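/- Let $\Omega\subset\mathbb R^3$ be a bounded open set with $C^\infty$ boundary, with surface measure $\sigma$ and exterior unit normal $\nu$ on $\partial\Omega$, and let $0<t_0<\infty$. Then there is a constant $C>0$, depending only on $\Omega$ and $t_0$, such that the following holds. Let $u$ be a real-valued function in $$C^0([0,t_0);H^1_0(\Omega))\cap C^1([0,t_0);L^2(\Omega))\cap L^5_{\mathrm{loc}}([0,t_0);L^{10}(\Omega))$$ which is a weak solution of the quintic wave equation with Dirichlet boundary condition, $$(\partial_t^2-\Delta)u+u^5=0\ \text{ in }(0,t_0)\times\Omega,\qquad u|_{(0,t_0)\times\partial\Omega}=0,$$ that is, $\int_0^{t_0}\!\int_\Omega(\nabla u\cdot\nabla_x\varphi-\partial_tu\,\partial_t\varphi+u^5\varphi)\,dx\,dt=0$ for all $\varphi\in C_c^\infty((0,t_0)\times\Omega)$, and let $$E(u)=\int_\Omega\Bigl(\frac{|\nabla u(0,x)|^2+|\partial_tu(0,x)|^2}{2}+\frac{|u(0,x)|^6}{6}\Bigr)dx$$ be its (conserved) energy. Then the trace of the exterior normal derivative $\partial u/\partial\nu$ on $(0,t_0)\times\partial\Omega$, defined through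 Green's formula $$\int_0^{t_0}\!\int_{\partial\Omega}\frac{\partial u}{\partial\nu}\,\varphi\,d\sigma\,dt=\int_0^{t_0}\!\int_\Omega\bigl(\nabla u\cdot\nabla_x\varphi-\partial_tu\,\partial_t\varphi+u^5\varphi\bigr)\,dx\,dt\qquad\text{for all }\varphi\in C_c^\infty((0,t_0)\times\mathbb R^3),$$ is a function in $L^2((0,t_0)\times\partial\Omega)$, and $$\Bigl\|\frac{\partial u}{\partial\nu}\Bigr\|_{L^2((0,t_0)\times\partial\Omega)}\le C\,E(u)^{1/2}.$$ -/

import Mathlib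

open MeasureTheory Set Filter Topology
open scoped ContDiff

namespace QuinticWave

noncomputable section

/-- Euclidean space `ℝ³`. -/
abbrev E3 : Type := EuclideanSpace ℝ (Fin 3)

/-- A bounded open set `Ω ⊆ ℝ³` with `C^∞` boundary: near every boundary point, `Ω` is the
sublevel set `{ρ < 0}` of a smooth function with non-vanishing gradient at that point, so that `∂Ω`
is a smooth hypersurface and `Ω` lies locally on one side of it. Connectedness is not required. -/
structure IsSmoothBoundedDomain (Ω : Set E3) : Prop where
  isOpen : IsOpen Ω
  isBounded : Bornology.IsBounded Ω
  smooth_boundary : ∀ p ∈ frontier Ω, ∃ ρ : E3 → ℝ, ContDiff ℝ ∞ ρ ∧ gradient ρ p ≠ 0 ∧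
    ∀ᶠ x in 𝓝 p, (x ∈ Ω ↔ ρ x < 0)

/-- The surface measure `σ` on `∂Ω`: the two-dimensional Hausdorff measure, normalized so that it
is the usual area. -/
def surfaceMeasure (Ω : Set E3) : Measure E3 :=
  (Measure.euclideanHausdorffMeasure 2 : Measure E3).restrict (frontier Ω)

/-- `dt ⊗ dσ` on `(0, t₀) × ∂Ω`. -/
def lateralMeasure (Ω : Set E3) (t₀ : ℝ) : Measure (ℝ × E3) :=
  (volume.restrict (Ioo 0 t₀)).prod (surfaceMeasure Ω)

/-- Real `L²(Ω)`. -/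
abbrev L2 (Ω : Set E3) : Type := Lp ℝ 2 (volume.restrict Ω)

/-- `L²(Ω; ℝ³)`. -/
abbrev L2Vec (Ω : Set E3) : Type := Lp E3 2 (volume.restrict Ω)

/-- `H¹₀(Ω)`: the closure of `C_c^∞(Ω)` in the `H¹` topology. A function is recorded together with
its weak gradient, i.e. `H¹₀(Ω)` is the closure in `L²(Ω) × L²(Ω; ℝ³)` of the space of the
pairs `(φ, ∇φ)`, `φ ∈ C_c^∞(Ω)`; it carries the topology of the `H¹` norm. -/
def H10 (Ω : Set E3) : Submodule ℝ (L2 Ω × L2Vec Ω) :=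
  (Submodule.span ℝ {p : L2 Ω × L2Vec Ω | ∃ φ : E3 → ℝ,
    ContDiff ℝ ∞ φ ∧ HasCompactSupport φ ∧ tsupport φ ⊆ Ω ∧
      p.1 =ᵐ[volume.restrict Ω] φ ∧ p.2 =ᵐ[volume.restrict Ω] gradient φ}).topologicalClosure

/-- The function underlying an element of `H¹₀(Ω)`. -/
def H10.fn {Ω : Set E3} (w : H10 Ω) : L2 Ω := w.1.1

/-- The weak gradient of an element of `H¹₀(Ω)`. -/
def H10.grad {Ω : Set E3} (w : H10 Ω) : L2Vec Ω := w.1.2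

/-- The space `C⁰([0,t₀); H¹₀(Ω)) ∩ C¹([0,t₀); L²(Ω)) ∩ L⁵_loc([0,t₀); L¹⁰(Ω))`, for a path `u`
with time derivative `v = ∂ₜu`. Only the values at times in `[0,t₀)` matter. -/
structure IsInX (Ω : Set E3) (t₀ : ℝ) (u : ℝ → H10 Ω) (v : ℝ → L2 Ω) : Prop where
  continuousOn : ContinuousOn u (Ico 0 t₀)
  continuousOn_deriv : ContinuousOn v (Ico 0 t₀)
  hasDeriv : ∀ t ∈ Ico 0 t₀, HasDerivWithinAt (fun s => H10.fn (u s)) (v t) (Ico 0 t₀) t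
  locally_L5_L10 : ∀ T ∈ Ioo 0 t₀,
    ∫⁻ t in Ioo 0 T, eLpNorm (H10.fn (u t)) 10 (volume.restrict Ω) ^ 5 < ⊤

/-- Smooth functions on `ℝ × ℝ³` with compact support contained in `S`. -/
def IsTest (S : Set (ℝ × E3)) (φ : ℝ × E3 → ℝ) : Prop :=
  ContDiff ℝ ∞ φ ∧ HasCompactSupport φ ∧ tsupport φ ⊆ S

/-- `∫₀^{t₀} ∫_Ω (∇u · ∇ₓφ - ∂ₜu ∂ₜφ + u⁵ φ) dx dt`, where `v = ∂ₜu`. -/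
def weakForm (Ω : Set E3) (t₀ : ℝ) (u : ℝ → H10 Ω) (v : ℝ → L2 Ω) (φ : ℝ × E3 → ℝ) : ℝ :=
  ∫ t in Ioo 0 t₀, ∫ x in Ω,
    (inner ℝ (H10.grad (u t) x) (gradient (fun y => φ (t, y)) x)
      - v t x * deriv (fun s => φ (s, x)) t
      + H10.fn (u t) x ^ 5 * φ (t, x))

/-- `u`, with `∂ₜu = v`, is a weak solution on `[0,t₀)`, in the class `IsInX`, of
`(∂ₜ² - Δ) u + u⁵ = 0` in `Ω`, `u = 0` on `∂Ω`. The boundary condition is contained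
in `u t ∈ H¹₀(Ω)`; the initial data are `(u 0, v 0)`. -/
structure IsWeakSolution (Ω : Set E3) (t₀ : ℝ) (u : ℝ → H10 Ω) (v : ℝ → L2 Ω) : Prop where
  isInX : IsInX Ω t₀ u v
  equation : ∀ φ, IsTest (Ioo 0 t₀ ×ˢ Ω) φ → weakForm Ω t₀ u v φ = 0

/-- The energy `∫_Ω ((|∇u|² + |∂ₜu|²) / 2 + |u|⁶ / 6) dx` of the state `(w, w') = (u, ∂ₜu)(t)`. -/
def energy (Ω : Set E3) (w : H10 Ω) (w' : L2 Ω) : ℝ :=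
  ∫ x in Ω, ((‖H10.grad w x‖ ^ 2 + |w' x| ^ 2) / 2 + |H10.fn w x| ^ 6 / 6)

/-- `g` is the trace on `(0,t₀) × ∂Ω` of the exterior normal derivative `∂u/∂ν` of a weak
solution `u`. As `Δu = ∂ₜ²u + u⁵`, Green's formula for the exterior normal `ν` reads
`∫∫_{(0,t₀)×∂Ω} (∂u/∂ν) φ dσ dt = ∫∫_{(0,t₀)×Ω} (∇u·∇ₓφ - ∂ₜu ∂ₜφ + u⁵ φ) dx dt`
for all `φ ∈ C_c^∞((0,t₀) × ℝ³)`, test functions that need not vanish on `∂Ω`. For solutions of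
finite energy this is the definition of the trace; it determines `g` up to null sets. -/
def IsNormalDerivTrace (Ω : Set E3) (t₀ : ℝ) (u : ℝ → H10 Ω) (v : ℝ → L2 Ω)
    (g : ℝ × E3 → ℝ) : Prop :=
  ∀ φ, IsTest (Ioo 0 t₀ ×ˢ univ) φ →
    Integrable (fun z => g z * φ z) (lateralMeasure Ω t₀) ∧
      ∫ z, g z * φ z ∂(lateralMeasure Ω t₀) = weakForm Ω t₀ u v φ

end

end QuinticWave

/-! Formally this is Rellich's identity: test the equation with X·∇u, where X is a vector field
transversal to ∂Ω. The boundary term controls |∂u/∂ν|², and everything else is bounded by the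
energy. A finite energy solution lacks the second derivatives for this computation, so the
multiplier is replaced by a difference quotient k χ (u − u_a), where u_a = u(· − a), a = τe, k =
1/τ, χ is a cutoff near a boundary point and e is a fixed inward direction. Near that point
translation by a carries Ω into itself, so the multiplier stays in H¹₀ (`IsCutoff.diffOp_mem`).

Every term is then treated by algebra. For the gradient, 2f(f − f_a) = f² − f_a² + (f − f_a)². After
a translation the first two squares leave only χ − χ(· + a) = O(τ), and the last square is a gain.
The same identity handles ∂ₜu after integration by parts in time; there the last square has the
wrong sign, but it is O(τ) for a solution regularized in time. Convexity of s⁶ bounds u⁵(u − u_a)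
below by an increment of u⁶/6, which is again moved onto χ. The outcome is `IsSol.integral_incr_le`:
the integral of τ⁻¹ χ |∇u − (∇u)_a|² is bounded by the energy, up to vanishing errors. In a boundary
layer of depth at most τ the translated gradient is zero, so τ⁻¹ ∫ |∇u|² over the layer is bounded.
This replaces the boundary integral of |∂u/∂ν|².

Time regularity comes from Steklov averages, which are differentiable in time with values in H¹₀.
They do not commute with the nonlinearity; but u ∈ L⁵L¹⁰ puts u⁵ in L¹(L²), so moving a test
function to a nearby time costs only a modulus of continuity times `IsSol.nlBound`. Together with
convexity this also gives the energy inequality `IsSol.en_le`; conservation is not needed.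

For the trace, split φ = (1 − θ)φ + θφ with θ = 1 near ∂Ω and θ = 0 deeper than the layer. The first
part is an admissible test function and contributes nothing. In the second the gradient is O(1) +
O(|φ|/τ), and Young's inequality with weight μ leaves μ τ⁻¹ ∫ |∇u|² and μ⁻¹ τ⁻¹ ∫ φ² over the layer.
The latter is controlled by the surface integral of φ², because the boundary is locally a Lipschitz
graph. Letting τ → 0 (`exists_patch_bound`), summing over finitely many patches
(`exists_greenBound`), letting ε → 0 and optimizing μ bounds the weak form by C E(u)^{1/2} times the
L² norm of φ on (0,t₀) × ∂Ω (`abs_weakForm_le`). Riesz representation then yields the trace. -/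

namespace QuinticWave

noncomputable section

/-! ### Operators on `Lᵖ(ℝ³)` -/

/-- Real `L²(ℝ³)`. -/
abbrev H : Type := Lp ℝ 2 (volume : Measure E3)

/-- `L²(ℝ³; ℝ³)`. -/
abbrev G : Type := Lp E3 2 (volume : Measure E3)

/-- Real `L⁶(ℝ³)`. -/
abbrev L6 : Type := Lp ℝ 6 (volume : Measure E3)

instance fact_one_le_six : Fact ((1 : ENNReal) ≤ 6) := ⟨by norm_num⟩

section Operators

variable {F' : Type*} [NormedAddCommGroup F'] {F : Type*} [NormedAddCommGroup F] [NormedSpace ℝ F]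

theorem indicator_ae_congr {Ω : Set E3} (hΩ : MeasurableSet Ω) {f g : E3 → F'}
    (h : f =ᵐ[volume.restrict Ω] g) : Ω.indicator f =ᵐ[volume] Ω.indicator g := by
  filter_upwards [(ae_restrict_iff' hΩ).1 h] with x hx
  by_cases hxΩ : x ∈ Ω
  · simp [hxΩ, hx hxΩ]
  · simp [hxΩ]

/-- Extension by zero of an `L²` function on `Ω`. -/
def extZero {Ω : Set E3} (hΩ : MeasurableSet Ω) :
    Lp F 2 (volume.restrict Ω) →ₗᵢ[ℝ] Lp F 2 (volume : Measure E3) where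
  toFun f := MemLp.toLp (Ω.indicator f) ((memLp_indicator_iff_restrict hΩ).2 (Lp.memLp f))
  map_add' f g := by
    rw [← MemLp.toLp_add]
    refine MemLp.toLp_congr _ _ ?_
    rw [← indicator_add']
    exact indicator_ae_congr hΩ (Lp.coeFn_add f g)
  map_smul' c f := by
    simp only [RingHom.id_apply]
    rw [← MemLp.toLp_const_smul]
    refine MemLp.toLp_congr _ _ ((indicator_ae_congr hΩ (Lp.coeFn_smul c f)).trans
      (Eventually.of_forall fun x => ?_))
    by_cases hx : x ∈ Ω <;> simp [hx]
  norm_map' f := by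
    simp only [LinearMap.coe_mk, AddHom.coe_mk, Lp.norm_toLp]
    rw [eLpNorm_indicator_eq_eLpNorm_restrict hΩ, Lp.norm_def]

theorem coeFn_extZero {Ω : Set E3} (hΩ : MeasurableSet Ω) (f : Lp F 2 (volume.restrict Ω)) :
    extZero hΩ f =ᵐ[volume] Ω.indicator f := by
  have h : extZero hΩ f =
    MemLp.toLp (Ω.indicator f) ((memLp_indicator_iff_restrict hΩ).2 (Lp.memLp f)) := rfl
  rw [h]
  exact MemLp.coeFn_toLp _

/-- Multiplication by a bounded function. -/
def mulOp {χ : E3 → ℝ} (hχ : MemLp χ ⊤ volume) :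
    Lp F 2 (volume : Measure E3) →L[ℝ] Lp F 2 (volume : Measure E3) :=
  (ContinuousLinearMap.lsmul ℝ ℝ : ℝ →L[ℝ] F →L[ℝ] F).holderL volume ⊤ 2 2 (hχ.toLp χ)

theorem coeFn_mulOp {χ : E3 → ℝ} (hχ : MemLp χ ⊤ volume) (f : Lp F 2 (volume : Measure E3)) :
    mulOp hχ f =ᵐ[volume] fun x => χ x • f x := by
  have h := (ContinuousLinearMap.lsmul ℝ ℝ : ℝ →L[ℝ] F →L[ℝ] F).coeFn_holder (r := 2)
    (hχ.toLp χ) f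
  filter_upwards [h, hχ.coeFn_toLp] with x h1 h2
  simp only [mulOp, ContinuousLinearMap.holderL_apply_apply]
  rw [h1, h2]; rfl

/-- Multiplication of a scalar function by a bounded vector field. -/
def vecMulOp {ξ : E3 → E3} (hξ : MemLp ξ ⊤ volume) : H →L[ℝ] G :=
  (ContinuousLinearMap.lsmul ℝ ℝ : ℝ →L[ℝ] E3 →L[ℝ] E3).flip.holderL volume ⊤ 2 2 (hξ.toLp ξ)

theorem coeFn_vecMulOp {ξ : E3 → E3} (hξ : MemLp ξ ⊤ volume) (f : H) :
    vecMulOp hξ f =ᵐ[volume] fun x => f x • ξ x := by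
  have h := (ContinuousLinearMap.lsmul ℝ ℝ : ℝ →L[ℝ] E3 →L[ℝ] E3).flip.coeFn_holder (r := 2)
    (hξ.toLp ξ) f
  filter_upwards [h, hξ.coeFn_toLp] with x h1 h2
  simp only [vecMulOp, ContinuousLinearMap.holderL_apply_apply]
  rw [h1, h2]; rfl

/-- Translation by `a`: `f ↦ f (· - a)`. -/
def transOp (a : E3) : Lp F 2 (volume : Measure E3) →ₗᵢ[ℝ] Lp F 2 (volume : Measure E3) :=
  Lp.compMeasurePreservingₗᵢ ℝ (fun x => x - a) (measurePreserving_sub_right volume a)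

theorem coeFn_transOp (a : E3) (f : Lp F 2 (volume : Measure E3)) :
    transOp a f =ᵐ[volume] fun x => f (x - a) :=
  Lp.coeFn_compMeasurePreserving f (measurePreserving_sub_right volume a)

theorem norm_mulOp_le {χ : E3 → ℝ} (hχ : MemLp χ ⊤ volume) {C : ℝ} (hC : ∀ x, |χ x| ≤ C)
    (f : Lp F 2 (volume : Measure E3)) : ‖mulOp hχ f‖ ≤ C * ‖f‖ := by
  refine Lp.norm_le_mul_norm_of_ae_le_mul ?_
  filter_upwards [coeFn_mulOp hχ f] with x hx
  rw [hx, norm_smul]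
  gcongr
  exact hC x

theorem norm_vecMulOp_le {ξ : E3 → E3} (hξ : MemLp ξ ⊤ volume) {C : ℝ} (hC : ∀ x, ‖ξ x‖ ≤ C)
    (f : H) : ‖vecMulOp hξ f‖ ≤ C * ‖f‖ := by
  refine Lp.norm_le_mul_norm_of_ae_le_mul ?_
  filter_upwards [coeFn_vecMulOp hξ f] with x hx
  rw [hx, norm_smul, mul_comm]
  gcongr
  exact hC x

end Operators

theorem ae_comp_sub {p : E3 → Prop} (a : E3) (h : ∀ᵐ x : E3, p x) : ∀ᵐ x : E3, p (x - a) :=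
  (measurePreserving_sub_right volume a).quasiMeasurePreserving.ae h

theorem memLp_top_of_bounded {F : Type*} [NormedAddCommGroup F] [SecondCountableTopology F]
    {f : E3 → F} (hf : Continuous f) {C : ℝ} (hC : ∀ x, ‖f x‖ ≤ C) : MemLp f ⊤ volume :=
  memLp_top_of_bound hf.aestronglyMeasurable C (Eventually.of_forall hC)

/-! ### The quintic pairing -/

instance holderTriple_663 : ENNReal.HolderTriple 6 6 3 where
  inv_add_inv_eq_inv := by
    rw [show (6 : ENNReal) = 2 * 3 by norm_num, ENNReal.mul_inv (by simp) (by simp), ← add_mul,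
      ENNReal.inv_two_add_inv_two, one_mul]

instance fact_one_le_three : Fact ((1 : ENNReal) ≤ 3) := ⟨by norm_num⟩

instance holderTriple_362 : ENNReal.HolderTriple 3 6 2 where
  inv_add_inv_eq_inv := by
    have h6 : (6 : ENNReal)⁻¹ = ENNReal.ofReal (1/6) := by
      rw [one_div, ENNReal.ofReal_inv_of_pos (by norm_num)]; norm_num
    have h3 : (3 : ENNReal)⁻¹ = ENNReal.ofReal (1/3) := by
      rw [one_div, ENNReal.ofReal_inv_of_pos (by norm_num)]; norm_num
    have h2 : (2 : ENNReal)⁻¹ = ENNReal.ofReal (1/2) := by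
      rw [one_div, ENNReal.ofReal_inv_of_pos (by norm_num)]; norm_num
    rw [h6, h3, h2, ← ENNReal.ofReal_add (by norm_num) (by norm_num)]
    norm_num

/-- Multiplication `L⁶ × L⁶ → L³`. -/
def mul66 : L6 →L[ℝ] L6 →L[ℝ] Lp ℝ 3 (volume : Measure E3) :=
  (ContinuousLinearMap.mul ℝ ℝ).holderL volume 6 6 3

/-- Multiplication `L³ × L⁶ → L²`. -/
def mul36 : Lp ℝ 3 (volume : Measure E3) →L[ℝ] L6 →L[ℝ] H :=
  (ContinuousLinearMap.mul ℝ ℝ).holderL volume 3 6 2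

/-- The pairing `∫ a⁵ b` of functions in `L⁶(ℝ³)`. -/
def quint (a b : L6) : ℝ := inner ℝ (mul36 (mul66 a a) a) (mul36 (mul66 a a) b)

theorem coeFn_mul36 (a b c : L6) :
    mul36 (mul66 a b) c =ᵐ[volume] fun x => a x * b x * c x := by
  have h := (ContinuousLinearMap.mul ℝ ℝ).coeFn_holder (r := 2) (mul66 a b) c
  have h' := (ContinuousLinearMap.mul ℝ ℝ).coeFn_holder (r := 3) a b
  filter_upwards [h, h'] with x h1 h2
  simp only [mul36, ContinuousLinearMap.holderL_apply_apply]
  rw [h1]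
  simp only [mul66, ContinuousLinearMap.holderL_apply_apply]
  rw [h2]; rfl

theorem integrable_quint (a b : L6) : Integrable (fun x => a x ^ 5 * b x) (volume : Measure E3) := by
  refine (L2.integrable_inner (𝕜 := ℝ) (mul36 (mul66 a a) a) (mul36 (mul66 a a) b)).congr ?_
  filter_upwards [coeFn_mul36 a a a, coeFn_mul36 a a b] with x h1 h2
  rw [h1, h2]
  simp only [RCLike.inner_apply, conj_trivial]
  ring

theorem quint_eq (a b : L6) : quint a b = ∫ x, a x ^ 5 * b x := by
  rw [quint, L2.inner_def]
  refine integral_congr_ae ?_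
  filter_upwards [coeFn_mul36 a a a, coeFn_mul36 a a b] with x h1 h2
  rw [h1, h2]
  simp only [RCLike.inner_apply, conj_trivial]
  ring

/-- Immediate from the chosen factorization a⁵b = a³ · a²b: both factors are bounded multilinear
expressions with values in L². -/
theorem continuous_quint : Continuous fun p : L6 × L6 => quint p.1 p.2 := by
  unfold quint
  fun_prop

theorem quint_add (a b c : L6) : quint a (b + c) = quint a b + quint a c := by
  simp [quint, inner_add_right]

theorem quint_sub (a b c : L6) : quint a (b - c) = quint a b - quint a c := by
  simp [quint, inner_sub_right]

theorem quint_smul (a b : L6) (k : ℝ) : quint a (k • b) = k * quint a b := by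
  simp [quint, inner_smul_right]

theorem norm_mul36_le (a b : L6) : ‖mul36 (mul66 a a) b‖ ≤ ‖a‖ ^ 2 * ‖b‖ := by
  have h1 : ‖mul36 (mul66 a a) b‖ ≤ ‖mul66 a a‖ * ‖b‖ := by
    have := (ContinuousLinearMap.mul ℝ ℝ).norm_holder_apply_apply_le (r := 2) (mul66 a a) b
    simpa [mul36] using this
  have h2 : ‖mul66 a a‖ ≤ ‖a‖ * ‖a‖ := by
    have := (ContinuousLinearMap.mul ℝ ℝ).norm_holder_apply_apply_le (r := 3) a a
    simpa [mul66] using this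
  calc _ ≤ ‖mul66 a a‖ * ‖b‖ := h1
    _ ≤ (‖a‖ * ‖a‖) * ‖b‖ := by gcongr
    _ = _ := by ring

theorem abs_quint_le (a b : L6) : |quint a b| ≤ ‖a‖ ^ 5 * ‖b‖ := by
  refine (abs_real_inner_le_norm _ _).trans ?_
  calc _ ≤ (‖a‖ ^ 2 * ‖a‖) * (‖a‖ ^ 2 * ‖b‖) := by
        gcongr <;> exact norm_mul36_le _ _
    _ = _ := by ring

/-! ### Paths in `Lᵖ` given by smooth functions of time and space -/

section Paths

variable {F : Type*} [NormedAddCommGroup F] {p : ENNReal}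

theorem norm_toLp_le {f : E3 → F} (hf : MemLp f p volume) {K : Set E3}
    (hKm : MeasurableSet K) (hK : volume K ≠ ⊤) {c : ℝ} (hc : 0 ≤ c) (hb : ∀ x ∈ K, ‖f x‖ ≤ c)
    (h0 : ∀ x ∉ K, f x = 0) : ‖hf.toLp f‖ ≤ c * volume.real K ^ (1 / p.toReal) := by
  have h1 : ‖hf.toLp f‖ ≤ ‖indicatorConstLp p hKm hK c‖ := by
    refine Lp.norm_le_norm_of_ae_le ?_
    filter_upwards [hf.coeFn_toLp, indicatorConstLp_coeFn (p := p) (hs := hKm) (hμs := hK) (c := c)]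
      with x h1 h2
    rw [h1, h2]
    by_cases hx : x ∈ K
    · simpa [hx, abs_of_nonneg hc] using hb x hx
    · simp [hx, h0 x hx]
  refine h1.trans (norm_indicatorConstLp_le.trans ?_)
  rw [Real.norm_of_nonneg hc]

theorem memLp_of_compact {f : E3 → F} (hf : Continuous f) (h : HasCompactSupport f) :
    MemLp f p volume := hf.memLp_of_hasCompactSupport h

/-- Slices of functions with compact support have a common compact support. -/
theorem exists_compact_slices {ψ : ℝ × E3 → F} (h : HasCompactSupport ψ) :
    ∃ K : Set E3, IsCompact K ∧ ∀ t, ∀ x ∉ K, ψ (t, x) = 0 := by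
  refine ⟨Prod.snd '' tsupport ψ, h.isCompact.image continuous_snd, fun t x hx => ?_⟩
  by_contra hne
  exact hx ⟨(t, x), subset_tsupport _ hne, rfl⟩

theorem slice_continuous {ψ : ℝ × E3 → F} (hc : Continuous ψ) (t : ℝ) :
    Continuous fun x => ψ (t, x) := by fun_prop

theorem slice_hasCompactSupport {ψ : ℝ × E3 → F} (h : HasCompactSupport ψ) (t : ℝ) :
    HasCompactSupport fun x => ψ (t, x) := by
  obtain ⟨K, hK, h0⟩ := exists_compact_slices h
  exact HasCompactSupport.intro hK (h0 t)

theorem slice_memLp {ψ : ℝ × E3 → F} (hc : Continuous ψ) (h : HasCompactSupport ψ) (t : ℝ) :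
    MemLp (fun x => ψ (t, x)) p volume :=
  memLp_of_compact (slice_continuous hc t) (slice_hasCompactSupport h t)

variable [Fact (1 ≤ p)]

/-- The slice at time `t` as an element of `Lᵖ`. -/
def slice (p : ENNReal) [Fact (1 ≤ p)] {ψ : ℝ × E3 → F} (hc : Continuous ψ)
    (h : HasCompactSupport ψ) (t : ℝ) : Lp F p (volume : Measure E3) :=
  (slice_memLp hc h t).toLp _

theorem coeFn_slice {ψ : ℝ × E3 → F} (hc : Continuous ψ) (h : HasCompactSupport ψ) (t : ℝ) :
    slice p hc h t =ᵐ[volume] fun x => ψ (t, x) := MemLp.coeFn_toLp _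

theorem continuous_slice {ψ : ℝ × E3 → F} (hc : Continuous ψ)
    (h : HasCompactSupport ψ) : Continuous (slice p hc h) := by
  obtain ⟨K, hK, h0⟩ := exists_compact_slices h
  have hu : UniformContinuous ψ := h.uniformContinuous_of_continuous hc
  rw [Metric.uniformContinuous_iff] at hu
  rw [Metric.continuous_iff]
  intro t ε hε
  set A := volume.real K ^ (1 / p.toReal)
  have hA : 0 ≤ A := by positivity
  obtain ⟨δ, hδ, hd⟩ := hu (ε / (A + 1)) (by positivity)
  refine ⟨δ, hδ, fun s hs => ?_⟩
  rw [dist_eq_norm, slice, slice, ← MemLp.toLp_sub]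
  have := norm_toLp_le ((slice_memLp hc h s).sub (slice_memLp (p := p) hc h t))
    hK.measurableSet hK.measure_lt_top.ne (c := ε / (A + 1)) (by positivity) (fun x _ => by
      have := hd (a := (s, x)) (b := (t, x)) (by simpa [Prod.dist_eq, hδ] using hs)
      rw [dist_eq_norm] at this
      exact this.le) (fun x hx => by simp [h0 _ x hx])
  refine this.trans_lt ?_
  rw [div_mul_eq_mul_div, div_lt_iff₀ (by positivity)]
  nlinarith

variable [NormedSpace ℝ F]

/-- The mean value inequality for r ↦ ψ r x − r • ψ' t x bounds the remainder uniformly in x. The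
common support K of finite measure turns the uniform bound into an Lᵖ bound. -/
theorem hasDerivAt_toLp {ψ ψ' : ℝ → E3 → F} (hψ : ∀ t, MemLp (ψ t) p volume)
    (hψ' : ∀ t, MemLp (ψ' t) p volume) (hd : ∀ s x, HasDerivAt (fun r => ψ r x) (ψ' s x) s)
    {t : ℝ} {K : Set E3} (hKm : MeasurableSet K) (hK : volume K ≠ ⊤)
    (h0 : ∀ᶠ s in 𝓝 t, ∀ x ∉ K, ψ s x = 0)
    (hu : ∀ ε > 0, ∀ᶠ s in 𝓝 t, ∀ x, ‖ψ' s x - ψ' t x‖ ≤ ε) :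
    HasDerivAt (fun s => (hψ s).toLp (ψ s)) ((hψ' t).toLp (ψ' t)) t := by
  rw [hasDerivAt_iff_isLittleO, Asymptotics.isLittleO_iff]
  intro c hc
  set A := volume.real K ^ (1 / p.toReal)
  have hA : 0 ≤ A := by positivity
  have h0' : ∀ x ∉ K, ψ' t x = 0 := by
    intro x hx
    refine (hd t x).unique ?_
    have : (fun r => ψ r x) =ᶠ[𝓝 t] fun _ => 0 := by
      filter_upwards [h0] with s hs using hs x hx
    exact (hasDerivAt_const t (0 : F)).congr_of_eventuallyEq this
  -- The denominator is A + 1 because A may vanish.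
  obtain ⟨δ, hδ, hb⟩ := Metric.eventually_nhds_iff_ball.1 (hu (c / (A + 1)) (by positivity))
  filter_upwards [h0, Metric.ball_mem_nhds t hδ] with s hs hsδ
  have h0t := h0.self_of_nhds
  rw [← MemLp.toLp_sub, ← MemLp.toLp_const_smul, ← MemLp.toLp_sub]
  have := norm_toLp_le (((hψ s).sub (hψ t)).sub ((hψ' t).const_smul (s - t))) hKm hK
    (c := c / (A + 1) * ‖s - t‖) (by positivity) (fun x _ => by
      have := (convex_ball t δ).norm_image_sub_le_of_norm_hasDerivWithin_le
        (f := fun r => ψ r x - r • ψ' t x) (f' := fun r => ψ' r x - ψ' t x) (C := c / (A + 1))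
        (fun r _ => by
          have := ((hd r x).sub ((hasDerivAt_id r).smul_const (ψ' t x)))
          simpa using! this.hasDerivWithinAt)
        (fun r hr => hb r hr x) (Metric.mem_ball_self hδ) hsδ
      refine le_trans (le_of_eq ?_) this
      simp only [Pi.sub_apply, Pi.smul_apply, sub_smul]
      congr 1
      abel) (fun x hx => by simp [hs x hx, h0t x hx, h0' x hx])
  refine this.trans ?_
  have h2 : c / (A + 1) * A ≤ c := by
    rw [div_mul_eq_mul_div, div_le_iff₀ (by positivity)]
    nlinarith
  calc c / (A + 1) * ‖s - t‖ * A = (c / (A + 1) * A) * ‖s - t‖ := by ring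
    _ ≤ _ := by gcongr

theorem hasDerivAt_slice {ψ ψ' : ℝ × E3 → F} (hc : Continuous ψ)
    (h : HasCompactSupport ψ) (hc' : Continuous ψ') (h' : HasCompactSupport ψ')
    (hd : ∀ s x, HasDerivAt (fun r => ψ (r, x)) (ψ' (s, x)) s) (t : ℝ) :
    HasDerivAt (slice p hc h) (slice p hc' h' t) t := by
  obtain ⟨K, hK, h0⟩ := exists_compact_slices h
  refine hasDerivAt_toLp (ψ := fun s x => ψ (s, x)) (ψ' := fun s x => ψ' (s, x))
    (slice_memLp hc h) (slice_memLp hc' h') hd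
    hK.measurableSet hK.measure_lt_top.ne (Eventually.of_forall h0) fun ε hε => ?_
  have hu : UniformContinuous ψ' := h'.uniformContinuous_of_continuous hc'
  obtain ⟨δ, hδ, hdd⟩ := Metric.uniformContinuous_iff.1 hu ε hε
  filter_upwards [Metric.ball_mem_nhds t hδ] with s hs x
  have := hdd (a := (s, x)) (b := (t, x)) (by simpa [Prod.dist_eq, hδ] using hs)
  rw [dist_eq_norm] at this
  exact this.le

end Paths

/-! ### The space `H¹₀` inside `L²(ℝ³) × L²(ℝ³; ℝ³)` -/

theorem gradient_def (f : E3 → ℝ) (x : E3) :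
    gradient f x = (InnerProductSpace.toDual ℝ E3).symm (fderiv ℝ f x) := rfl

theorem norm_gradient (f : E3 → ℝ) (x : E3) : ‖gradient f x‖ = ‖fderiv ℝ f x‖ := by
  rw [gradient_def, LinearIsometryEquiv.norm_map]

theorem continuous_gradient {f : E3 → ℝ} (hf : ContDiff ℝ ∞ f) : Continuous (gradient f) := by
  have : Continuous (fderiv ℝ f) := hf.continuous_fderiv (by simp)
  exact (InnerProductSpace.toDual ℝ E3).symm.continuous.comp this

theorem hasCompactSupport_gradient {f : E3 → ℝ} (hf : HasCompactSupport f) :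
    HasCompactSupport (gradient f) := by
  refine (hf.fderiv (𝕜 := ℝ)).mono fun x hx => ?_
  rw [Function.mem_support] at hx ⊢
  intro h
  apply hx
  rw [gradient_def, h, map_zero]

/-- `C_c^∞(Ω)`. -/
def IsTestFn (Ω : Set E3) (φ : E3 → ℝ) : Prop :=
  ContDiff ℝ ∞ φ ∧ HasCompactSupport φ ∧ tsupport φ ⊆ Ω

theorem IsTestFn.differentiable {Ω : Set E3} {φ : E3 → ℝ} (h : IsTestFn Ω φ) :
    Differentiable ℝ φ := h.1.differentiable (by simp)

theorem IsTestFn.add {Ω : Set E3} {φ ψ : E3 → ℝ} (h : IsTestFn Ω φ) (h' : IsTestFn Ω ψ) :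
    IsTestFn Ω (φ + ψ) :=
  ⟨h.1.add h'.1, h.2.1.add h'.2.1, (tsupport_add _ _).trans (union_subset h.2.2 h'.2.2)⟩

theorem IsTestFn.smul {Ω : Set E3} {φ : E3 → ℝ} (h : IsTestFn Ω φ) (c : ℝ) :
    IsTestFn Ω (c • φ) :=
  ⟨contDiff_const.smul h.1, h.2.1.smul_left (f := fun _ => c),
    (tsupport_smul_subset_right (fun _ => c) φ).trans h.2.2⟩

theorem gradient_add_fn {φ ψ : E3 → ℝ} (h : Differentiable ℝ φ) (h' : Differentiable ℝ ψ) :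
    gradient (φ + ψ) = gradient φ + gradient ψ := by
  ext1 x
  simp only [gradient_def, Pi.add_apply]
  rw [fderiv_add (h x) (h' x), map_add]

theorem gradient_smul_fn {φ : E3 → ℝ} (h : Differentiable ℝ φ) (c : ℝ) :
    gradient (c • φ) = c • gradient φ := by
  ext1 x
  simp only [gradient_def, Pi.smul_apply]
  rw [fderiv_const_smul (h x), map_smul]

theorem gradient_mul_fn {φ ψ : E3 → ℝ} (h : Differentiable ℝ φ) (h' : Differentiable ℝ ψ) (x : E3) :
    gradient (fun y => φ y * ψ y) x = φ x • gradient ψ x + ψ x • gradient φ x := by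
  simp only [gradient_def]
  rw [fderiv_fun_mul (h x) (h' x), map_add, map_smul, map_smul]

/-- Pairs `(φ, ∇φ)` with `φ ∈ C_c^∞(Ω)`. -/
def testPairs (Ω : Set E3) : Submodule ℝ (H × G) where
  carrier := {p | ∃ φ, IsTestFn Ω φ ∧ p.1 =ᵐ[volume] φ ∧ p.2 =ᵐ[volume] gradient φ}
  add_mem' := by
    rintro p q ⟨φ, h, h1, h2⟩ ⟨ψ, h', h1', h2'⟩
    refine ⟨φ + ψ, h.add h', (Lp.coeFn_add _ _).trans (h1.add h1'), ?_⟩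
    rw [gradient_add_fn h.differentiable h'.differentiable]
    exact (Lp.coeFn_add _ _).trans (h2.add h2')
  zero_mem' := by
    refine ⟨0, ⟨contDiff_const, HasCompactSupport.zero, by simp [tsupport]⟩, Lp.coeFn_zero _ _ _, ?_⟩
    have : gradient (0 : E3 → ℝ) = 0 := by
      ext1 x; exact gradient_const (𝕜 := ℝ) (F := E3) x (0 : ℝ)
    rw [this]
    exact Lp.coeFn_zero _ _ _
  smul_mem' := by
    rintro c p ⟨φ, h, h1, h2⟩
    refine ⟨c • φ, h.smul c, (Lp.coeFn_smul _ _).trans (h1.const_smul c), ?_⟩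
    rw [gradient_smul_fn h.differentiable]
    exact (Lp.coeFn_smul _ _).trans (h2.const_smul c)

/-- `H¹₀(Ω)`, as a space of pairs of functions on `ℝ³`. -/
def VSub (Ω : Set E3) : Submodule ℝ (H × G) := (testPairs Ω).topologicalClosure

instance (Ω : Set E3) : CompleteSpace (VSub Ω) :=
  inferInstanceAs (CompleteSpace (testPairs Ω).topologicalClosure)

theorem VSub_induction {Ω : Set E3} {P : H × G → Prop} (hc : IsClosed {x | P x})
    (h : ∀ x ∈ testPairs Ω, P x) {x : H × G} (hx : x ∈ VSub Ω) : P x := by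
  have : closure (testPairs Ω : Set (H × G)) ⊆ {x | P x} := hc.closure_subset_iff.2 h
  exact this hx

theorem mem_VSub_of_map {Ω' : Set E3} {X : Type*} [NormedAddCommGroup X] [NormedSpace ℝ X]
    {S : Set X} (M : X →L[ℝ] H × G) (h : ∀ x ∈ S, M x ∈ testPairs Ω') {x : X}
    (hx : x ∈ closure S) : M x ∈ VSub Ω' := by
  have h1 : closure S ⊆ M ⁻¹' (closure (testPairs Ω' : Set (H × G))) :=
    (isClosed_closure.preimage M.continuous).closure_subset_iff.2 fun y hy => subset_closure (h y hy)
  exact h1 hx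

theorem IsTestFn.memLp {Ω : Set E3} {φ : E3 → ℝ} (h : IsTestFn Ω φ) (p : ENNReal) :
    MemLp φ p volume := memLp_of_compact h.1.continuous h.2.1

theorem IsTestFn.memLp_gradient {Ω : Set E3} {φ : E3 → ℝ} (h : IsTestFn Ω φ) (p : ENNReal) :
    MemLp (gradient φ) p volume :=
  memLp_of_compact (continuous_gradient h.1) (hasCompactSupport_gradient h.2.1)

theorem IsTestFn.mem_testPairs {Ω : Set E3} {φ : E3 → ℝ} (h : IsTestFn Ω φ) :
    (((h.memLp 2).toLp φ, (h.memLp_gradient 2).toLp (gradient φ)) : H × G) ∈ testPairs Ω :=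
  ⟨φ, h, (h.memLp 2).coeFn_toLp, (h.memLp_gradient 2).coeFn_toLp⟩

theorem IsTestFn.mem_VSub {Ω : Set E3} {φ : E3 → ℝ} (h : IsTestFn Ω φ) :
    (((h.memLp 2).toLp φ, (h.memLp_gradient 2).toLp (gradient φ)) : H × G) ∈ VSub Ω :=
  Submodule.le_topologicalClosure _ h.mem_testPairs

theorem eq_zero_of_notMem_tsupport_gradient {φ : E3 → ℝ} {x : E3} (hx : x ∉ tsupport φ) :
    gradient φ x = 0 := by
  have h : fderiv ℝ φ x = 0 := by
    by_contra hne
    exact hx (support_fderiv_subset ℝ hne)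
  rw [gradient_def, h, map_zero]

/-! #### Comparison with `H10` -/

/-- Extension by zero of a pair. -/
def extPair {Ω : Set E3} (hΩ : MeasurableSet Ω) : L2 Ω × L2Vec Ω →L[ℝ] H × G :=
  (extZero hΩ).toContinuousLinearMap.prodMap (extZero hΩ).toContinuousLinearMap

theorem extPair_mem {Ω : Set E3} (hΩ : MeasurableSet Ω) (w : H10 Ω) :
    extPair hΩ w.1 ∈ VSub Ω := by
  have key : Submodule.span ℝ {p : L2 Ω × L2Vec Ω | ∃ φ : E3 → ℝ,
      ContDiff ℝ ∞ φ ∧ HasCompactSupport φ ∧ tsupport φ ⊆ Ω ∧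
      p.1 =ᵐ[volume.restrict Ω] φ ∧ p.2 =ᵐ[volume.restrict Ω] gradient φ} ≤
      (testPairs Ω).comap (extPair hΩ).toLinearMap := by
    rw [Submodule.span_le]
    rintro p ⟨φ, h1, h2, h3, h4, h5⟩
    refine ⟨φ, ⟨h1, h2, h3⟩, ?_, ?_⟩
    · refine (coeFn_extZero hΩ p.1).trans ((indicator_ae_congr hΩ h4).trans
        (Eventually.of_forall fun x => ?_))
      by_cases hx : x ∈ Ω
      · simp [hx]
      · simp [hx, image_eq_zero_of_notMem_tsupport fun h => hx (h3 h)]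
    · refine (coeFn_extZero hΩ p.2).trans ((indicator_ae_congr hΩ h5).trans
        (Eventually.of_forall fun x => ?_))
      by_cases hx : x ∈ Ω
      · simp [hx]
      · simp [hx, eq_zero_of_notMem_tsupport_gradient fun h => hx (h3 h)]
  exact mem_VSub_of_map (extPair hΩ) (fun x hx => key hx) w.2

/-- `H¹₀(Ω)` embedded in `L²(ℝ³) × L²(ℝ³; ℝ³)`. -/
def h10ToV {Ω : Set E3} (hΩ : MeasurableSet Ω) : H10 Ω →L[ℝ] VSub Ω :=
  ((extPair hΩ).comp (H10 Ω).subtypeL).codRestrict (VSub Ω) (extPair_mem hΩ)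

/-! #### Vanishing outside the domain -/

theorem memLp_top_indicator {S : Set E3} (hS : MeasurableSet S) :
    MemLp (S.indicator fun _ => (1 : ℝ)) ⊤ (volume : Measure E3) :=
  (memLp_top_const (1 : ℝ)).indicator hS

theorem mulOp_indicator_eq_zero_iff {F : Type*} [NormedAddCommGroup F] [NormedSpace ℝ F]
    {Ω : Set E3} (hΩ : MeasurableSet Ω) (f : Lp F 2 (volume : Measure E3)) :
    mulOp (memLp_top_indicator hΩ.compl) f = 0 ↔ ∀ᵐ x : E3, x ∉ Ω → f x = 0 := by
  rw [Lp.eq_zero_iff_ae_eq_zero]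
  constructor
  · intro h
    filter_upwards [h, coeFn_mulOp (memLp_top_indicator hΩ.compl) f] with x h1 h2 hx
    rw [h2] at h1
    simpa [hx] using h1
  · intro h
    filter_upwards [h, coeFn_mulOp (memLp_top_indicator hΩ.compl) f] with x h1 h2
    rw [h2]
    by_cases hx : x ∈ Ω
    · simp [hx]
    · simp [h1 hx]

/-- Vanishing off Ω means lying in the kernel of multiplication by the indicator of the complement.
This is a closed condition, so it passes from test pairs to their closure. -/
theorem VSub_ae_zero {Ω : Set E3} (hΩ : MeasurableSet Ω) {x : H × G} (hx : x ∈ VSub Ω) :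
    (∀ᵐ y : E3, y ∉ Ω → x.1 y = 0) ∧ ∀ᵐ y : E3, y ∉ Ω → x.2 y = 0 := by
  rw [← mulOp_indicator_eq_zero_iff hΩ, ← mulOp_indicator_eq_zero_iff hΩ]
  refine VSub_induction (P := fun x : H × G => mulOp (memLp_top_indicator hΩ.compl) x.1 = 0 ∧
    mulOp (memLp_top_indicator hΩ.compl) x.2 = 0) ?_ ?_ hx
  · refine IsClosed.inter (isClosed_eq (by fun_prop) (by fun_prop))
      (isClosed_eq (by fun_prop) (by fun_prop))
  · rintro p ⟨φ, h, h1, h2⟩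
    rw [mulOp_indicator_eq_zero_iff hΩ, mulOp_indicator_eq_zero_iff hΩ]
    constructor
    · filter_upwards [h1] with y hy hyΩ
      rw [hy, image_eq_zero_of_notMem_tsupport fun h' => hyΩ (h.2.2 h')]
    · filter_upwards [h2] with y hy hyΩ
      rw [hy, eq_zero_of_notMem_tsupport_gradient fun h' => hyΩ (h.2.2 h')]

/-! #### Translations -/

/-- The path s ↦ φ(· − sa) is differentiable in L² with derivative −a·∇φ(· − sa), whose norm is at
most ‖a‖‖∇φ‖; apply the mean value inequality on [0,1]. -/
theorem norm_sub_trans_testFn {φ : E3 → ℝ} {Ω : Set E3} (h : IsTestFn Ω φ) (a : E3) :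
    ‖(h.memLp 2).toLp φ - transOp a ((h.memLp 2).toLp φ)‖ ≤
      ‖a‖ * ‖(h.memLp_gradient 2).toLp (gradient φ)‖ := by
  have hmem (s : ℝ) : MemLp (fun x => φ (x - s • a)) 2 volume :=
    (h.memLp 2).comp_measurePreserving (measurePreserving_sub_right volume (s • a))
  have hgmem (s : ℝ) : MemLp (fun x => gradient φ (x - s • a)) 2 volume :=
    (h.memLp_gradient 2).comp_measurePreserving (measurePreserving_sub_right volume (s • a))
  have hmem' (s : ℝ) : MemLp (fun x => - inner ℝ a (gradient φ (x - s • a))) 2 volume :=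
    ((hgmem s).const_inner a).neg
  have hu : UniformContinuous (gradient φ) :=
    (hasCompactSupport_gradient h.2.1).uniformContinuous_of_continuous (continuous_gradient h.1)
  have hderiv (t : ℝ) : HasDerivAt (fun s => (hmem s).toLp fun x => φ (x - s • a))
      ((hmem' t).toLp _) t := by
    -- This compact set contains the supports of all translates with |s − t| < 1.
    set K : Set E3 := Metric.cthickening (‖a‖ * (|t| + 1)) (tsupport φ) with hK
    have hKc : IsCompact K := h.2.1.isCompact.cthickening
    refine hasDerivAt_toLp (ψ := fun s x => φ (x - s • a))
      (ψ' := fun s x => - inner ℝ a (gradient φ (x - s • a))) hmem hmem' ?_ hKc.measurableSet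
      hKc.measure_lt_top.ne ?_ ?_
    · intro s x
      have h1 : HasDerivAt (fun r : ℝ => x - r • a) (-a) s := by
        simpa using ((hasDerivAt_id s).smul_const a).const_sub x
      have h2 : HasDerivAt (fun r : ℝ => φ (x - r • a)) _ s :=
        (h.differentiable (x - s • a)).hasFDerivAt.comp_hasDerivAt s h1
      rwa [map_neg, ← inner_gradient_left, real_inner_comm] at h2
    · filter_upwards [Metric.ball_mem_nhds t one_pos] with s hs x hx
      refine image_eq_zero_of_notMem_tsupport fun hmem => hx ?_
      refine Metric.mem_cthickening_of_dist_le x (x - s • a) _ _ hmem ?_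
      rw [dist_eq_norm, sub_sub_cancel, norm_smul, mul_comm]
      gcongr
      rw [Metric.mem_ball, Real.dist_eq] at hs
      have := abs_sub_abs_le_abs_sub s t
      rw [Real.norm_eq_abs]
      linarith
    · intro ε hε
      obtain ⟨δ, hδ, hd⟩ := Metric.uniformContinuous_iff.1 hu (ε / (‖a‖ + 1)) (by positivity)
      filter_upwards [Metric.ball_mem_nhds t (show 0 < δ / (‖a‖ + 1) by positivity)] with s hs x
      rw [neg_sub_neg, ← inner_sub_right]
      refine (norm_inner_le_norm _ _).trans ?_
      have : dist (x - t • a) (x - s • a) < δ := by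
        rw [dist_eq_norm, sub_sub_sub_cancel_left, ← sub_smul, norm_smul]
        rw [Metric.mem_ball, dist_eq_norm] at hs
        rw [lt_div_iff₀ (by positivity)] at hs
        have := norm_nonneg (s - t)
        nlinarith
      have h3 := hd this
      rw [dist_eq_norm, lt_div_iff₀ (by positivity)] at h3
      nlinarith [norm_nonneg (gradient φ (x - t • a) - gradient φ (x - s • a))]
  have hbound (t : ℝ) : ‖(hmem' t).toLp _‖ ≤
      ‖a‖ * ‖(h.memLp_gradient 2).toLp (gradient φ)‖ := by
    rw [← (transOp (t • a)).norm_map ((h.memLp_gradient 2).toLp (gradient φ))]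
    refine Lp.norm_le_mul_norm_of_ae_le_mul ?_
    filter_upwards [(hmem' t).coeFn_toLp,
      coeFn_transOp (t • a) ((h.memLp_gradient 2).toLp (gradient φ)),
      ae_comp_sub (t • a) (h.memLp_gradient 2).coeFn_toLp] with x h1 h2 h3
    rw [h1, h2, h3, norm_neg]
    exact norm_inner_le_norm _ _
  have := norm_image_sub_le_of_norm_deriv_le_segment_01' (fun t _ => (hderiv t).hasDerivWithinAt)
    (fun t _ => hbound t)
  rw [norm_sub_rev]
  have e1 : (hmem 1).toLp _ = transOp a ((h.memLp 2).toLp φ) := by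
    ext1
    filter_upwards [(hmem 1).coeFn_toLp, coeFn_transOp a ((h.memLp 2).toLp φ),
      ae_comp_sub a (h.memLp 2).coeFn_toLp] with x h1 h2 h3
    rw [h1, h2, h3, one_smul]
  have e0 : (hmem 0).toLp _ = (h.memLp 2).toLp φ :=
    MemLp.toLp_congr _ _ (Eventually.of_forall fun x => by simp)
  rwa [e1, e0] at this

theorem norm_sub_trans_le {Ω : Set E3} {x : H × G} (hx : x ∈ VSub Ω) (a : E3) :
    ‖x.1 - transOp a x.1‖ ≤ ‖a‖ * ‖x.2‖ := by
  have hcont : Continuous (transOp (F := ℝ) a) := (transOp a).continuous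
  refine VSub_induction (P := fun x : H × G => ‖x.1 - transOp a x.1‖ ≤ ‖a‖ * ‖x.2‖) ?_ ?_ hx
  · exact isClosed_le (by fun_prop) (by fun_prop)
  · rintro p ⟨φ, h, h1, h2⟩
    have e1 : p.1 = (h.memLp 2).toLp φ := by
      ext1; exact h1.trans (MemLp.coeFn_toLp _).symm
    have e2 : p.2 = (h.memLp_gradient 2).toLp (gradient φ) := by
      ext1; exact h2.trans (MemLp.coeFn_toLp _).symm
    rw [e1, e2]
    exact norm_sub_trans_testFn h a

/-! #### The Sobolev embedding -/

theorem exists_sobolev_testFn : ∃ C : NNReal, ∀ {Ω : Set E3} {φ : E3 → ℝ}, IsTestFn Ω φ →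
    eLpNorm φ 6 volume ≤ C * eLpNorm (gradient φ) 2 volume := by
  refine ⟨SNormLESNormFDerivOfEqConst ℝ (volume : Measure E3) 2, fun {Ω φ} h => ?_⟩
  have h1 := eLpNorm_le_eLpNorm_fderiv_of_eq (volume : Measure E3) (p := 2) (p' := 6)
    (h.1.of_le (by simp)) h.2.1 (by norm_num) (by simp) (by simp; norm_num)
  have h2 : eLpNorm (fderiv ℝ φ) 2 (volume : Measure E3) = eLpNorm (gradient φ) 2 volume :=
    eLpNorm_congr_norm_ae (Eventually.of_forall fun x => (norm_gradient φ x).symm)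
  have h3 : ((6 : NNReal) : ENNReal) = 6 := by norm_num
  have h4 : ((2 : NNReal) : ENNReal) = 2 := by norm_num
  rw [h3, h4, h2] at h1
  exact h1

/-- The constant in the Sobolev inequality. -/
def sobolevConst : NNReal := exists_sobolev_testFn.choose

/-- Approximating test functions converge almost everywhere along a subsequence, and Fatou's lemma
makes the L⁶ norm lower semicontinuous along it. -/
theorem VSub_sobolev {Ω : Set E3} {x : H × G} (hx : x ∈ VSub Ω) :
    eLpNorm x.1 6 volume ≤ sobolevConst * ENNReal.ofReal ‖x.2‖ := by
  obtain ⟨u, hu, hlim⟩ := mem_closure_iff_seq_limit.1 (show x ∈ closure (testPairs Ω : Set (H × G)) from hx)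
  obtain ⟨ns, hns, hae⟩ := (tendstoInMeasure_of_tendsto_Lp
    ((continuous_fst.tendsto x).comp hlim)).exists_seq_tendsto_ae
  have hb (n : ℕ) : eLpNorm (u n).1 6 volume ≤ sobolevConst * ENNReal.ofReal ‖(u n).2‖ := by
    obtain ⟨φ, h, h1, h2⟩ := hu n
    rw [eLpNorm_congr_ae h1, Lp.norm_def, ENNReal.ofReal_toReal (Lp.eLpNorm_ne_top _),
      eLpNorm_congr_ae h2]
    exact exists_sobolev_testFn.choose_spec h
  refine (Lp.eLpNorm_lim_le_liminf_eLpNorm (fun n => Lp.aestronglyMeasurable (u (ns n)).1) _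
    hae).trans ?_
  refine (liminf_le_liminf (Eventually.of_forall fun n => hb (ns n))).trans ?_
  refine (Tendsto.liminf_eq ?_).le
  refine ENNReal.Tendsto.const_mul ?_ (Or.inr ENNReal.coe_ne_top)
  refine (ENNReal.continuous_ofReal.tendsto _).comp ?_
  have h2 : Tendsto (fun n => ‖(u n).2‖) atTop (𝓝 ‖x.2‖) :=
    ((continuous_norm.comp continuous_snd).tendsto x).comp hlim
  exact h2.comp hns.tendsto_atTop

theorem VSub_memLp {Ω : Set E3} {x : H × G} (hx : x ∈ VSub Ω) : MemLp x.1 6 volume :=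
  ⟨Lp.aestronglyMeasurable _, (VSub_sobolev hx).trans_lt
    (ENNReal.mul_lt_top ENNReal.coe_lt_top ENNReal.ofReal_lt_top)⟩

/-- The embedding of `H¹₀(Ω)` in `L⁶`. -/
def toL6 (Ω : Set E3) : VSub Ω →L[ℝ] L6 :=
  LinearMap.mkContinuous
    { toFun := fun x => (VSub_memLp x.2).toLp x.1.1
      map_add' := fun x y => by
        rw [← MemLp.toLp_add]
        exact MemLp.toLp_congr _ _ (Lp.coeFn_add x.1.1 y.1.1)
      map_smul' := fun c x => by
        rw [RingHom.id_apply, ← MemLp.toLp_const_smul]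
        exact MemLp.toLp_congr _ _ (Lp.coeFn_smul c x.1.1) } sobolevConst fun x => by
    simp only [LinearMap.coe_mk, AddHom.coe_mk, Lp.norm_toLp]
    refine ENNReal.toReal_le_of_le_ofReal (by positivity) ((VSub_sobolev x.2).trans ?_)
    rw [ENNReal.ofReal_mul (by positivity), ENNReal.ofReal_coe_nnreal]
    gcongr
    exact norm_snd_le x.1

theorem coeFn_toL6 {Ω : Set E3} (x : VSub Ω) : toL6 Ω x =ᵐ[volume] x.1.1 := by
  have h : toL6 Ω x = (VSub_memLp x.2).toLp x.1.1 := rfl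
  rw [h]
  exact MemLp.coeFn_toLp _

/-! ### Cut-off difference quotients -/

/-- A smooth cutoff function with values in `[0,1]` and Lipschitz constant `L`. -/
structure IsCutoff (χ : E3 → ℝ) (L : ℝ) : Prop where
  contDiff : ContDiff ℝ ∞ χ
  compact : HasCompactSupport χ
  nonneg : ∀ x, 0 ≤ χ x
  le_one : ∀ x, χ x ≤ 1
  lip : ∀ x y, |χ x - χ y| ≤ L * ‖x - y‖
  grad_le : ∀ x, ‖gradient χ x‖ ≤ L

namespace IsCutoff

variable {χ : E3 → ℝ} {L : ℝ}

theorem abs_le_one (h : IsCutoff χ L) (x : E3) : |χ x| ≤ 1 := by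
  rw [abs_of_nonneg (h.nonneg x)]; exact h.le_one x

theorem L_nonneg (h : IsCutoff χ L) : 0 ≤ L := (norm_nonneg _).trans (h.grad_le 0)

theorem memLp (h : IsCutoff χ L) : MemLp χ ⊤ volume :=
  memLp_top_of_bounded h.contDiff.continuous h.abs_le_one

theorem memLp_grad (h : IsCutoff χ L) : MemLp (gradient χ) ⊤ volume :=
  memLp_top_of_bounded (continuous_gradient h.contDiff) h.grad_le

theorem memLp_shift (h : IsCutoff χ L) (a : E3) : MemLp (fun x => χ (x + a)) ⊤ volume :=
  memLp_top_of_bounded (h.contDiff.continuous.comp (continuous_id.add continuous_const))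
    fun x => h.abs_le_one (x + a)

/-- `(f, g) ↦ (k χ (f - τ_a f), ∇(k χ (f - τ_a f)))`, where `g` stands for `∇f`. -/
def diffOp (h : IsCutoff χ L) (a : E3) (k : ℝ) : H × G →L[ℝ] H × G :=
  let D1 : H × G →L[ℝ] H := k • (ContinuousLinearMap.fst ℝ H G -
    (transOp a).toContinuousLinearMap.comp (ContinuousLinearMap.fst ℝ H G))
  let D2 : H × G →L[ℝ] G := k • (ContinuousLinearMap.snd ℝ H G -
    (transOp a).toContinuousLinearMap.comp (ContinuousLinearMap.snd ℝ H G))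
  ((mulOp h.memLp).comp D1).prod ((mulOp h.memLp).comp D2 + (vecMulOp h.memLp_grad).comp D1)

theorem diffOp_fst (h : IsCutoff χ L) (a : E3) (k : ℝ) (x : H × G) :
    (h.diffOp a k x).1 = mulOp h.memLp (k • (x.1 - transOp a x.1)) := rfl

theorem diffOp_snd (h : IsCutoff χ L) (a : E3) (k : ℝ) (x : H × G) :
    (h.diffOp a k x).2 = mulOp h.memLp (k • (x.2 - transOp a x.2)) +
      vecMulOp h.memLp_grad (k • (x.1 - transOp a x.1)) := rfl

theorem _root_.QuinticWave.gradient_sub_trans {φ : E3 → ℝ} (hφ : Differentiable ℝ φ) (a : E3) (k : ℝ) (x : E3) :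
    gradient (fun y => k * (φ y - φ (y - a))) x = k • (gradient φ x - gradient φ (x - a)) := by
  have h1 : DifferentiableAt ℝ (fun y : E3 => φ (y - a)) x :=
    (hφ (x - a)).comp x (differentiableAt_id.sub_const a)
  simp only [gradient_def]
  rw [fderiv_const_mul ((hφ x).fun_sub h1), map_smul, fderiv_fun_sub (hφ x) h1, map_sub,
    fderiv_comp_sub]

/-- By `ha`, a point of the support of χ outside Ω remains outside after subtracting a. There both φ
and its translate vanish nearby, so test functions of Ω go to test functions of Ω; density does the
rest. -/
theorem diffOp_mem (h : IsCutoff χ L) {Ω : Set E3} {a : E3} {k : ℝ}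
    (ha : ∀ x ∈ tsupport χ, x - a ∈ Ω → x ∈ Ω) {x : H × G} (hx : x ∈ VSub Ω) :
    h.diffOp a k x ∈ VSub Ω := by
  refine mem_VSub_of_map (h.diffOp a k) (S := testPairs Ω) ?_
    (show x ∈ closure (testPairs Ω : Set (H × G)) from hx)
  rintro p ⟨φ, hφ, h1, h2⟩
  have hcd : ContDiff ℝ ∞ fun y : E3 => φ (y - a) := hφ.1.comp (contDiff_id.sub contDiff_const)
  have hd : Differentiable ℝ fun y : E3 => φ (y - a) := hcd.differentiable (by simp)
  refine ⟨fun y => χ y * (k * (φ y - φ (y - a))), ⟨?_, ?_, ?_⟩, ?_, ?_⟩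
  · exact h.contDiff.mul (contDiff_const.mul (hφ.1.sub hcd))
  · exact h.compact.mul_right
  · intro y hy
    have hy1 : y ∈ tsupport χ := tsupport_mul_subset_left hy
    by_contra hyΩ
    have hA : y ∉ tsupport φ := fun hh => hyΩ (hφ.2.2 hh)
    have hB : y - a ∉ tsupport φ := fun hh => hyΩ (ha y hy1 (hφ.2.2 hh))
    have eA : φ =ᶠ[𝓝 y] 0 := notMem_tsupport_iff_eventuallyEq.1 hA
    have eB : ∀ᶠ z in 𝓝 y, φ (z - a) = 0 :=
      (continuous_id.sub continuous_const).continuousAt.eventually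
        (notMem_tsupport_iff_eventuallyEq.1 hB)
    refine (notMem_tsupport_iff_eventuallyEq.2 ?_) hy
    filter_upwards [eA, eB] with z hz hz'
    simp [hz, hz']
  · rw [diffOp_fst]
    filter_upwards [coeFn_mulOp h.memLp (k • (p.1 - transOp a p.1)),
      Lp.coeFn_smul k (p.1 - transOp a p.1), Lp.coeFn_sub p.1 (transOp a p.1),
      coeFn_transOp a p.1, h1, ae_comp_sub a h1] with y e1 e2 e3 e4 e5 e6
    rw [e1, e2, Pi.smul_apply, e3, Pi.sub_apply, e4, e5, e6]
    rfl
  · rw [diffOp_snd]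
    filter_upwards [Lp.coeFn_add (mulOp h.memLp (k • (p.2 - transOp a p.2)))
      (vecMulOp h.memLp_grad (k • (p.1 - transOp a p.1))),
      coeFn_mulOp h.memLp (k • (p.2 - transOp a p.2)),
      coeFn_vecMulOp h.memLp_grad (k • (p.1 - transOp a p.1)),
      Lp.coeFn_smul k (p.1 - transOp a p.1), Lp.coeFn_sub p.1 (transOp a p.1),
      coeFn_transOp a p.1, h1, ae_comp_sub a h1,
      Lp.coeFn_smul k (p.2 - transOp a p.2), Lp.coeFn_sub p.2 (transOp a p.2),
      coeFn_transOp a p.2, h2, ae_comp_sub a h2] with y e0 e1 e2 e3 e4 e5 e6 e7 e8 e9 e10 e11 e12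
    rw [e0, Pi.add_apply, e1, e2, e3, e8, Pi.smul_apply, Pi.smul_apply, e4, e9, Pi.sub_apply,
      Pi.sub_apply, e5, e10, e6, e7, e11, e12,
      gradient_mul_fn (h.contDiff.differentiable (by simp))
        ((hφ.differentiable.fun_sub hd).const_mul k), gradient_sub_trans hφ.differentiable]
    rfl

/-- The cut-off difference quotient as an operator on `H¹₀(Ω)`. -/
def diffV (h : IsCutoff χ L) {Ω : Set E3} {a : E3} (k : ℝ)
    (ha : ∀ x ∈ tsupport χ, x - a ∈ Ω → x ∈ Ω) : VSub Ω →L[ℝ] VSub Ω :=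
  ((h.diffOp a k).comp (VSub Ω).subtypeL).codRestrict (VSub Ω) fun x => h.diffOp_mem ha x.2

theorem diffV_coe (h : IsCutoff χ L) {Ω : Set E3} {a : E3} (k : ℝ)
    (ha : ∀ x ∈ tsupport χ, x - a ∈ Ω → x ∈ Ω) (x : VSub Ω) :
    (h.diffV k ha x).1 = h.diffOp a k x.1 := rfl

/-! #### Quadratic identities -/

section Quadratic

variable {F : Type*} [NormedAddCommGroup F] [InnerProductSpace ℝ F]

theorem _root_.QuinticWave.mulOp_inner_comm {χ : E3 → ℝ} (hχ : MemLp χ ⊤ volume) (f g : Lp F 2 (volume : Measure E3)) :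
    inner ℝ (mulOp hχ f) g = inner ℝ f (mulOp hχ g) := by
  rw [L2.inner_def, L2.inner_def]
  refine integral_congr_ae ?_
  filter_upwards [coeFn_mulOp hχ f, coeFn_mulOp hχ g] with x h1 h2
  rw [h1, h2, real_inner_smul_left, real_inner_smul_right]

theorem mulOp_trans (h : IsCutoff χ L) (a : E3) (f : Lp F 2 (volume : Measure E3)) :
    mulOp h.memLp (transOp a f) = transOp a (mulOp (h.memLp_shift a) f) := by
  ext1
  filter_upwards [coeFn_mulOp h.memLp (transOp a f), coeFn_transOp a f,
    coeFn_transOp a (mulOp (h.memLp_shift a) f),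
    ae_comp_sub a (coeFn_mulOp (h.memLp_shift a) f)] with x e1 e2 e3 e4
  rw [e1, e2, e3, e4, sub_add_cancel]

/-- Translation is an isometry, so it can be moved onto the cutoff. What remains is the weight χ −
χ(· + a), of size at most L‖a‖. -/
theorem abs_inner_mulOp_sub_trans_le (h : IsCutoff χ L) (a : E3)
    (f : Lp F 2 (volume : Measure E3)) :
    |inner ℝ f (mulOp h.memLp f) - inner ℝ (transOp a f) (mulOp h.memLp (transOp a f))| ≤
      L * ‖a‖ * ‖f‖ ^ 2 := by
  rw [h.mulOp_trans, LinearIsometry.inner_map_map, ← inner_sub_right]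
  refine (abs_real_inner_le_norm _ _).trans ?_
  have : ‖mulOp h.memLp f - mulOp (h.memLp_shift a) f‖ ≤ L * ‖a‖ * ‖f‖ := by
    refine Lp.norm_le_mul_norm_of_ae_le_mul ?_
    filter_upwards [Lp.coeFn_sub (mulOp h.memLp f) (mulOp (h.memLp_shift a) f),
      coeFn_mulOp h.memLp f, coeFn_mulOp (h.memLp_shift a) f] with x e1 e2 e3
    rw [e1, Pi.sub_apply, e2, e3, ← sub_smul, norm_smul]
    gcongr
    refine (h.lip _ _).trans ?_
    rw [sub_add_cancel_left, norm_neg]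
  calc _ ≤ ‖f‖ * (L * ‖a‖ * ‖f‖) := by gcongr
    _ = _ := by ring

/-- `2 f·(f - τf) = f² - (τf)² + (f - τf)²`. -/
theorem two_mul_inner_diff (h : IsCutoff χ L) (a : E3) (k : ℝ)
    (f : Lp F 2 (volume : Measure E3)) :
    2 * inner ℝ f (mulOp h.memLp (k • (f - transOp a f))) =
      k * (inner ℝ f (mulOp h.memLp f) - inner ℝ (transOp a f) (mulOp h.memLp (transOp a f))) +
      k * inner ℝ (f - transOp a f) (mulOp h.memLp (f - transOp a f)) := by
  have hs : inner ℝ (transOp a f) (mulOp h.memLp f) = inner ℝ f (mulOp h.memLp (transOp a f)) := by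
    rw [← mulOp_inner_comm, real_inner_comm]
  simp only [map_smul, map_sub, inner_smul_right, inner_sub_left, inner_sub_right]
  rw [hs]
  ring

theorem inner_mulOp_self_le (h : IsCutoff χ L) (f : Lp F 2 (volume : Measure E3)) :
    inner ℝ f (mulOp h.memLp f) ≤ ‖f‖ ^ 2 := by
  refine (real_inner_le_norm _ _).trans ?_
  have := norm_mulOp_le h.memLp h.abs_le_one f
  nlinarith [norm_nonneg f]

end Quadratic

/-! #### The nonlinear term -/

theorem _root_.QuinticWave.integrable_pow_six (a : L6) : Integrable (fun x => a x ^ 6) (volume : Measure E3) :=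
  (integrable_quint a a).congr (Eventually.of_forall fun x => by simp only; ring)

theorem _root_.QuinticWave.quint_self (a : L6) : quint a a = ∫ x, a x ^ 6 := by
  rw [quint_eq]
  refine integral_congr_ae (Eventually.of_forall fun x => ?_)
  simp only
  ring

theorem _root_.QuinticWave.quint_self_nonneg (a : L6) : 0 ≤ quint a a := real_inner_self_nonneg

/-- Convexity of `s ↦ s⁶`. -/
theorem _root_.QuinticWave.pow_six_convex (s t : ℝ) : (s ^ 6 - t ^ 6) / 6 ≤ s ^ 5 * (s - t) := by
  -- The polynomial 5s⁶ − 6s⁵t + t⁶ has the double root s = t, and the quotient by (s − t)² is a sum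
  -- of squares.
  have h : s ^ 5 * (s - t) - (s ^ 6 - t ^ 6) / 6 =
      (s - t) ^ 2 * ((t ^ 2 + s * t) ^ 2 + 2 * (s * t + s ^ 2) ^ 2 + 3 * (s ^ 2) ^ 2) / 6 := by ring
  have : 0 ≤ (s - t) ^ 2 * ((t ^ 2 + s * t) ^ 2 + 2 * (s * t + s ^ 2) ^ 2 + 3 * (s ^ 2) ^ 2) / 6 := by
    positivity
  linarith

theorem _root_.QuinticWave.quint_sub_ge (a b : L6) : (quint a a - quint b b) / 6 ≤ quint a (a - b) := by
  rw [quint_sub, quint_self b, quint_self a, quint_eq a b, ← integral_sub (integrable_pow_six a)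
    (integrable_pow_six b), ← integral_sub (integrable_pow_six a) (integrable_quint a b),
    ← integral_div]
  refine integral_mono (((integrable_pow_six a).sub (integrable_pow_six b)).div_const 6)
    ((integrable_pow_six a).sub (integrable_quint a b)) fun x => ?_
  have := pow_six_convex (a x) (b x)
  simp only
  linarith

/-- Convexity is used pointwise with the non-negative weight kχ. Translating the integral of χ u(· −
a)⁶ then leaves u⁶ against χ − χ(· + a), which is at least −L‖a‖. -/
theorem quint_diffV_ge (h : IsCutoff χ L) {Ω : Set E3} {a : E3} {k : ℝ} (hk : 0 ≤ k)
    (ha : ∀ x ∈ tsupport χ, x - a ∈ Ω → x ∈ Ω) (x : VSub Ω) :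
    -(k * (L * ‖a‖ * quint (toL6 Ω x) (toL6 Ω x)) / 6) ≤
      quint (toL6 Ω x) (toL6 Ω (h.diffV k ha x)) := by
  set u := toL6 Ω x with hu
  have hi := integrable_pow_six u
  have hi' : Integrable (fun y => u (y - a) ^ 6) (volume : Measure E3) := hi.comp_sub_right a
  have hb1 : Integrable (fun y => χ y * u y ^ 6) (volume : Measure E3) :=
    hi.bdd_mul h.contDiff.continuous.aestronglyMeasurable
      (Eventually.of_forall fun y => h.abs_le_one y)
  have hb2 : Integrable (fun y => χ y * u (y - a) ^ 6) (volume : Measure E3) :=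
    hi'.bdd_mul h.contDiff.continuous.aestronglyMeasurable
      (Eventually.of_forall fun y => h.abs_le_one y)
  have hb3 : Integrable (fun y => χ (y + a) * u y ^ 6) (volume : Measure E3) :=
    hi.bdd_mul (h.contDiff.continuous.comp (continuous_id.add continuous_const)).aestronglyMeasurable
      (Eventually.of_forall fun y => h.abs_le_one (y + a))
  have e1 : ∫ y, χ y * u (y - a) ^ 6 = ∫ y, χ (y + a) * u y ^ 6 := by
    rw [← integral_sub_right_eq_self (fun y => χ (y + a) * u y ^ 6) a]
    simp
  have e2 : -(L * ‖a‖ * ∫ y, u y ^ 6) ≤ ∫ y, (χ y * u y ^ 6 - χ (y + a) * u y ^ 6) := by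
    rw [← neg_mul, ← integral_const_mul]
    refine integral_mono (hi.const_mul _) (hb1.sub hb3) fun y => ?_
    have h1 := h.lip y (y + a)
    rw [sub_add_cancel_left, norm_neg] at h1
    have h2 := (abs_le.1 h1).1
    have h3 : 0 ≤ u y ^ 6 := by positivity
    simp only
    nlinarith
  have e3 : ∫ y, k * ((χ y * u y ^ 6 - χ y * u (y - a) ^ 6) / 6) ≤
      quint u (toL6 Ω (h.diffV k ha x)) := by
    rw [quint_eq]
    refine integral_mono_ae (((hb1.sub hb2).div_const 6).const_mul k) (integrable_quint _ _) ?_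
    filter_upwards [coeFn_toL6 (h.diffV k ha x), coeFn_toL6 x, ae_comp_sub a (coeFn_toL6 x),
      coeFn_mulOp h.memLp (k • (x.1.1 - transOp a x.1.1)),
      Lp.coeFn_smul k (x.1.1 - transOp a x.1.1), Lp.coeFn_sub x.1.1 (transOp a x.1.1),
      coeFn_transOp a x.1.1] with y f1 f2 f3 f4 f5 f6 f7
    rw [f1, diffV_coe, diffOp_fst, f4, f5, Pi.smul_apply, f6, Pi.sub_apply, f7, ← f2, ← f3,
      smul_eq_mul, smul_eq_mul, ← hu]
    have h1 := pow_six_convex (u y) (u (y - a))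
    have h2 := mul_le_mul_of_nonneg_left h1 (mul_nonneg hk (h.nonneg y))
    calc _ = k * χ y * ((u y ^ 6 - u (y - a) ^ 6) / 6) := by ring
      _ ≤ _ := h2
      _ = _ := by ring
  refine le_trans ?_ e3
  rw [integral_const_mul, integral_div, integral_sub hb1 hb2, e1, ← integral_sub hb1 hb3,
    quint_self]
  have := mul_le_mul_of_nonneg_left e2 hk
  linarith

end IsCutoff

/-- Cauchy–Schwarz with x⁵ ∈ L², since the square of x⁵ is x¹⁰. Only the L² norm of y enters, which
makes L² errors in test functions harmless after integration in time. -/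
theorem enorm_quint_le {Ω : Set E3} (x y : VSub Ω) :
    ‖quint (toL6 Ω x) (toL6 Ω y)‖ₑ ≤
      eLpNorm x.1.1 10 volume ^ 5 * ENNReal.ofReal ‖y.1.1‖ := by
  rw [quint_eq]
  refine (enorm_integral_le_lintegral_enorm _).trans ?_
  have e1 : ∫⁻ z, ‖toL6 Ω x z ^ 5 * toL6 Ω y z‖ₑ = 
      ∫⁻ z, ((fun z => ‖x.1.1 z‖ₑ ^ 5) * fun z => ‖y.1.1 z‖ₑ) z := by
    refine lintegral_congr_ae ?_
    filter_upwards [coeFn_toL6 x, coeFn_toL6 y] with z h1 h2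
    rw [h1, h2, enorm_mul, enorm_pow, Pi.mul_apply]
  rw [e1]
  refine (ENNReal.lintegral_mul_le_Lp_mul_Lq volume Real.HolderConjugate.two_two
    ((Lp.aestronglyMeasurable x.1.1).enorm.pow_const 5)
    (Lp.aestronglyMeasurable y.1.1).enorm).trans ?_
  have e2 : ENNReal.ofReal ‖y.1.1‖ = (∫⁻ z, ‖y.1.1 z‖ₑ ^ (2 : ℝ)) ^ (1 / 2 : ℝ) := by
    rw [Lp.norm_def, ENNReal.ofReal_toReal (Lp.eLpNorm_ne_top _),
      eLpNorm_eq_lintegral_rpow_enorm_toReal (by simp) (by simp)]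
    simp
  have e3 : eLpNorm x.1.1 10 volume ^ 5 = (∫⁻ z, (‖x.1.1 z‖ₑ ^ 5) ^ (2 : ℝ)) ^ (1 / 2 : ℝ) := by
    rw [eLpNorm_eq_lintegral_rpow_enorm_toReal (by simp) (by simp), ← ENNReal.rpow_natCast,
      ← ENNReal.rpow_mul]
    have : ∀ z, (‖x.1.1 z‖ₑ ^ 5) ^ (2 : ℝ) = ‖x.1.1 z‖ₑ ^ (10 : ℝ) := fun z => by
      rw [← ENNReal.rpow_natCast, ← ENNReal.rpow_mul]; norm_num
    simp only [this]
    norm_num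
  rw [e2, e3]

/-! ### Steklov averages -/

section Average

variable {X : Type*} [NormedAddCommGroup X] [NormedSpace ℝ X]

/-- The average of `f` over the interval from `t` to `t + ε`. -/
def avg (ε : ℝ) (f : ℝ → X) (t : ℝ) : X := ∫ r in (0 : ℝ)..1, f (t + ε * r)

variable [CompleteSpace X]

/-- Parametrizing the average by the unit interval makes ε = 0 a regular value, so limits ε → 0 are
plain continuity. Negative ε gives averages over the past. -/
theorem avg_zero (f : ℝ → X) (t : ℝ) : avg 0 f t = f t := by simp [avg]

omit [CompleteSpace X] in
theorem continuous_avg {f : ℝ → X} (hf : Continuous f) :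
    Continuous fun p : ℝ × ℝ => avg p.1 f p.2 := by
  unfold avg
  refine intervalIntegral.continuous_parametric_intervalIntegral_of_continuous' ?_ 0 1
  unfold Function.uncurry
  fun_prop

omit [CompleteSpace X] in
theorem continuous_avg_right {f : ℝ → X} (hf : Continuous f) (ε : ℝ) : Continuous (avg ε f) :=
  (continuous_avg hf).comp (by fun_prop : Continuous fun t : ℝ => (ε, t))

omit [CompleteSpace X] in
theorem smul_avg (ε : ℝ) (f : ℝ → X) (t : ℝ) : ε • avg ε f t = ∫ r in t..(t + ε), f r := by
  simp [avg]

theorem hasDerivAt_avg {f : ℝ → X} (hf : Continuous f) {ε : ℝ} (hε : ε ≠ 0) (t : ℝ) :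
    HasDerivAt (avg ε f) (ε⁻¹ • (f (t + ε) - f t)) t := by
  have h1 : avg ε f = fun t => ε⁻¹ • ((∫ r in (0 : ℝ)..(t + ε), f r) - ∫ r in (0 : ℝ)..t, f r) := by
    ext1 t
    rw [intervalIntegral.integral_interval_sub_left (hf.intervalIntegrable _ _)
      (hf.intervalIntegrable _ _), ← smul_avg, smul_smul, inv_mul_cancel₀ hε, one_smul]
  rw [h1]
  have h2 (b : ℝ) : HasDerivAt (fun u => ∫ r in (0 : ℝ)..u, f r) (f b) b :=
    (hf.integral_hasStrictDerivAt 0 b).hasDerivAt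
  exact (((h2 (t + ε)).comp_add_const t ε).sub (h2 t)).const_smul ε⁻¹

theorem map_avg {Y : Type*} [NormedAddCommGroup Y] [NormedSpace ℝ Y] [CompleteSpace Y]
    (A : X →L[ℝ] Y) {f : ℝ → X} (hf : Continuous f) (ε t : ℝ) :
    A (avg ε f t) = avg ε (fun s => A (f s)) t := by
  unfold avg
  rw [A.intervalIntegral_comp_comm]
  exact Continuous.intervalIntegrable (by fun_prop) _ _

theorem norm_avg_sub_le {f : ℝ → X} (hf : Continuous f) {ε t δ : ℝ} {c : X}
    (h : ∀ r ∈ Icc (0 : ℝ) 1, ‖f (t + ε * r) - c‖ ≤ δ) : ‖avg ε f t - c‖ ≤ δ := by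
  have h1 : avg ε f t - c = ∫ r in (0 : ℝ)..1, (f (t + ε * r) - c) := by
    rw [intervalIntegral.integral_sub (Continuous.intervalIntegrable (by fun_prop) _ _)
      (by simp)]
    simp [avg]
  rw [h1]
  refine (intervalIntegral.norm_integral_le_of_norm_le_const (C := δ) fun r hr => ?_).trans
    (by simp)
  rw [uIoc_of_le zero_le_one] at hr
  exact h r ⟨hr.1.le, hr.2⟩

theorem norm_avg_le {f : ℝ → X} (hf : Continuous f) {ε t δ : ℝ}
    (h : ∀ r ∈ Icc (0 : ℝ) 1, ‖f (t + ε * r)‖ ≤ δ) : ‖avg ε f t‖ ≤ δ := by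
  have := norm_avg_sub_le (c := (0 : X)) hf (by simpa using h)
  simpa using this

theorem integral_avg_deriv {F κ : ℝ → X} (hd : ∀ t, HasDerivAt F (κ t) t)
    (hκ : Continuous κ) {ε : ℝ} (hε : ε ≠ 0) (a b : ℝ) :
    ∫ t in a..b, avg ε κ t = avg ε F b - avg ε F a := by
  have hF : Continuous F := continuous_iff_continuousAt.2 fun t => (hd t).continuousAt
  have h1 (t : ℝ) : avg ε κ t = ε⁻¹ • (F (t + ε) - F t) := by
    rw [← intervalIntegral.integral_eq_sub_of_hasDerivAt (fun x _ => hd x)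
      (hκ.intervalIntegrable _ _), ← smul_avg, smul_smul, inv_mul_cancel₀ hε, one_smul]
  rw [intervalIntegral.integral_eq_sub_of_hasDerivAt (fun t _ => ?_)
    ((continuous_avg_right hκ ε).intervalIntegrable _ _)]
  rw [h1]
  exact hasDerivAt_avg hF hε t

end Average

/-! ### Solutions on a compact time interval -/

/-- Functional analytic description of a weak solution on `[0,T]`, extended to all times. -/
structure IsSol (Ω : Set E3) (T : ℝ) (U : ℝ → VSub Ω) (V : ℝ → H) : Prop where
  ucU : UniformContinuous U
  ucV : UniformContinuous V
  deriv : ∀ s t, 0 ≤ s → s ≤ t → t ≤ T → (U t).1.1 - (U s).1.1 = ∫ r in s..t, V r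
  eqn : ∀ (ψ : VSub Ω) (s t : ℝ), 0 ≤ s → s ≤ t → t ≤ T →
    inner ℝ (V t - V s) ψ.1.1 =
      - ∫ r in s..t, (inner ℝ (U r).1.2 ψ.1.2 + quint (toL6 Ω (U r)) (toL6 Ω ψ))
  l5l10 : ∫⁻ t in Ioc 0 T, eLpNorm (U t).1.1 10 volume ^ 5 < ⊤
  zero : ∀ t, ∀ᵐ x : E3, x ∉ Ω → V t x = 0

/-- The potential energy. -/
def pot {Ω : Set E3} (x : VSub Ω) : ℝ := quint (toL6 Ω x) (toL6 Ω x) / 6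

/-- The energy of a state. -/
def en {Ω : Set E3} (x : VSub Ω) (y : H) : ℝ := ‖x.1.2‖ ^ 2 / 2 + ‖y‖ ^ 2 / 2 + pot x

theorem pot_nonneg {Ω : Set E3} (x : VSub Ω) : 0 ≤ pot x := by
  have := quint_self_nonneg (toL6 Ω x)
  unfold pot; positivity

theorem continuous_quint_comp {Ω : Set E3} {Y : Type*} [TopologicalSpace Y] {f g : Y → VSub Ω}
    (hf : Continuous f) (hg : Continuous g) :
    Continuous fun y => quint (toL6 Ω (f y)) (toL6 Ω (g y)) :=
  Continuous.comp (g := fun p : L6 × L6 => quint p.1 p.2)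
    (f := fun y => (toL6 Ω (f y), toL6 Ω (g y))) continuous_quint
    (((toL6 Ω).continuous.comp hf).prodMk ((toL6 Ω).continuous.comp hg))

theorem continuous_pot {Ω : Set E3} : Continuous (pot (Ω := Ω)) := by
  unfold pot
  exact (continuous_quint_comp continuous_id continuous_id).div_const 6

/-- The function component. -/
def fstV (Ω : Set E3) : VSub Ω →L[ℝ] H := (ContinuousLinearMap.fst ℝ H G).comp (VSub Ω).subtypeL

/-- The gradient component. -/
def sndV (Ω : Set E3) : VSub Ω →L[ℝ] G := (ContinuousLinearMap.snd ℝ H G).comp (VSub Ω).subtypeL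

@[simp] theorem sndV_apply {Ω : Set E3} (x : VSub Ω) : sndV Ω x = x.1.2 := rfl

namespace IsSol

variable {Ω : Set E3} {T : ℝ} {U : ℝ → VSub Ω} {V : ℝ → H}

theorem contU (h : IsSol Ω T U V) : Continuous U := h.ucU.continuous
theorem contV (h : IsSol Ω T U V) : Continuous V := h.ucV.continuous

/-- The bound of the nonlinearity in `L¹(0,T; L²)`. -/
def nlBound (_ : IsSol Ω T U V) : ℝ :=
  (∫⁻ t in Ioc 0 T, eLpNorm (U t).1.1 10 volume ^ 5).toReal

theorem nlBound_nonneg (h : IsSol Ω T U V) : 0 ≤ h.nlBound := ENNReal.toReal_nonneg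

/-- After exchanging the integrals, r is fixed and the time integral sees u⁵ shifted by εr. The
shift stays inside (0,T], so its L¹(L²) norm is at most `nlBound`. -/
theorem abs_integral_quint_le (h : IsSol Ω T U V) {Ψ : ℝ → ℝ → VSub Ω}
    (hΨ : Continuous Ψ.uncurry) {a b ε m : ℝ} (ha : 0 ≤ a) (hab : a ≤ b) (hε : 0 ≤ ε)
    (hb : b + ε ≤ T)
    (hm : ∀ t ∈ Icc a b, ∀ r ∈ Icc (0 : ℝ) 1, ‖(Ψ t r).1.1‖ ≤ m) :
    |∫ t in a..b, ∫ r in (0 : ℝ)..1, quint (toL6 Ω (U (t + ε * r))) (toL6 Ω (Ψ t r))| ≤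
      m * h.nlBound := by
  have hm0 : 0 ≤ m := (norm_nonneg _).trans
    (hm a (left_mem_Icc.2 hab) 0 (left_mem_Icc.2 zero_le_one))
  set q : ℝ → ℝ → ℝ := fun t r => quint (toL6 Ω (U (t + ε * r))) (toL6 Ω (Ψ t r)) with hq
  have hqc : Continuous q.uncurry := by
    refine continuous_quint_comp (h.contU.comp ?_) hΨ
    fun_prop
  have hswap : ∫ t in a..b, ∫ r in (0 : ℝ)..1, q t r = ∫ r in (0 : ℝ)..1, ∫ t in a..b, q t r := by
    refine intervalIntegral_intervalIntegral_swap ?_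
    refine (hqc.continuousOn.integrableOn_compact
      (isCompact_uIcc.prod isCompact_uIcc)).mono_set
      (prod_mono uIoc_subset_uIcc uIoc_subset_uIcc)
  have key (r : ℝ) (hr : r ∈ Icc (0 : ℝ) 1) : ‖∫ t in a..b, q t r‖ ≤ m * h.nlBound := by
    rw [intervalIntegral.integral_of_le hab]
    refine ENNReal.ofReal_le_ofReal_iff (by have := h.nlBound_nonneg; positivity) |>.1 ?_
    rw [ofReal_norm]
    refine (enorm_integral_le_lintegral_enorm _).trans ?_
    calc ∫⁻ t in Ioc a b, ‖q t r‖ₑ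
        ≤ ∫⁻ t in Ioc a b, eLpNorm (U (t + ε * r)).1.1 10 volume ^ 5 * ENNReal.ofReal m := by
          refine setLIntegral_mono' measurableSet_Ioc fun t ht => ?_
          refine (enorm_quint_le _ _).trans ?_
          gcongr
          exact hm t ⟨ht.1.le, ht.2⟩ r hr
      _ = (∫⁻ t in Ioc a b, eLpNorm (U (t + ε * r)).1.1 10 volume ^ 5) * ENNReal.ofReal m :=
          lintegral_mul_const' _ _ ENNReal.ofReal_ne_top
      _ = (∫⁻ t in Ioc (a + ε * r) (b + ε * r), eLpNorm (U t).1.1 10 volume ^ 5) *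
            ENNReal.ofReal m := by
          congr 1
          have := (measurePreserving_add_right (volume : Measure ℝ) (ε * r)).setLIntegral_comp_preimage_emb
            (measurableEmbedding_addRight (ε * r)) (fun t => eLpNorm (U t).1.1 10 volume ^ 5)
            (Ioc (a + ε * r) (b + ε * r))
          rw [← this]
          congr 2
          ext t
          simp
      _ ≤ (∫⁻ t in Ioc 0 T, eLpNorm (U t).1.1 10 volume ^ 5) * ENNReal.ofReal m := by
          gcongr
          · have := mul_nonneg hε hr.1
            linarith
          · have := mul_le_mul_of_nonneg_left hr.2 hε
            linarith
      _ = ENNReal.ofReal (m * h.nlBound) := by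
          rw [mul_comm, ENNReal.ofReal_mul hm0, nlBound, ENNReal.ofReal_toReal h.l5l10.ne]
  rw [hswap, ← Real.norm_eq_abs]
  refine (intervalIntegral.norm_integral_le_of_norm_le_const (C := m * h.nlBound)
    fun r hr => ?_).trans (by simp)
  rw [uIoc_of_le zero_le_one] at hr
  exact key r ⟨hr.1.le, hr.2⟩

/-- The derivative of the Steklov average of `U`. -/
def _root_.QuinticWave.diffQuot (U : ℝ → VSub Ω) (ε t : ℝ) : VSub Ω := ε⁻¹ • (U (t + ε) - U t)

theorem diffQuot_fst (h : IsSol Ω T U V) {ε t : ℝ} (hε : 0 < ε) (ht : 0 ≤ t) (htT : t + ε ≤ T) :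
    (diffQuot U ε t).1.1 = avg ε V t := by
  have : (diffQuot U ε t).1.1 = ε⁻¹ • ((U (t + ε)).1.1 - (U t).1.1) := rfl
  rw [this, h.deriv t (t + ε) ht (by linarith) htT, ← smul_avg, smul_smul, inv_mul_cancel₀ hε.ne',
    one_smul]

/-- The equation integrated from t to t + ε, divided by ε. The nonlinear term is the average of u⁵,
not the fifth power of the average. -/
theorem steklov_eq (h : IsSol Ω T U V) {ε t : ℝ} (hε : 0 < ε) (ht : 0 ≤ t) (htT : t + ε ≤ T)
    (ψ : VSub Ω) :
    inner ℝ (ε⁻¹ • (V (t + ε) - V t)) ψ.1.1 + inner ℝ (avg ε U t).1.2 ψ.1.2 +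
      ∫ r in (0 : ℝ)..1, quint (toL6 Ω (U (t + ε * r))) (toL6 Ω ψ) = 0 := by
  have hc1 : Continuous fun r => quint (toL6 Ω (U r)) (toL6 Ω ψ) :=
    continuous_quint_comp h.contU continuous_const
  have hc2 : Continuous fun r => inner ℝ (U r).1.2 ψ.1.2 :=
    ((sndV Ω).continuous.comp h.contU).inner continuous_const
  have e1 : inner ℝ (avg ε U t).1.2 ψ.1.2 = avg ε (fun r => inner ℝ (U r).1.2 ψ.1.2) t := by
    have := map_avg ((innerSL ℝ ψ.1.2).comp (sndV Ω)) h.contU ε t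
    simp only [ContinuousLinearMap.comp_apply, innerSL_apply_apply, sndV_apply] at this
    rw [real_inner_comm, this]
    simp only [real_inner_comm]
  have e2 : avg ε (fun r => quint (toL6 Ω (U r)) (toL6 Ω ψ)) t =
    ∫ r in (0 : ℝ)..1, quint (toL6 Ω (U (t + ε * r))) (toL6 Ω ψ) := rfl
  rw [real_inner_smul_left, h.eqn ψ t (t + ε) ht (by linarith) htT, ← smul_avg, e1, ← e2,
    smul_eq_mul, mul_neg, ← mul_assoc, inv_mul_cancel₀ hε.ne', one_mul]
  have e3 : avg ε (fun r => inner ℝ (U r).1.2 ψ.1.2 + quint (toL6 Ω (U r)) (toL6 Ω ψ)) t =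
      avg ε (fun r => inner ℝ (U r).1.2 ψ.1.2) t +
        avg ε (fun r => quint (toL6 Ω (U r)) (toL6 Ω ψ)) t := by
    unfold avg
    have hl : Continuous fun r : ℝ => t + ε * r := by fun_prop
    exact intervalIntegral.integral_add ((hc2.comp hl).intervalIntegrable _ _)
      ((hc1.comp hl).intervalIntegrable _ _)
  rw [e3]
  ring

theorem _root_.QuinticWave.exists_modulus {X : Type*} [PseudoMetricSpace X] {f : ℝ → X} (hf : UniformContinuous f)
    {m : ℝ} (hm : 0 < m) : ∃ δ > 0, ∀ s t, |s - t| ≤ δ → dist (f s) (f t) ≤ m := by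
  obtain ⟨δ, hδ, hd⟩ := Metric.uniformContinuous_iff.1 hf m hm
  refine ⟨δ / 2, by positivity, fun s t hst => (hd ?_).le⟩
  rw [Real.dist_eq]
  linarith

theorem continuous_diffQuot (h : IsSol Ω T U V) (ε : ℝ) : Continuous (diffQuot U ε) := by
  unfold diffQuot
  have := h.contU
  fun_prop

theorem continuous_integral_quint (h : IsSol Ω T U V) (ε : ℝ) {Ψ : ℝ → ℝ → VSub Ω}
    (hΨ : Continuous Ψ.uncurry) :
    Continuous fun t => ∫ r in (0 : ℝ)..1, quint (toL6 Ω (U (t + ε * r))) (toL6 Ω (Ψ t r)) := by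
  refine intervalIntegral.continuous_parametric_intervalIntegral_of_continuous' ?_ 0 1
  exact continuous_quint_comp (h.contU.comp (by fun_prop : Continuous fun p : ℝ × ℝ => p.1 + ε * p.2)) hΨ

theorem integral_quint_add (h : IsSol Ω T U V) (ε : ℝ) {Ψ Ψ' : ℝ → ℝ → VSub Ω}
    (hΨ : Continuous Ψ.uncurry) (hΨ' : Continuous Ψ'.uncurry) (a b : ℝ) :
    ∫ t in a..b, ∫ r in (0 : ℝ)..1, quint (toL6 Ω (U (t + ε * r))) (toL6 Ω (Ψ t r + Ψ' t r)) =
      (∫ t in a..b, ∫ r in (0 : ℝ)..1, quint (toL6 Ω (U (t + ε * r))) (toL6 Ω (Ψ t r))) +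
      ∫ t in a..b, ∫ r in (0 : ℝ)..1, quint (toL6 Ω (U (t + ε * r))) (toL6 Ω (Ψ' t r)) := by
  have slice_cont {Ψ : ℝ → ℝ → VSub Ω} (hΨ : Continuous Ψ.uncurry) (t : ℝ) :
      Continuous fun r => quint (toL6 Ω (U (t + ε * r))) (toL6 Ω (Ψ t r)) :=
    continuous_quint_comp (h.contU.comp (by fun_prop : Continuous fun r : ℝ => t + ε * r))
      (hΨ.comp (by fun_prop : Continuous fun r : ℝ => (t, r)))
  rw [← intervalIntegral.integral_add ((h.continuous_integral_quint ε hΨ).intervalIntegrable _ _)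
    ((h.continuous_integral_quint ε hΨ').intervalIntegrable _ _)]
  refine intervalIntegral.integral_congr fun t _ => ?_
  rw [← intervalIntegral.integral_add ((slice_cont hΨ t).intervalIntegrable _ _)
    ((slice_cont hΨ' t).intervalIntegrable _ _)]
  refine intervalIntegral.integral_congr fun r _ => ?_
  rw [map_add, quint_add]

theorem integral_quint_mono (h : IsSol Ω T U V) (ε : ℝ) {Ψ : ℝ → ℝ → VSub Ω}
    (hΨ : Continuous Ψ.uncurry) {q : ℝ → ℝ → ℝ} (hq : Continuous q.uncurry) {a b : ℝ} (hab : a ≤ b)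
    (hle : ∀ t r, q t r ≤ quint (toL6 Ω (U (t + ε * r))) (toL6 Ω (Ψ t r))) :
    ∫ t in a..b, ∫ r in (0 : ℝ)..1, q t r ≤
      ∫ t in a..b, ∫ r in (0 : ℝ)..1, quint (toL6 Ω (U (t + ε * r))) (toL6 Ω (Ψ t r)) := by
  refine intervalIntegral.integral_mono hab
    ((intervalIntegral.continuous_parametric_intervalIntegral_of_continuous'
      hq 0 1).intervalIntegrable _ _)
    ((h.continuous_integral_quint ε hΨ).intervalIntegrable _ _) fun t => ?_
  refine intervalIntegral.integral_mono zero_le_one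
    ((hq.comp (by fun_prop : Continuous fun r : ℝ => (t, r))).intervalIntegrable _ _)
    ((continuous_quint_comp (h.contU.comp (by fun_prop : Continuous fun r : ℝ => t + ε * r))
      (hΨ.comp (by fun_prop : Continuous fun r : ℝ => (t, r)))).intervalIntegrable _ _) fun r => ?_
  exact hle t r

/-- The work of the nonlinearity along a solution. -/
theorem integral_quint_diffQuot_ge (h : IsSol Ω T U V) {a b ε m : ℝ} (hab : a ≤ b) (hε : 0 < ε)
    (hεa : ε < a) (hεT : b + ε < T) (hmod : ∀ s t, |s - t| ≤ ε → dist (V s) (V t) ≤ m) :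
    avg ε (avg (-ε) fun t => pot (U t)) b - avg ε (avg (-ε) fun t => pot (U t)) a -
      m * h.nlBound ≤
    ∫ t in a..b, ∫ r in (0 : ℝ)..1, quint (toL6 Ω (U (t + ε * r))) (toL6 Ω (diffQuot U ε t)) := by
  have hΦc : Continuous fun t => pot (U t) := continuous_pot.comp h.contU
  -- B is the backward difference quotient at the very time t + εr where the nonlinearity is
  -- evaluated, so convexity applies to it. The error D compares averages of V at times at most ε
  -- apart, hence is at most m in L². The assumption ε < a keeps t + εr − ε positive.
  set B : ℝ → ℝ → VSub Ω := fun t r => ε⁻¹ • (U (t + ε * r) - U (t + ε * r - ε)) with hB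
  have hBc : Continuous B.uncurry := by
    have := h.contU
    simp only [hB, Function.uncurry_def]
    fun_prop
  set D : ℝ → ℝ → VSub Ω := fun t r => diffQuot U ε t - B t r with hD
  have hDc : Continuous D.uncurry := ((h.continuous_diffQuot ε).comp continuous_fst).sub hBc
  -- The derivative of the backward average of the potential energy; averaging it forward and
  -- integrating telescopes.
  set κ : ℝ → ℝ := fun s => (-ε)⁻¹ • (pot (U (s + -ε)) - pot (U s)) with hκ
  have hκc : Continuous κ :=
    ((hΦc.comp (continuous_id.add continuous_const)).sub hΦc).const_smul (-ε)⁻¹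
  have hκint := integral_avg_deriv (fun t => hasDerivAt_avg hΦc (neg_ne_zero.2 hε.ne') t) hκc
    hε.ne' a b
  have herr := h.abs_integral_quint_le hDc
    (a := a) (b := b) (ε := ε) (m := m) (hε.trans hεa).le hab hε.le hεT.le (by
      intro t ht r hr
      have hr0 := mul_nonneg hε.le hr.1
      have hr1 := mul_le_mul_of_nonneg_left hr.2 hε.le
      have e1 : (D t r).1.1 = avg ε V t - avg ε V (t + ε * r - ε) := by
        have : (D t r).1.1 = (diffQuot U ε t).1.1 - (diffQuot U ε (t + ε * r - ε)).1.1 := by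
          simp only [hD, hB, diffQuot, sub_add_cancel]
          rfl
        rw [this, h.diffQuot_fst hε (by linarith [ht.1]) (by linarith [ht.2]),
          h.diffQuot_fst hε (by linarith [ht.1]) (by linarith [ht.2])]
      rw [e1]
      have e2 : avg ε V t - avg ε V (t + ε * r - ε) =
          ∫ r' in (0 : ℝ)..1, (V (t + ε * r') - V (t + ε * r - ε + ε * r')) := by
        have := h.contV
        rw [intervalIntegral.integral_sub (Continuous.intervalIntegrable (by fun_prop) _ _)
          (Continuous.intervalIntegrable (by fun_prop) _ _)]
        rfl
      rw [e2]
      refine (intervalIntegral.norm_integral_le_of_norm_le_const (C := m) fun r' _ => ?_).trans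
        (by simp)
      rw [← dist_eq_norm]
      refine hmod _ _ ?_
      rw [abs_le]
      constructor <;> linarith)
  have hlow : ∫ t in a..b, avg ε κ t ≤
      ∫ t in a..b, ∫ r in (0 : ℝ)..1, quint (toL6 Ω (U (t + ε * r))) (toL6 Ω (B t r)) := by
    refine h.integral_quint_mono ε hBc (q := fun t r => κ (t + ε * r)) (by fun_prop) hab
      fun t r => ?_
    simp only [hB, hκ, map_smul, map_sub, pot]
    rw [quint_smul]
    have := quint_sub_ge (toL6 Ω (U (t + ε * r))) (toL6 Ω (U (t + ε * r - ε)))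
    have h2 := mul_le_mul_of_nonneg_left this (inv_nonneg.2 hε.le)
    refine le_trans (le_of_eq ?_) h2
    rw [inv_neg, smul_eq_mul, ← sub_eq_add_neg]
    ring
  have hsum := h.integral_quint_add ε hBc hDc a b
  have hBD (t r : ℝ) : B t r + D t r = diffQuot U ε t := by simp only [hD]; abel
  simp only [hBD] at hsum
  rw [hsum]
  have := (abs_le.1 herr).1
  linarith

/-- The averaged equation is tested with the time derivative of the averaged solution, which is an
element of H¹₀ although ∂ₜu itself is only in L². -/
theorem kinetic_identity (h : IsSol Ω T U V) {a b ε : ℝ} (ha : 0 ≤ a) (hab : a ≤ b) (hε : 0 < ε)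
    (hεT : b + ε ≤ T) :
    (‖(avg ε U b).1.2‖ ^ 2 / 2 + ‖avg ε V b‖ ^ 2 / 2) -
      (‖(avg ε U a).1.2‖ ^ 2 / 2 + ‖avg ε V a‖ ^ 2 / 2) =
    -∫ t in a..b, ∫ r in (0 : ℝ)..1, quint (toL6 Ω (U (t + ε * r))) (toL6 Ω (diffQuot U ε t)) := by
  have hderiv (t : ℝ) (ht : t ∈ uIcc a b) : HasDerivAt
      (fun t => ‖(avg ε U t).1.2‖ ^ 2 / 2 + ‖avg ε V t‖ ^ 2 / 2)
      (-∫ r in (0 : ℝ)..1, quint (toL6 Ω (U (t + ε * r))) (toL6 Ω (diffQuot U ε t))) t := by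
    rw [uIcc_of_le hab] at ht
    have d1 : HasDerivAt (fun s => (avg ε U s).1.2) (diffQuot U ε t).1.2 t :=
      ((sndV Ω).hasFDerivAt (x := avg ε U t)).comp_hasDerivAt t (hasDerivAt_avg h.contU hε.ne' t)
    have d2 := hasDerivAt_avg h.contV hε.ne' t
    have d3 := (d1.norm_sq.div_const 2).add (d2.norm_sq.div_const 2)
    have h1 := h.steklov_eq (t := t) hε (by linarith [ht.1]) (by linarith [ht.2]) (diffQuot U ε t)
    rw [h.diffQuot_fst hε (by linarith [ht.1]) (by linarith [ht.2])] at h1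
    refine d3.congr_deriv ?_
    rw [real_inner_comm] at h1
    linarith
  rw [← intervalIntegral.integral_neg]
  refine (intervalIntegral.integral_eq_sub_of_hasDerivAt hderiv ?_).symm
  exact ((h.continuous_integral_quint ε (Ψ := fun t _ => diffQuot U ε t)
    ((h.continuous_diffQuot ε).comp continuous_fst)).neg).intervalIntegrable _ _

/-- The kinetic identity and the lower bound for the work of the nonlinearity are added. First ε → 0
with the modulus m fixed, then m → 0 removes the error. -/
theorem en_le_of_pos (h : IsSol Ω T U V) {a b : ℝ} (ha : 0 < a) (hab : a ≤ b) (hb : b < T) :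
    en (U b) (V b) ≤ en (U a) (V a) := by
  set Φ : ℝ → ℝ := fun t => pot (U t) with hΦ
  have hΦc : Continuous Φ := continuous_pot.comp h.contU
  set e : ℝ → ℝ → ℝ := fun ε t => ‖(avg ε U t).1.2‖ ^ 2 / 2 + ‖avg ε V t‖ ^ 2 / 2 with he
  have hec (t : ℝ) : Continuous fun ε => e ε t := by
    have h1 : Continuous fun ε => (avg ε U t).1.2 := (sndV Ω).continuous.comp
      ((continuous_avg h.contU).comp (by fun_prop : Continuous fun ε : ℝ => (ε, t)))
    have h2 : Continuous fun ε => avg ε V t :=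
      (continuous_avg h.contV).comp (by fun_prop : Continuous fun ε : ℝ => (ε, t))
    simp only [he]
    fun_prop
  have hAc (t : ℝ) : Continuous fun ε => avg ε (avg (-ε) Φ) t := by
    unfold avg
    refine intervalIntegral.continuous_parametric_intervalIntegral_of_continuous' ?_ 0 1
    have := (continuous_avg hΦc).comp
      (by fun_prop : Continuous fun p : ℝ × ℝ => (-p.1, t + p.1 * p.2))
    exact this
  have main : ∀ m > 0, en (U b) (V b) - en (U a) (V a) ≤ m * h.nlBound := by
    intro m hm
    obtain ⟨δ, hδ, hmod⟩ := exists_modulus h.ucV hm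
    have hlim : Tendsto (fun ε => (e ε b - e ε a) +
        (avg ε (avg (-ε) Φ) b - avg ε (avg (-ε) Φ) a)) (𝓝[>] 0)
        (𝓝 (en (U b) (V b) - en (U a) (V a))) := by
      have hcont : Continuous fun ε => (e ε b - e ε a) +
          (avg ε (avg (-ε) Φ) b - avg ε (avg (-ε) Φ) a) :=
        ((hec b).sub (hec a)).add ((hAc b).sub (hAc a))
      have := hcont.tendsto 0
      simp only [neg_zero, avg_zero, he, hΦ] at this
      convert this.mono_left nhdsWithin_le_nhds using 2
      simp only [en]
      ring
    refine le_of_tendsto hlim ?_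
    filter_upwards [self_mem_nhdsWithin, nhdsWithin_le_nhds (Iio_mem_nhds hδ),
      nhdsWithin_le_nhds (Iio_mem_nhds ha), nhdsWithin_le_nhds (Iio_mem_nhds (sub_pos.2 hb))]
      with ε hε hεδ hεa hεT
    rw [mem_Iio] at hεδ hεa hεT
    have h1 := h.kinetic_identity ha.le hab hε (by linarith)
    have h2 := h.integral_quint_diffQuot_ge hab hε hεa (by linarith) (m := m) fun s t hst =>
      hmod s t (hst.trans hεδ.le)
    simp only [he]
    linarith
  have : Tendsto (fun m => m * h.nlBound) (𝓝[>] 0) (𝓝 (0 * h.nlBound)) :=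
    ((continuous_id.mul continuous_const).tendsto (0 : ℝ)).mono_left nhdsWithin_le_nhds
  have h2 := ge_of_tendsto this (eventually_nhdsWithin_of_forall main)
  rw [zero_mul] at h2
  linarith

theorem continuous_en (h : IsSol Ω T U V) : Continuous fun t => en (U t) (V t) := by
  have h1 : Continuous fun t => (U t).1.2 := (sndV Ω).continuous.comp h.contU
  have h2 := h.contV
  have h3 : Continuous fun t => pot (U t) := continuous_pot.comp h.contU
  unfold en
  fun_prop

/-- The energy inequality. -/
theorem en_le (h : IsSol Ω T U V) {t : ℝ} (ht : 0 < t) (htT : t < T) :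
    en (U t) (V t) ≤ en (U 0) (V 0) := by
  have hlim : Tendsto (fun t => en (U t) (V t)) (𝓝[>] 0) (𝓝 (en (U 0) (V 0))) :=
    (h.continuous_en.tendsto 0).mono_left nhdsWithin_le_nhds
  refine ge_of_tendsto hlim ?_
  filter_upwards [self_mem_nhdsWithin, nhdsWithin_le_nhds (Iio_mem_nhds ht)] with s h1 h2
  exact h.en_le_of_pos h1 h2.le htT

end IsSol

/-! ### The multiplier applied to a single state -/

namespace IsCutoff

variable {χ : E3 → ℝ} {L : ℝ} {Ω : Set E3} {a : E3} {k : ℝ}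

theorem _root_.QuinticWave.norm_smul_sub_trans_le (hk : 0 ≤ k) (hka : k * ‖a‖ = 1) (x : VSub Ω) :
    ‖k • (x.1.1 - transOp a x.1.1)‖ ≤ ‖x.1.2‖ := by
  rw [norm_smul, Real.norm_of_nonneg hk]
  calc k * ‖x.1.1 - transOp a x.1.1‖ ≤ k * (‖a‖ * ‖x.1.2‖) := by
        gcongr; exact norm_sub_trans_le x.2 a
    _ = ‖x.1.2‖ := by rw [← mul_assoc, hka, one_mul]

theorem norm_diffV_fst_le (h : IsCutoff χ L) (hk : 0 ≤ k) (hka : k * ‖a‖ = 1)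
    (ha : ∀ x ∈ tsupport χ, x - a ∈ Ω → x ∈ Ω) (x : VSub Ω) :
    ‖(h.diffV k ha x).1.1‖ ≤ ‖x.1.2‖ := by
  rw [diffV_coe, diffOp_fst]
  refine (norm_mulOp_le h.memLp h.abs_le_one _).trans ?_
  rw [one_mul]
  exact norm_smul_sub_trans_le hk hka x

/-- The weighted square of the increment of the gradient. -/
def incr (h : IsCutoff χ L) (a : E3) (x : VSub Ω) : ℝ :=
  inner ℝ (x.1.2 - transOp a x.1.2) (mulOp h.memLp (x.1.2 - transOp a x.1.2))

theorem continuous_incr (h : IsCutoff χ L) (a : E3) : Continuous (h.incr (Ω := Ω) a) := by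
  have h1 : Continuous fun x : VSub Ω => x.1.2 - transOp a x.1.2 :=
    (sndV Ω).continuous.sub ((transOp a).continuous.comp (sndV Ω).continuous)
  exact h1.inner ((mulOp h.memLp).continuous.comp h1)

/-- Used for the time derivative, where the squared increment has the unfavourable sign. The
increment is at most ‖a‖ times the norm of the gradient, so after multiplication by k = 1/‖a‖ one
factor ‖a‖ survives and the loss vanishes as a → 0. -/
theorem inner_diffV_fst_le (h : IsCutoff χ L) (hk : 0 ≤ k) (hka : k * ‖a‖ = 1)
    (ha : ∀ x ∈ tsupport χ, x - a ∈ Ω → x ∈ Ω) (x : VSub Ω) :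
    inner ℝ x.1.1 (h.diffV k ha x).1.1 ≤ L * ‖x.1.1‖ ^ 2 / 2 + ‖a‖ * ‖x.1.2‖ ^ 2 / 2 := by
  have h1 := h.two_mul_inner_diff a k x.1.1
  have h2 := (abs_le.1 (h.abs_inner_mulOp_sub_trans_le a x.1.1)).2
  have h3 := h.inner_mulOp_self_le (x.1.1 - transOp a x.1.1)
  have h4 := norm_sub_trans_le x.2 a
  have h5 : ‖x.1.1 - transOp a x.1.1‖ ^ 2 ≤ (‖a‖ * ‖x.1.2‖) ^ 2 := by gcongr
  have h6 := mul_le_mul_of_nonneg_left h2 hk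
  have h7 := mul_le_mul_of_nonneg_left (h3.trans h5) hk
  rw [diffV_coe, diffOp_fst]
  have e1 : k * (L * ‖a‖ * ‖x.1.1‖ ^ 2) = L * ‖x.1.1‖ ^ 2 := by
    calc _ = (k * ‖a‖) * (L * ‖x.1.1‖ ^ 2) := by ring
      _ = _ := by rw [hka, one_mul]
  have e2 : k * (‖a‖ * ‖x.1.2‖) ^ 2 = ‖a‖ * ‖x.1.2‖ ^ 2 := by
    calc _ = (k * ‖a‖) * (‖a‖ * ‖x.1.2‖ ^ 2) := by ring
      _ = _ := by rw [hka, one_mul]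
  linarith

/-- Here the squared increment has the good sign and is kept. The loss is L/2 from translating the
cutoff plus L from the term with ∇χ. -/
theorem inner_diffV_snd_ge (h : IsCutoff χ L) (hk : 0 ≤ k) (hka : k * ‖a‖ = 1)
    (ha : ∀ x ∈ tsupport χ, x - a ∈ Ω → x ∈ Ω) (x : VSub Ω) :
    k * h.incr a x / 2 - 3 * L * ‖x.1.2‖ ^ 2 / 2 ≤ inner ℝ x.1.2 (h.diffV k ha x).1.2 := by
  have h1 := h.two_mul_inner_diff a k x.1.2
  have h2 := (abs_le.1 (h.abs_inner_mulOp_sub_trans_le a x.1.2)).1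
  have h6 := mul_le_mul_of_nonneg_left h2 hk
  rw [diffV_coe, diffOp_snd, inner_add_right]
  have e1 : k * -(L * ‖a‖ * ‖x.1.2‖ ^ 2) = -(L * ‖x.1.2‖ ^ 2) := by
    calc _ = (k * ‖a‖) * -(L * ‖x.1.2‖ ^ 2) := by ring
      _ = _ := by rw [hka, one_mul]
  have h3 : |inner ℝ x.1.2 (vecMulOp h.memLp_grad (k • (x.1.1 - transOp a x.1.1)))| ≤
      ‖x.1.2‖ * (L * ‖x.1.2‖) := by
    refine (abs_real_inner_le_norm _ _).trans ?_
    gcongr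
    refine (norm_vecMulOp_le h.memLp_grad h.grad_le _).trans ?_
    have := h.L_nonneg
    gcongr
    exact norm_smul_sub_trans_le hk hka x
  have h4 := (abs_le.1 h3).1
  unfold incr
  nlinarith

end IsCutoff

/-! ### The discrete Rellich estimate for solutions -/

namespace IsSol

variable {Ω : Set E3} {T : ℝ} {U : ℝ → VSub Ω} {V : ℝ → H} {χ : E3 → ℝ} {L : ℝ}

theorem sq_norm_snd_le (h : IsSol Ω T U V) {t : ℝ} (ht : 0 < t) (htT : t < T) :
    ‖(U t).1.2‖ ^ 2 ≤ 2 * en (U 0) (V 0) := by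
  have h1 := h.en_le ht htT
  have h2 := pot_nonneg (U t)
  unfold en at *
  nlinarith [sq_nonneg ‖V t‖]

theorem sq_norm_V_le (h : IsSol Ω T U V) {t : ℝ} (ht : 0 < t) (htT : t < T) :
    ‖V t‖ ^ 2 ≤ 2 * en (U 0) (V 0) := by
  have h1 := h.en_le ht htT
  have h2 := pot_nonneg (U t)
  unfold en at *
  nlinarith [sq_nonneg ‖(U t).1.2‖]

theorem pot_le (h : IsSol Ω T U V) {t : ℝ} (ht : 0 < t) (htT : t < T) :
    pot (U t) ≤ en (U 0) (V 0) := by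
  have h1 := h.en_le ht htT
  unfold en at *
  nlinarith [sq_nonneg ‖(U t).1.2‖, sq_nonneg ‖V t‖]

theorem _root_.QuinticWave.en_nonneg (x : VSub Ω) (y : H) : 0 ≤ en x y := by
  have := pot_nonneg x
  unfold en; positivity

theorem avg_snd (h : IsSol Ω T U V) (ε t : ℝ) :
    (avg ε U t).1.2 = avg ε (fun s => (U s).1.2) t := map_avg (sndV Ω) h.contU ε t

theorem sq_norm_avg_snd_le (h : IsSol Ω T U V) {ε t : ℝ} (hε : 0 ≤ ε) (ht : 0 < t)
    (htT : t + ε < T) : ‖(avg ε U t).1.2‖ ^ 2 ≤ 2 * en (U 0) (V 0) := by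
  have : ‖(avg ε U t).1.2‖ ≤ √(2 * en (U 0) (V 0)) := by
    rw [h.avg_snd]
    refine norm_avg_le ((sndV Ω).continuous.comp h.contU) fun r hr => ?_
    have := mul_nonneg hε hr.1
    have := mul_le_mul_of_nonneg_left hr.2 hε
    exact Real.le_sqrt_of_sq_le (h.sq_norm_snd_le (by linarith) (by linarith))
  calc _ ≤ √(2 * en (U 0) (V 0)) ^ 2 := by gcongr
    _ = _ := Real.sq_sqrt (by have := en_nonneg (U 0) (V 0); positivity)

theorem sq_norm_avg_V_le (h : IsSol Ω T U V) {ε t : ℝ} (hε : 0 ≤ ε) (ht : 0 < t)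
    (htT : t + ε < T) : ‖avg ε V t‖ ^ 2 ≤ 2 * en (U 0) (V 0) := by
  have : ‖avg ε V t‖ ≤ √(2 * en (U 0) (V 0)) := by
    refine norm_avg_le h.contV fun r hr => ?_
    have := mul_nonneg hε hr.1
    have := mul_le_mul_of_nonneg_left hr.2 hε
    exact Real.le_sqrt_of_sq_le (h.sq_norm_V_le (by linarith) (by linarith))
  calc _ ≤ √(2 * en (U 0) (V 0)) ^ 2 := by gcongr
    _ = _ := Real.sq_sqrt (by have := en_nonneg (U 0) (V 0); positivity)

/-- The contribution of the nonlinearity. -/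
theorem integral_quint_diffV_ge (h : IsSol Ω T U V) (hχ : IsCutoff χ L) {c : E3} {k : ℝ}
    (hk : 0 ≤ k) (hkc : k * ‖c‖ = 1) (hc : ∀ x ∈ tsupport χ, x - c ∈ Ω → x ∈ Ω)
    {a b ε m : ℝ} (ha : 0 < a) (hab : a ≤ b) (hε : 0 < ε) (hεT : b + ε < T)
    (hmod : ∀ s t, |s - t| ≤ ε → dist (U s) (U t) ≤ m) :
    -(L * en (U 0) (V 0) * (b - a)) - m * h.nlBound ≤
      ∫ t in a..b, ∫ r in (0 : ℝ)..1,
        quint (toL6 Ω (U (t + ε * r))) (toL6 Ω (hχ.diffV k hc (avg ε U t))) := by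
  have hUc : Continuous fun p : ℝ × ℝ => U (p.1 + ε * p.2) := h.contU.comp (by fun_prop)
  have hAc : Continuous fun p : ℝ × ℝ => avg ε U p.1 :=
    (continuous_avg_right h.contU ε).comp continuous_fst
  -- Convexity needs multiplier and nonlinearity at the same time t + εr, so the averaged state is
  -- replaced by U(t + εr). The multiplier changes in L² by at most the change of the gradient,
  -- which is at most m.
  have hΨ1 : Continuous (Function.uncurry fun t r => hχ.diffV k hc (U (t + ε * r))) :=
    (hχ.diffV k hc).continuous.comp hUc
  have hΨ2 : Continuous (Function.uncurry fun t r => hχ.diffV k hc (avg ε U t - U (t + ε * r))) :=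
    (hχ.diffV k hc).continuous.comp (hAc.sub hUc)
  have hsum := h.integral_quint_add ε hΨ1 hΨ2 a b
  simp only [← map_add, add_sub_cancel] at hsum
  rw [hsum]
  have herr := h.abs_integral_quint_le hΨ2 (m := m) ha.le hab hε.le hεT.le (by
    intro t ht r hr
    refine (hχ.norm_diffV_fst_le hk hkc hc _).trans ?_
    refine (norm_snd_le (avg ε U t - U (t + ε * r)).1).trans ?_
    refine norm_avg_sub_le h.contU fun r' hr' => ?_
    rw [← dist_eq_norm]
    refine hmod _ _ ?_
    rw [add_sub_add_left_eq_sub, ← mul_sub, abs_mul, abs_of_pos hε]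
    have : |r' - r| ≤ 1 := abs_le.2 ⟨by linarith [hr.2, hr'.1], by linarith [hr.1, hr'.2]⟩
    nlinarith)
  have hlow := h.integral_quint_mono ε hΨ1 (q := fun t r => -(L * pot (U (t + ε * r))))
    (continuous_const.mul (continuous_pot.comp hUc)).neg hab (fun t r => by
      have := hχ.quint_diffV_ge hk hc (U (t + ε * r))
      refine le_trans (le_of_eq ?_) this
      unfold pot
      calc _ = -((1 : ℝ) * (L * quint (toL6 Ω (U (t + ε * r))) (toL6 Ω (U (t + ε * r))) / 6)) := by ring
        _ = _ := by rw [← hkc]; ring)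
  have hL := hχ.L_nonneg
  have hb : |∫ t in a..b, ∫ r in (0 : ℝ)..1, -(L * pot (U (t + ε * r)))| ≤
      L * en (U 0) (V 0) * |b - a| := by
    rw [← Real.norm_eq_abs]
    refine intervalIntegral.norm_integral_le_of_norm_le_const fun t ht => ?_
    rw [uIoc_of_le hab] at ht
    refine (intervalIntegral.norm_integral_le_of_norm_le_const
      (C := L * en (U 0) (V 0)) fun r hr => ?_).trans (by simp)
    rw [uIoc_of_le zero_le_one] at hr
    rw [norm_neg, Real.norm_of_nonneg (mul_nonneg hL (pot_nonneg _))]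
    have h1 := mul_nonneg hε.le hr.1.le
    have h2 := mul_le_mul_of_nonneg_left hr.2 hε.le
    gcongr
    exact h.pot_le (by linarith [ht.1]) (by linarith [ht.2])
  rw [abs_of_nonneg (sub_nonneg.2 hab)] at hb
  have h1 := (abs_le.1 hb).1
  have h2 := (abs_le.1 herr).1
  linarith

/-- Integration by parts in time. Each end point costs 2E, because the difference quotient is
bounded in L² by the gradient. The remaining integrand is the multiplier's quadratic form at
`diffQuot U ε t`, whose function component is the average of V. Z bounds its gradient; it may depend
on ε, but enters only with the factor ‖c‖. -/
theorem integral_inner_diffV_ge (h : IsSol Ω T U V) (hχ : IsCutoff χ L) {c : E3} {k : ℝ}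
    (hk : 0 ≤ k) (hkc : k * ‖c‖ = 1) (hc : ∀ x ∈ tsupport χ, x - c ∈ Ω → x ∈ Ω)
    {a b ε Z : ℝ} (ha : 0 < a) (hab : a ≤ b) (hε : 0 < ε) (hεT : b + ε < T)
    (hZ : ∀ t ∈ Icc a b, ‖(diffQuot U ε t).1.2‖ ≤ Z) :
    -(4 * en (U 0) (V 0)) - (L * en (U 0) (V 0) + ‖c‖ * Z ^ 2 / 2) * (b - a) ≤
      ∫ t in a..b, inner ℝ (ε⁻¹ • (V (t + ε) - V t)) (hχ.diffV k hc (avg ε U t)).1.1 := by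
  set E := en (U 0) (V 0)
  have hE : 0 ≤ E := en_nonneg _ _
  have hL := hχ.L_nonneg
  have hWc := continuous_avg_right h.contU ε
  have hVc := continuous_avg_right h.contV ε
  have hDc : Continuous fun x : VSub Ω => (hχ.diffV k hc x).1.1 :=
    (fstV Ω).continuous.comp (hχ.diffV k hc).continuous
  have hd (t : ℝ) : HasDerivAt (fun t => inner ℝ (avg ε V t) (hχ.diffV k hc (avg ε U t)).1.1)
      (inner ℝ (ε⁻¹ • (V (t + ε) - V t)) (hχ.diffV k hc (avg ε U t)).1.1 +
        inner ℝ (avg ε V t) (hχ.diffV k hc (diffQuot U ε t)).1.1) t := by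
    have d1 : HasDerivAt (fun t => (hχ.diffV k hc (avg ε U t)).1.1)
        (hχ.diffV k hc (diffQuot U ε t)).1.1 t :=
      (((fstV Ω).comp (hχ.diffV k hc)).hasFDerivAt (x := avg ε U t)).comp_hasDerivAt t
        (hasDerivAt_avg h.contU hε.ne' t)
    refine ((hasDerivAt_avg h.contV hε.ne' t).inner ℝ d1).congr_deriv ?_
    rw [add_comm]
  have c1 : Continuous fun t =>
      inner ℝ (ε⁻¹ • (V (t + ε) - V t)) (hχ.diffV k hc (avg ε U t)).1.1 := by
    have := h.contV
    exact Continuous.inner (by fun_prop) (hDc.comp hWc)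
  have c2 : Continuous fun t => inner ℝ (avg ε V t) (hχ.diffV k hc (diffQuot U ε t)).1.1 :=
    hVc.inner (hDc.comp (h.continuous_diffQuot ε))
  have hint := intervalIntegral.integral_eq_sub_of_hasDerivAt (fun t (_ : t ∈ uIcc a b) => hd t)
    ((c1.add c2).intervalIntegrable a b)
  rw [intervalIntegral.integral_add (c1.intervalIntegrable _ _) (c2.intervalIntegrable _ _)] at hint
  have hend (t : ℝ) (ht : t ∈ Icc a b) :
      |inner ℝ (avg ε V t) (hχ.diffV k hc (avg ε U t)).1.1| ≤ 2 * E := by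
    refine (abs_real_inner_le_norm _ _).trans ?_
    have h1 := hχ.norm_diffV_fst_le hk hkc hc (avg ε U t)
    have h2 := h.sq_norm_avg_snd_le hε.le (t := t) (by linarith [ht.1]) (by linarith [ht.2])
    have h3 := h.sq_norm_avg_V_le hε.le (t := t) (by linarith [ht.1]) (by linarith [ht.2])
    have h4 : ‖avg ε V t‖ * ‖(hχ.diffV k hc (avg ε U t)).1.1‖ ≤
      ‖avg ε V t‖ * ‖(avg ε U t).1.2‖ := by gcongr
    nlinarith [sq_nonneg (‖avg ε V t‖ - ‖(avg ε U t).1.2‖)]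
  have hz : ∫ t in a..b, inner ℝ (avg ε V t) (hχ.diffV k hc (diffQuot U ε t)).1.1 ≤
      ∫ t in a..b, (L * E + ‖c‖ * Z ^ 2 / 2) := by
    refine intervalIntegral.integral_mono_on hab (c2.intervalIntegrable _ _) (by simp)
      fun t ht => ?_
    have h1 := hχ.inner_diffV_fst_le hk hkc hc (diffQuot U ε t)
    rw [h.diffQuot_fst hε (by linarith [ht.1]) (by linarith [ht.2])] at h1
    refine h1.trans ?_
    have h3 := h.sq_norm_avg_V_le hε.le (t := t) (by linarith [ht.1]) (by linarith [ht.2])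
    have h4 : ‖(diffQuot U ε t).1.2‖ ^ 2 ≤ Z ^ 2 := by
      have := hZ t ht
      gcongr
    have h5 := mul_le_mul_of_nonneg_left h3 hL
    have h6 := mul_le_mul_of_nonneg_left h4 (norm_nonneg c)
    linarith
  rw [intervalIntegral.integral_const, smul_eq_mul] at hz
  have e1 := (abs_le.1 (hend b (right_mem_Icc.2 hab))).1
  have e2 := (abs_le.1 (hend a (left_mem_Icc.2 hab))).2
  linarith

/-- The Rellich estimate in terms of increments of the gradient. -/
theorem integral_incr_le (h : IsSol Ω T U V) (hχ : IsCutoff χ L) {c : E3} {k : ℝ}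
    (hk : 0 ≤ k) (hkc : k * ‖c‖ = 1) (hc : ∀ x ∈ tsupport χ, x - c ∈ Ω → x ∈ Ω)
    {a b ε m Z : ℝ} (ha : 0 < a) (hab : a ≤ b) (hε : 0 < ε) (hεT : b + ε < T)
    (hmod : ∀ s t, |s - t| ≤ ε → dist (U s) (U t) ≤ m)
    (hZ : ∀ t ∈ Icc a b, ‖(diffQuot U ε t).1.2‖ ≤ Z) :
    k * ∫ t in a..b, hχ.incr c (avg ε U t) ≤
      (8 + 10 * L * T) * en (U 0) (V 0) + T * ‖c‖ * Z ^ 2 + 2 * m * h.nlBound := by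
  set E := en (U 0) (V 0)
  have hE : 0 ≤ E := en_nonneg _ _
  have hL := hχ.L_nonneg
  have hWc := continuous_avg_right h.contU ε
  have hDc : Continuous fun x : VSub Ω => (hχ.diffV k hc x).1 :=
    continuous_subtype_val.comp (hχ.diffV k hc).continuous
  have c1 : Continuous fun t =>
      inner ℝ (ε⁻¹ • (V (t + ε) - V t)) (hχ.diffV k hc (avg ε U t)).1.1 := by
    have := h.contV
    exact Continuous.inner (by fun_prop) (continuous_fst.comp (hDc.comp hWc))
  have c2 : Continuous fun t => inner ℝ (avg ε U t).1.2 (hχ.diffV k hc (avg ε U t)).1.2 :=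
    ((sndV Ω).continuous.comp hWc).inner (continuous_snd.comp (hDc.comp hWc))
  have c3 : Continuous fun t => ∫ r in (0 : ℝ)..1,
      quint (toL6 Ω (U (t + ε * r))) (toL6 Ω (hχ.diffV k hc (avg ε U t))) :=
    h.continuous_integral_quint ε (Ψ := fun t _ => hχ.diffV k hc (avg ε U t))
      ((hχ.diffV k hc).continuous.comp (hWc.comp continuous_fst))
  have hzero : ∫ t in a..b, (inner ℝ (ε⁻¹ • (V (t + ε) - V t)) (hχ.diffV k hc (avg ε U t)).1.1 +
      inner ℝ (avg ε U t).1.2 (hχ.diffV k hc (avg ε U t)).1.2 + ∫ r in (0 : ℝ)..1,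
      quint (toL6 Ω (U (t + ε * r))) (toL6 Ω (hχ.diffV k hc (avg ε U t)))) = 0 := by
    rw [intervalIntegral.integral_congr (g := fun _ => (0 : ℝ)) fun t ht => ?_]
    · simp
    · rw [uIcc_of_le hab] at ht
      exact h.steklov_eq hε (by linarith [ht.1]) (by linarith [ht.2]) _
  rw [intervalIntegral.integral_add ((c1.fun_add c2).intervalIntegrable _ _)
    (c3.intervalIntegrable _ _), intervalIntegral.integral_add (c1.intervalIntegrable _ _)
    (c2.intervalIntegrable _ _)] at hzero
  have h1 := h.integral_inner_diffV_ge hχ hk hkc hc ha hab hε hεT hZ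
  have h3 := h.integral_quint_diffV_ge hχ hk hkc hc ha hab hε hεT hmod
  have hic : Continuous fun t => hχ.incr c (avg ε U t) := (hχ.continuous_incr c).comp hWc
  have h2 : ∫ t in a..b, (k / 2 * hχ.incr c (avg ε U t) - 3 * L * E) ≤
      ∫ t in a..b, inner ℝ (avg ε U t).1.2 (hχ.diffV k hc (avg ε U t)).1.2 := by
    refine intervalIntegral.integral_mono_on hab
      (((hic.const_mul (k / 2)).sub continuous_const).intervalIntegrable _ _)
      (c2.intervalIntegrable _ _) fun t ht => ?_
    have h4 := hχ.inner_diffV_snd_ge hk hkc hc (avg ε U t)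
    have h5 := h.sq_norm_avg_snd_le hε.le (t := t) (by linarith [ht.1]) (by linarith [ht.2])
    have h6 := mul_le_mul_of_nonneg_left h5 hL
    linarith
  rw [intervalIntegral.integral_sub ((hic.const_mul (k / 2)).intervalIntegrable _ _) (by simp),
    intervalIntegral.integral_const_mul, intervalIntegral.integral_const, smul_eq_mul] at h2
  -- The gradient, the time derivative and the nonlinearity cost 3LE, LE and LE per unit time, and
  -- the end points cost 4E in total. The gain carries the factor 1/2, so doubling gives 10L and 8.
  have hT : b - a ≤ T := by linarith
  have hLE : 0 ≤ L * E := mul_nonneg hL hE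
  have hcZ : 0 ≤ ‖c‖ * Z ^ 2 := by positivity
  have h7 := mul_le_mul_of_nonneg_left hT hLE
  have h8 := mul_le_mul_of_nonneg_left hT hcZ
  nlinarith

end IsSol

/-! ### Coordinates -/

/-- The Euclidean plane. -/
abbrev E2 : Type := EuclideanSpace ℝ (Fin 2)

/-- The projection of `ℝ³` forgetting the `i`-th coordinate. -/
def proj (i : Fin 3) (x : E3) : E2 := WithLp.toLp 2 fun j => x (i.succAbove j)

/-- The point with `i`-th coordinate `s` and projection `y`. -/
def lift (i : Fin 3) (s : ℝ) (y : E2) : E3 := WithLp.toLp 2 (i.insertNth s fun j => y j)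

theorem proj_sub (i : Fin 3) (x y : E3) : proj i (x - y) = proj i x - proj i y := rfl

theorem norm_sq_eq_proj (i : Fin 3) (x : E3) : ‖x‖ ^ 2 = x i ^ 2 + ‖proj i x‖ ^ 2 := by
  rw [EuclideanSpace.norm_sq_eq, EuclideanSpace.norm_sq_eq, Fin.sum_univ_succAbove _ i]
  simp [proj]

theorem norm_proj_le (i : Fin 3) (x : E3) : ‖proj i x‖ ≤ ‖x‖ := by
  refine le_of_sq_le_sq ?_ (norm_nonneg _)
  rw [norm_sq_eq_proj i x]
  nlinarith [sq_nonneg (x i)]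

theorem norm_le_proj (i : Fin 3) (x : E3) : ‖x‖ ≤ |x i| + ‖proj i x‖ := by
  refine le_of_sq_le_sq ?_ (by positivity)
  rw [norm_sq_eq_proj i x, ← sq_abs (x i)]
  nlinarith [mul_nonneg (abs_nonneg (x i)) (norm_nonneg (proj i x))]

theorem lipschitzWith_proj (i : Fin 3) : LipschitzWith 1 (proj i) :=
  LipschitzWith.of_dist_le_mul fun x y => by
    rw [dist_eq_norm, dist_eq_norm, ← proj_sub, NNReal.coe_one, one_mul]
    exact norm_proj_le i _

@[simp] theorem proj_lift (i : Fin 3) (s : ℝ) (y : E2) : proj i (lift i s y) = y := by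
  ext j; simp [proj, lift]

@[simp] theorem lift_apply_self (i : Fin 3) (s : ℝ) (y : E2) : lift i s y i = s := by
  simp [lift]

theorem measurePreserving_lift (i : Fin 3) :
    MeasurePreserving (fun z : ℝ × E2 => lift i z.1 z.2) := by
  have h1 : MeasurePreserving (fun z : ℝ × E2 => (z.1, (WithLp.ofLp z.2 : Fin 2 → ℝ)))
      (volume.prod volume) (volume.prod volume) :=
    (MeasurePreserving.id volume).prod (PiLp.volume_preserving_ofLp (Fin 2))
  have h2 := (volume_preserving_piFinSuccAbove (fun _ : Fin 3 => ℝ) i).symm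
  have h3 := PiLp.volume_preserving_toLp (Fin 3)
  exact h3.comp (h2.comp h1)

theorem lintegral_eq_lift (i : Fin 3) {f : E3 → ENNReal} (hf : Measurable f) :
    ∫⁻ x, f x = ∫⁻ y : E2, ∫⁻ s : ℝ, f (lift i s y) := by
  rw [← (measurePreserving_lift i).lintegral_comp hf, Measure.volume_eq_prod]
  exact lintegral_prod_symm (fun z : ℝ × E2 => f (lift i z.1 z.2))
    (hf.comp (measurePreserving_lift i).measurable).aemeasurable

/-! ### Boundary patches -/

/-- Near the boundary point `p`, the domain is `{ρ < 0}`, where `ρ` decreases at a definite rate in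
the direction `e`, which is `±` the `i`-th basis vector. -/
structure IsPatch (Ω : Set E3) (p : E3) (i : Fin 3) (e : E3) (ρ : E3 → ℝ) (R c M : ℝ) : Prop where
  smooth : ContDiff ℝ ∞ ρ
  R_pos : 0 < R
  c_pos : 0 < c
  M_pos : 0 < M
  norm_e : ‖e‖ = 1
  proj_e : ∀ (x : E3) (s : ℝ), proj i (x - s • e) = proj i x
  mem_iff : ∀ x ∈ Metric.ball p R, x ∈ Ω ↔ ρ x < 0
  mono : ∀ x ∈ Metric.ball p R, ∀ s, 0 ≤ s → x - s • e ∈ Metric.ball p R →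
    ρ x ≤ ρ (x - s • e) - c * s
  anti : ∀ x ∈ Metric.ball p R, ∀ y ∈ Metric.ball p R, ρ x = 0 → ρ y = 0 →
    ‖x - y‖ ≤ M * ‖proj i x - proj i y‖
  grad_le : ∀ x ∈ Metric.ball p R, ‖gradient ρ x‖ ≤ M

theorem exists_coord_ne_zero {D : E3 →L[ℝ] ℝ} (hD : D ≠ 0) :
    ∃ i : Fin 3, D (EuclideanSpace.single i 1) ≠ 0 := by
  by_contra! h
  refine hD (ContinuousLinearMap.coe_injective ((EuclideanSpace.basisFun (Fin 3) ℝ).toBasis.ext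
    fun i => ?_))
  simpa using h i

/-- Some coordinate derivative of ρ at p is non-zero, of absolute value d. Strict differentiability
approximates ρ on a small ball by its linear part with relative error d/2. This yields decrease at
rate d/2 along e, and makes the i-th coordinate of a difference of two zeros bounded by its
projection: a Lipschitz graph, without the implicit function theorem. -/
theorem exists_isPatch {Ω : Set E3} (hΩ : IsSmoothBoundedDomain Ω) {p : E3} (hp : p ∈ frontier Ω) :
    ∃ i e ρ R c M, IsPatch Ω p i e ρ R c M := by
  obtain ⟨ρ, hρ, hgrad, hloc⟩ := hΩ.smooth_boundary p hp
  set D := fderiv ℝ ρ p with hDdef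
  have hD : D ≠ 0 := by
    intro h0
    apply hgrad
    rw [gradient_def, ← hDdef, h0, map_zero]
  obtain ⟨i, hi⟩ := exists_coord_ne_zero hD
  set b : E3 := EuclideanSpace.single i 1 with hb
  set d : ℝ := |D b| with hd
  have hd0 : 0 < d := abs_pos.2 hi
  set e : E3 := (-(SignType.sign (D b) : ℝ)) • b with he
  have hDe : D e = -d := by
    rw [he, map_smul, smul_eq_mul, neg_mul, sign_mul_self, hd]
  have hbnorm : ‖b‖ = 1 := by simp [hb]
  have hsign : |(SignType.sign (D b) : ℝ)| = 1 := by
    rcases lt_or_gt_of_ne hi with h | h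
    · rw [sign_neg h]; simp
    · rw [sign_pos h]; simp
  have henorm : ‖e‖ = 1 := by
    rw [he, norm_smul, hbnorm, mul_one, norm_neg, Real.norm_eq_abs, hsign]
  have hprojb (t : ℝ) : proj i (t • b) = 0 := by
    ext j
    simp [proj, hb, Fin.succAbove_ne]
  have hstrict : HasStrictFDerivAt ρ D p :=
    (hρ.contDiffAt).hasStrictFDerivAt (by simp)
  obtain ⟨S, hS, happrox⟩ := hstrict.approximates_deriv_on_nhds (c := Real.toNNReal (d / 2))
    (Or.inr (Real.toNNReal_pos.2 (half_pos hd0)))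
  have hgc : ∀ᶠ x in 𝓝 p, ‖gradient ρ x‖ < ‖gradient ρ p‖ + 1 :=
    (continuous_gradient hρ).norm.continuousAt.eventually (gt_mem_nhds (by linarith))
  obtain ⟨R, hR, hball⟩ := Metric.eventually_nhds_iff_ball.1 ((hloc.and hgc).and hS)
  set M : ℝ := max (‖gradient ρ p‖ + 1) (2 / d * (‖D‖ + d / 2) + 1) with hM
  have hM0 : 0 < M := lt_of_lt_of_le (by positivity) (le_max_left _ _)
  have happ (x y : E3) (hx : x ∈ Metric.ball p R) (hy : y ∈ Metric.ball p R) :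
      |ρ x - ρ y - D (x - y)| ≤ d / 2 * ‖x - y‖ := by
    have := happrox x (hball x hx).2 y (hball y hy).2
    rwa [Real.coe_toNNReal _ (half_pos hd0).le, Real.norm_eq_abs] at this
  refine ⟨i, e, ρ, R, d / 2, M, hρ, hR, by positivity, hM0, henorm, ?_,
    fun x hx => (hball x hx).1.1, ?_, ?_, ?_⟩
  · intro x s
    rw [proj_sub, he, smul_smul, hprojb, sub_zero]
  · intro x hx s hs hxs
    have h1 := (abs_le.1 (happ x _ hx hxs)).2
    rw [sub_sub_cancel, map_smul, hDe, norm_smul, henorm, Real.norm_of_nonneg hs, smul_eq_mul] at h1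
    linarith
  · intro x hx y hy hx0 hy0
    have h1 := happ x y hx hy
    rw [hx0, hy0, sub_zero, zero_sub, abs_neg] at h1
    rw [← proj_sub]
    generalize x - y = v at h1 ⊢
    -- The horizontal part of v. The bound on D v then controls the vertical coordinate v i, since D
    -- b has absolute value d and only d/2 is lost.
    set z := v - v i • b with hz
    have hzi : z i = 0 := by simp [hz, hb]
    have hzp : proj i z = proj i v := by rw [hz, proj_sub, hprojb, sub_zero]
    have hzn : ‖z‖ ≤ ‖proj i v‖ := by
      have := norm_le_proj i z
      rwa [hzi, hzp, abs_zero, zero_add] at this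
    have hDv : D v = D z + v i * D b := by
      have : v = z + v i • b := by rw [hz, sub_add_cancel]
      calc D v = D (z + v i • b) := congrArg D this
        _ = D z + v i * D b := by rw [map_add, map_smul, smul_eq_mul]
    have h2 : |v i| * d ≤ |D v| + |D z| := by
      rw [hd, ← abs_mul]
      have : v i * D b = D v - D z := by rw [hDv]; ring
      rw [this]
      exact abs_sub _ _
    have h3 : |D z| ≤ ‖D‖ * ‖proj i v‖ := (D.le_opNorm z).trans (by gcongr)
    have h4 := norm_le_proj i v
    have h5 : |v i| ≤ 2 / d * (‖D‖ + d / 2) * ‖proj i v‖ := by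
      rw [div_mul_eq_mul_div, div_mul_eq_mul_div, le_div_iff₀ hd0]
      nlinarith
    calc ‖v‖ ≤ (2 / d * (‖D‖ + d / 2) + 1) * ‖proj i v‖ := by linarith
      _ ≤ M * ‖proj i v‖ := by gcongr; exact le_max_right _ _
  · intro x hx
    exact (hball x hx).1.2.le.trans (le_max_left _ _)

namespace IsPatch

variable {Ω : Set E3} {p : E3} {i : Fin 3} {e : E3} {ρ : E3 → ℝ} {R c M : ℝ}

theorem sub_smul_mem_ball (h : IsPatch Ω p i e ρ R c M) {x : E3} {r s t : ℝ}
    (hx : x ∈ Metric.closedBall p r) (hs : |s| ≤ t) (hr : r + t < R) :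
    x - s • e ∈ Metric.ball p R := by
  rw [Metric.mem_closedBall, dist_eq_norm] at hx
  rw [Metric.mem_ball, dist_eq_norm]
  have : ‖s • e‖ = |s| := by rw [norm_smul, h.norm_e, mul_one, Real.norm_eq_abs]
  calc ‖x - s • e - p‖ = ‖(x - p) - s • e‖ := by congr 1; abel
    _ ≤ ‖x - p‖ + ‖s • e‖ := norm_sub_le _ _
    _ < R := by linarith

theorem mem_of_sub_mem (h : IsPatch Ω p i e ρ R c M) {x : E3} {r s : ℝ} (hs : 0 ≤ s)
    (hr : r + s < R) (hx : x ∈ Metric.closedBall p r) (hxs : x - s • e ∈ Ω) : x ∈ Ω := by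
  have h1 : x - s • e ∈ Metric.ball p R := h.sub_smul_mem_ball hx (abs_of_nonneg hs).le hr
  have h0 : x ∈ Metric.ball p R := by
    have := h.sub_smul_mem_ball (s := 0) (t := s) hx (by simpa using hs) hr
    simpa using this
  rw [h.mem_iff x h0]
  have h2 := (h.mem_iff _ h1).1 hxs
  have h3 := h.mono x h0 s hs h1
  nlinarith [h.c_pos]

/-- The points x + s • e with small s > 0 lie in Ω, as ρ is strictly decreasing along e. -/
theorem frontier_of_zero (h : IsPatch Ω p i e ρ R c M) {x : E3} (hx : x ∈ Metric.ball p R)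
    (h0 : ρ x = 0) : x ∈ frontier Ω := by
  have hxΩ : x ∉ Ω := fun hh => by
    have := (h.mem_iff x hx).1 hh
    linarith
  refine ⟨?_, fun hint => hxΩ (interior_subset hint)⟩
  have hlim : Tendsto (fun s : ℝ => x + s • e) (𝓝[>] 0) (𝓝 x) := by
    have hc : Continuous fun s : ℝ => x + s • e := by fun_prop
    have := hc.tendsto 0
    rw [zero_smul, add_zero] at this
    exact this.mono_left nhdsWithin_le_nhds
  refine mem_closure_of_tendsto hlim ?_
  filter_upwards [self_mem_nhdsWithin, hlim (Metric.isOpen_ball.mem_nhds hx)] with s hs hsb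
  rw [mem_Ioi] at hs
  have hsb' : x + s • e ∈ Metric.ball p R := hsb
  have h3 := h.mono (x + s • e) hsb' s hs.le (by simpa using hx)
  rw [add_sub_cancel_right, h0] at h3
  rw [h.mem_iff _ hsb']
  nlinarith [h.c_pos]

theorem zero_of_frontier (h : IsPatch Ω p i e ρ R c M) (hΩ : IsOpen Ω) {x : E3}
    (hx : x ∈ Metric.ball p R) (hf : x ∈ frontier Ω) : ρ x = 0 := by
  have hxΩ : x ∉ Ω := fun hh => hf.2 (hΩ.interior_eq.symm ▸ hh)
  have h1 : 0 ≤ ρ x := not_lt.1 fun hh => hxΩ ((h.mem_iff x hx).2 hh)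
  refine le_antisymm (not_lt.1 fun hpos => ?_) h1
  have hev : ∀ᶠ y in 𝓝 x, y ∉ Ω := by
    filter_upwards [h.smooth.continuous.continuousAt.eventually (lt_mem_nhds hpos),
      Metric.isOpen_ball.mem_nhds hx] with y hy hyb hyΩ
    have := (h.mem_iff y hyb).1 hyΩ
    linarith
  exact (mem_closure_iff_frequently.1 hf.1) hev

/-- The boundary inside a closed ball. -/
def bdry (_ : IsPatch Ω p i e ρ R c M) (r : ℝ) : Set E3 := {x | ρ x = 0} ∩ Metric.closedBall p r

theorem isCompact_bdry (h : IsPatch Ω p i e ρ R c M) (r : ℝ) : IsCompact (h.bdry r) :=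
  (isCompact_closedBall p r).inter_left (isClosed_eq h.smooth.continuous continuous_const)

theorem bdry_subset (h : IsPatch Ω p i e ρ R c M) {r : ℝ} (hr : r < R) :
    h.bdry r ⊆ frontier Ω :=
  fun _ hx => h.frontier_of_zero (Metric.closedBall_subset_ball hr hx.2) hx.1

theorem anti_bdry (h : IsPatch Ω p i e ρ R c M) {r : ℝ} (hr : r < R) {x y : E3}
    (hx : x ∈ h.bdry r) (hy : y ∈ h.bdry r) : ‖x - y‖ ≤ M * ‖proj i x - proj i y‖ :=
  h.anti x (Metric.closedBall_subset_ball hr hx.2) y (Metric.closedBall_subset_ball hr hy.2) hx.1 hy.1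

theorem injOn_proj (h : IsPatch Ω p i e ρ R c M) {r : ℝ} (hr : r < R) :
    InjOn (proj i) (h.bdry r) := fun x hx y hy hxy => by
  have := h.anti_bdry hr hx hy
  rw [hxy, sub_self, norm_zero, mul_zero] at this
  exact sub_eq_zero.1 (norm_le_zero_iff.1 this)

/-- The inverse of the projection of the boundary. -/
def graph (h : IsPatch Ω p i e ρ R c M) (r : ℝ) : E2 → E3 := Function.invFunOn (proj i) (h.bdry r)

theorem graph_proj (h : IsPatch Ω p i e ρ R c M) {r : ℝ} (hr : r < R) {x : E3}
    (hx : x ∈ h.bdry r) : h.graph r (proj i x) = x :=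
  (h.injOn_proj hr).leftInvOn_invFunOn hx

theorem lipschitzOn_graph (h : IsPatch Ω p i e ρ R c M) {r : ℝ} (hr : r < R) :
    LipschitzOnWith (Real.toNNReal M) (h.graph r) (proj i '' h.bdry r) := by
  refine LipschitzOnWith.of_dist_le_mul ?_
  rintro _ ⟨x, hx, rfl⟩ _ ⟨y, hy, rfl⟩
  rw [h.graph_proj hr hx, h.graph_proj hr hy, dist_eq_norm, dist_eq_norm,
    Real.coe_toNNReal _ h.M_pos.le]
  exact h.anti_bdry hr hx hy

theorem isCompact_image (h : IsPatch Ω p i e ρ R c M) (r : ℝ) : IsCompact (proj i '' h.bdry r) :=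
  (h.isCompact_bdry r).image (lipschitzWith_proj i).continuous

/-- A 1-Lipschitz map does not increase Hausdorff measure. Projected area is at most surface area,
and this one-sided comparison replaces the area formula. -/
theorem hausdorff_image_proj_le (i : Fin 3) (S : Set E3) :
    volume (proj i '' S) ≤ (Measure.euclideanHausdorffMeasure 2 : Measure E3) S := by
  rw [← EuclideanSpace.euclideanHausdorffMeasure_eq_volume 2,
    Measure.euclideanHausdorffMeasure_def, Measure.euclideanHausdorffMeasure_def]
  simp only [Measure.smul_apply]
  gcongr
  have := (lipschitzWith_proj i).hausdorffMeasure_image_le (d := 2) (by norm_num) S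
  simpa using this

/-- The boundary piece is a Lipschitz image of a compact subset of the plane. -/
theorem hausdorff_bdry_lt_top (h : IsPatch Ω p i e ρ R c M) {r : ℝ} (hr : r < R) :
    (Measure.euclideanHausdorffMeasure 2 : Measure E3) (h.bdry r) < ⊤ := by
  have h1 : h.bdry r = h.graph r '' (proj i '' h.bdry r) := by
    rw [image_image]
    refine Subset.antisymm (fun x hx => ⟨x, hx, h.graph_proj hr hx⟩) ?_
    rintro _ ⟨x, hx, rfl⟩
    simp only
    rwa [h.graph_proj hr hx]
  have h2 := (h.lipschitzOn_graph hr).hausdorffMeasure_image_le (d := 2) (by norm_num)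
  rw [← h1] at h2
  have h3 : (Measure.euclideanHausdorffMeasure 2 : Measure E2) (proj i '' h.bdry r) < ⊤ := by
    rw [EuclideanSpace.euclideanHausdorffMeasure_eq_volume 2]
    exact (h.isCompact_image r).measure_lt_top
  rw [Measure.euclideanHausdorffMeasure_def, Measure.smul_apply] at h3 ⊢
  -- The normalizing factor depends only on the dimension 2 of the measure, so it is the same in the
  -- plane and in space.
  set s := Measure.addHaarScalarFactor (volume : Measure (EuclideanSpace ℝ (Fin 2)))
    (Measure.hausdorffMeasure ((2 : ℕ) : ℝ))
  rw [ENNReal.smul_def, smul_eq_mul] at h3 ⊢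
  calc _ ≤ (s : ENNReal) * (((Real.toNNReal M : NNReal) : ENNReal) ^ (2 : ℝ) *
        Measure.hausdorffMeasure 2 (proj i '' h.bdry r)) := by
        gcongr
        exact_mod_cast h2
    _ = ((Real.toNNReal M : NNReal) : ENNReal) ^ (2 : ℝ) *
        (s * Measure.hausdorffMeasure ((2 : ℕ) : ℝ) (proj i '' h.bdry r)) := by
        rw [Nat.cast_ofNat]; ring
    _ < ⊤ := ENNReal.mul_lt_top (by simp) h3

/-- Integrals over the projection of the boundary are controlled by surface integrals. -/
theorem lintegral_graph_le (h : IsPatch Ω p i e ρ R c M) {r : ℝ} (hr : r < R) {F : E3 → ENNReal}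
    (hF : Continuous F) :
    ∫⁻ y in proj i '' h.bdry r, F (h.graph r y) ≤ ∫⁻ x, F x ∂(surfaceMeasure Ω) := by
  set K := proj i '' h.bdry r with hK
  have hKm : MeasurableSet K := (h.isCompact_image r).measurableSet
  have hΓm : MeasurableSet (h.bdry r) := (h.isCompact_bdry r).measurableSet
  set μΓ := (Measure.euclideanHausdorffMeasure 2 : Measure E3).restrict (h.bdry r)
  have hle : (volume : Measure E2).restrict K ≤ Measure.map (proj i) μΓ := by
    refine Measure.le_iff.2 fun A hA => ?_
    rw [Measure.map_apply (lipschitzWith_proj i).continuous.measurable hA, Measure.restrict_apply hA,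
      Measure.restrict_apply ((lipschitzWith_proj i).continuous.measurable hA)]
    refine le_trans (le_of_eq ?_) (hausdorff_image_proj_le i _)
    congr 1
    rw [hK, image_preimage_inter]
  have hgm : Measurable (K.indicator fun y => F (h.graph r y)) := by
    have hc : ContinuousOn (fun y => F (h.graph r y)) K :=
      hF.comp_continuousOn (h.lipschitzOn_graph hr).continuousOn
    classical
    rw [← piecewise_eq_indicator]
    exact hc.measurable_piecewise continuousOn_const hKm
  calc ∫⁻ y in K, F (h.graph r y)
      = ∫⁻ y in K, K.indicator (fun y => F (h.graph r y)) y :=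
        setLIntegral_congr_fun hKm fun y hy => by simp [hy]
    _ ≤ ∫⁻ y, K.indicator (fun y => F (h.graph r y)) y ∂(Measure.map (proj i) μΓ) :=
        lintegral_mono' hle le_rfl
    _ = ∫⁻ x, K.indicator (fun y => F (h.graph r y)) (proj i x) ∂μΓ :=
        lintegral_map hgm (lipschitzWith_proj i).continuous.measurable
    _ = ∫⁻ x, F x ∂μΓ := setLIntegral_congr_fun hΓm fun x hx => by
        have : proj i x ∈ K := ⟨x, hx, rfl⟩
        simp [this, h.graph_proj hr hx]
    _ ≤ ∫⁻ x, F x ∂(surfaceMeasure Ω) :=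
        lintegral_mono' (Measure.restrict_mono (h.bdry_subset hr) le_rfl) le_rfl

theorem norm_e_coord (h : IsPatch Ω p i e ρ R c M) : |e i| = 1 := by
  have h1 := norm_sq_eq_proj i e
  have h2 : proj i e = 0 := by
    have := h.proj_e e 1
    rw [one_smul, sub_self] at this
    rw [← this]
    ext j; simp [proj]
  rw [h2, h.norm_e, norm_zero] at h1
  have : |e i| ^ 2 = 1 := by rw [sq_abs]; linarith
  nlinarith [abs_nonneg (e i)]

/-- The integral over a thin set above the boundary is controlled by a surface integral. -/
theorem lintegral_layer_le (h : IsPatch Ω p i e ρ R c M) {r τ : ℝ} (hr : r < R)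
    {Λ : Set E3} (hΛ : MeasurableSet Λ) {q F : E3 → ENNReal} (hq : Measurable q) (hF : Continuous F)
    (hfoot : ∀ x ∈ Λ, ∃ s ∈ Icc 0 τ, x - s • e ∈ h.bdry r ∧ q x ≤ F (x - s • e)) :
    ∫⁻ x in Λ, q x ≤ ENNReal.ofReal (2 * τ) * ∫⁻ x, F x ∂(surfaceMeasure Ω) := by
  have hKm : MeasurableSet (proj i '' h.bdry r) := (h.isCompact_image r).measurableSet
  rw [← lintegral_indicator hΛ, lintegral_eq_lift i (hq.indicator hΛ)]
  have key (y : E2) : ∫⁻ s : ℝ, Λ.indicator q (lift i s y) ≤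
      (proj i '' h.bdry r).indicator (fun y => ENNReal.ofReal (2 * τ) * F (h.graph r y)) y := by
    -- All points of Λ above y share one foot, the graph point over y, and lie within height τ of
    -- it. Hence the fibre is contained in an interval of length 2τ.
    have hpt (s : ℝ) (hs : lift i s y ∈ Λ) : y ∈ proj i '' h.bdry r ∧
        s ∈ Icc (h.graph r y i - τ) (h.graph r y i + τ) ∧ q (lift i s y) ≤ F (h.graph r y) := by
      obtain ⟨s', hs', hb, hqF⟩ := hfoot _ hs
      have hpy : proj i (lift i s y - s' • e) = y := by rw [h.proj_e, proj_lift]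
      have hg : h.graph r y = lift i s y - s' • e := by
        rw [← h.graph_proj hr hb, hpy]
      refine ⟨⟨_, hb, hpy⟩, ?_, by rwa [hg]⟩
      have hgi : h.graph r y i = s - s' * e i := by rw [hg]; simp
      have := h.norm_e_coord
      have h2 : |s' * e i| ≤ τ := by rw [abs_mul, this, mul_one, abs_of_nonneg hs'.1]; exact hs'.2
      have := abs_le.1 h2
      rw [hgi]
      constructor <;> linarith
    by_cases hy : y ∈ proj i '' h.bdry r
    · rw [indicator_of_mem hy]
      calc ∫⁻ s : ℝ, Λ.indicator q (lift i s y)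
          ≤ ∫⁻ s : ℝ, (Icc (h.graph r y i - τ) (h.graph r y i + τ)).indicator
              (fun _ => F (h.graph r y)) s := by
            refine lintegral_mono fun s => ?_
            by_cases hs : lift i s y ∈ Λ
            · obtain ⟨-, h2, h3⟩ := hpt s hs
              rw [indicator_of_mem hs, indicator_of_mem h2]
              exact h3
            · rw [indicator_of_notMem hs]
              exact zero_le
        _ = _ := by
            rw [lintegral_indicator measurableSet_Icc, setLIntegral_const, Real.volume_Icc, mul_comm]
            congr 2
            ring
    · have : ∀ s, Λ.indicator q (lift i s y) = 0 := fun s =>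
        indicator_of_notMem (fun hs => hy (hpt s hs).1) _
      simp [this]
  refine (lintegral_mono key).trans ?_
  rw [lintegral_indicator hKm, lintegral_const_mul' _ _ ENNReal.ofReal_ne_top]
  gcongr
  exact h.lintegral_graph_le hr hF

end IsPatch

/-- Local finiteness in each patch, and compactness of the boundary. -/
theorem surfaceMeasure_univ_lt_top {Ω : Set E3} (hΩ : IsSmoothBoundedDomain Ω) :
    surfaceMeasure Ω univ < ⊤ := by
  rw [surfaceMeasure, Measure.restrict_apply_univ]
  have hcomp : IsCompact (frontier Ω) :=
    Metric.isCompact_of_isClosed_isBounded isClosed_frontier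
      (hΩ.isBounded.closure.subset frontier_subset_closure)
  refine hcomp.measure_lt_top_of_nhdsWithin fun p hp => ?_
  obtain ⟨i, e, ρ, R, c, M, h⟩ := exists_isPatch hΩ hp
  refine ⟨frontier Ω ∩ Metric.ball p (R / 2), ?_, ?_⟩
  · exact inter_mem_nhdsWithin _ (Metric.ball_mem_nhds p (half_pos h.R_pos))
  · refine lt_of_le_of_lt (measure_mono ?_) (h.hausdorff_bdry_lt_top (half_lt_self h.R_pos))
    rintro x ⟨hx, hxb⟩
    exact ⟨h.zero_of_frontier hΩ.isOpen (Metric.ball_subset_ball (half_le_self h.R_pos.le) hxb) hx,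
      Metric.ball_subset_closedBall hxb⟩

theorem isFiniteMeasure_surfaceMeasure {Ω : Set E3} (hΩ : IsSmoothBoundedDomain Ω) :
    IsFiniteMeasure (surfaceMeasure Ω) := ⟨surfaceMeasure_univ_lt_top hΩ⟩

/-! ### Green's form -/

/-- A test function as an element of `H¹₀`. -/
def IsTestFn.toV {Ω : Set E3} {φ : E3 → ℝ} (h : IsTestFn Ω φ) : VSub Ω :=
  ⟨((h.memLp 2).toLp φ, (h.memLp_gradient 2).toLp (gradient φ)), h.mem_VSub⟩

theorem IsTestFn.coeFn_toV_fst {Ω : Set E3} {φ : E3 → ℝ} (h : IsTestFn Ω φ) :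
    h.toV.1.1 =ᵐ[volume] φ := (h.memLp 2).coeFn_toLp

theorem IsTestFn.coeFn_toV_snd {Ω : Set E3} {φ : E3 → ℝ} (h : IsTestFn Ω φ) :
    h.toV.1.2 =ᵐ[volume] gradient φ := (h.memLp_gradient 2).coeFn_toLp

theorem IsTestFn.mono {Ω Ω' : Set E3} {φ : E3 → ℝ} (h : IsTestFn Ω φ) (hs : Ω ⊆ Ω') :
    IsTestFn Ω' φ := ⟨h.1, h.2.1, h.2.2.trans hs⟩

theorem ae_of_notMem_of_mem {Ω : Set E3} {P Q : E3 → Prop} (h : ∀ᵐ x : E3, x ∉ Ω → P x)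
    (h' : ∀ᵐ x : E3, x ∈ Ω → Q x) : ∀ᵐ x : E3, P x ∨ Q x := by
  filter_upwards [h, h'] with x hx hx'
  by_cases hxΩ : x ∈ Ω
  · exact Or.inr (hx' hxΩ)
  · exact Or.inl (hx hxΩ)

theorem inner_congr_right {F : Type*} [NormedAddCommGroup F] [InnerProductSpace ℝ F] {Ω : Set E3}
    {f g g' : Lp F 2 (volume : Measure E3)} (hf : ∀ᵐ x : E3, x ∉ Ω → f x = 0)
    (hg : ∀ᵐ x : E3, x ∈ Ω → g x = g' x) : inner ℝ f g = inner ℝ f g' := by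
  rw [L2.inner_def, L2.inner_def]
  refine integral_congr_ae ?_
  filter_upwards [ae_of_notMem_of_mem hf hg] with x hx
  rcases hx with hx | hx
  · simp [hx]
  · rw [hx]

theorem quint_congr_right {Ω : Set E3} {f g g' : L6} (hf : ∀ᵐ x : E3, x ∉ Ω → f x = 0)
    (hg : ∀ᵐ x : E3, x ∈ Ω → g x = g' x) : quint f g = quint f g' := by
  rw [quint_eq, quint_eq]
  refine integral_congr_ae ?_
  filter_upwards [ae_of_notMem_of_mem hf hg] with x hx
  rcases hx with hx | hx
  · simp [hx]
  · rw [hx]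

theorem continuous_quint_of {Y : Type*} [TopologicalSpace Y] {f g : Y → L6} (hf : Continuous f)
    (hg : Continuous g) : Continuous fun y => quint (f y) (g y) :=
  Continuous.comp (g := fun p : L6 × L6 => quint p.1 p.2) (f := fun y => (f y, g y))
    continuous_quint (hf.prodMk hg)

theorem toL6_ae_zero {Ω : Set E3} (hΩ : MeasurableSet Ω) (x : VSub Ω) :
    ∀ᵐ y : E3, y ∉ Ω → toL6 Ω x y = 0 := by
  filter_upwards [coeFn_toL6 x, (VSub_ae_zero hΩ x.2).1] with y h1 h2 hy
  rw [h1, h2 hy]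

/-- The time averaged Green form of a solution, against functions which need not vanish on the
boundary. -/
def greenForm {Ω : Set E3} (U : ℝ → VSub Ω) (V : ℝ → H) (ε t : ℝ) (ψ : VSub univ) : ℝ :=
  inner ℝ (ε⁻¹ • (V (t + ε) - V t)) ψ.1.1 + inner ℝ (avg ε U t).1.2 ψ.1.2 +
    ∫ r in (0 : ℝ)..1, quint (toL6 Ω (U (t + ε * r))) (toL6 univ ψ)

namespace IsSol

variable {Ω : Set E3} {T : ℝ} {U : ℝ → VSub Ω} {V : ℝ → H}

theorem diffQuot_ae_zero (h : IsSol Ω T U V) (ε t : ℝ) :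
    ∀ᵐ x : E3, x ∉ Ω → (ε⁻¹ • (V (t + ε) - V t) : H) x = 0 := by
  filter_upwards [h.zero t, h.zero (t + ε), Lp.coeFn_smul ε⁻¹ (V (t + ε) - V t),
    Lp.coeFn_sub (V (t + ε)) (V t)] with x h1 h2 h3 h4 hx
  rw [h3, Pi.smul_apply, h4, Pi.sub_apply, h1 hx, h2 hx, sub_zero, smul_zero]

/-- The solution, its gradient and its velocity vanish off Ω, so the form sees only the restriction
of the test function to Ω. -/
theorem greenForm_congr (h : IsSol Ω T U V) (hΩ : MeasurableSet Ω) (ε t : ℝ) {ψ ψ' : VSub univ}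
    (h1 : ∀ᵐ x : E3, x ∈ Ω → ψ.1.1 x = ψ'.1.1 x) (h2 : ∀ᵐ x : E3, x ∈ Ω → ψ.1.2 x = ψ'.1.2 x) :
    greenForm U V ε t ψ = greenForm U V ε t ψ' := by
  have h3 : ∀ᵐ x : E3, x ∈ Ω → toL6 univ ψ x = toL6 univ ψ' x := by
    filter_upwards [coeFn_toL6 ψ, coeFn_toL6 ψ', h1] with x h3 h4 h5 hx
    rw [h3, h4, h5 hx]
  unfold greenForm
  rw [inner_congr_right (h.diffQuot_ae_zero ε t) h1,
    inner_congr_right (VSub_ae_zero hΩ (avg ε U t).2).2 h2]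
  congr 2
  ext1 r
  exact quint_congr_right (toL6_ae_zero hΩ _) h3

theorem greenForm_add (h : IsSol Ω T U V) (ε t : ℝ) (ψ ψ' : VSub univ) :
    greenForm U V ε t (ψ + ψ') = greenForm U V ε t ψ + greenForm U V ε t ψ' := by
  have hc (x : VSub univ) : Continuous fun r => quint (toL6 Ω (U (t + ε * r))) (toL6 univ x) :=
    continuous_quint_of ((toL6 Ω).continuous.comp
      (h.contU.comp (by fun_prop : Continuous fun r : ℝ => t + ε * r))) continuous_const
  unfold greenForm
  simp only [map_add, quint_add, Submodule.coe_add, Prod.fst_add, Prod.snd_add, inner_add_right]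
  rw [intervalIntegral.integral_add ((hc ψ).intervalIntegrable _ _)
    ((hc ψ').intervalIntegrable _ _)]
  ring

theorem greenForm_eq_zero (h : IsSol Ω T U V) {ε t : ℝ} (hε : 0 < ε) (ht : 0 ≤ t) (htT : t + ε ≤ T)
    {φ : E3 → ℝ} (hφ : IsTestFn Ω φ) :
    greenForm U V ε t (hφ.mono (subset_univ _)).toV = 0 := by
  have h1 := h.steklov_eq hε ht htT hφ.toV
  have h2 : toL6 univ (hφ.mono (subset_univ _)).toV = toL6 Ω hφ.toV := by
    refine Lp.ext ?_
    exact (coeFn_toL6 _).trans (coeFn_toL6 hφ.toV).symm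
  unfold greenForm
  rw [h2]
  exact h1

/-- Green's form vanishes on functions that vanish near the boundary. -/
theorem greenForm_eq_zero_of_frontier (h : IsSol Ω T U V) (hΩ : IsOpen Ω) {ε t : ℝ} (hε : 0 < ε)
    (ht : 0 ≤ t) (htT : t + ε ≤ T) {φ : E3 → ℝ} (hφ : IsTestFn univ φ)
    (h0 : ∀ x ∈ frontier Ω, φ =ᶠ[𝓝 x] 0) : greenForm U V ε t hφ.toV = 0 := by
  have hin {x : E3} (hx : x ∈ Ω) : Ω.indicator φ =ᶠ[𝓝 x] φ := by
    filter_upwards [hΩ.mem_nhds hx] with y hy using indicator_of_mem hy _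
  have hout {x : E3} (hx : x ∉ Ω) : Ω.indicator φ =ᶠ[𝓝 x] 0 := by
    by_cases hxc : x ∈ closure Ω
    · filter_upwards [h0 x ⟨hxc, fun hi => hx (interior_subset hi)⟩] with y hy
      by_cases hyΩ : y ∈ Ω
      · rw [indicator_of_mem hyΩ, hy]
      · exact indicator_of_notMem hyΩ _
    · filter_upwards [isClosed_closure.isOpen_compl.mem_nhds hxc] with y hy
      exact indicator_of_notMem (fun hh => hy (subset_closure hh)) _
  -- The sharp truncation is smooth because φ vanishes near every boundary point.
  have htest : IsTestFn Ω (Ω.indicator φ) := by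
    refine ⟨contDiff_iff_contDiffAt.2 fun x => ?_, hφ.2.1.mono (support_indicator.subset.trans inter_subset_right), ?_⟩
    · by_cases hx : x ∈ Ω
      · exact hφ.1.contDiffAt.congr_of_eventuallyEq (hin hx)
      · exact contDiffAt_const.congr_of_eventuallyEq (hout hx)
    · intro x hx
      by_contra hxΩ
      exact (notMem_tsupport_iff_eventuallyEq.2 (hout hxΩ)) hx
  rw [← h.greenForm_eq_zero hε ht htT htest]
  refine h.greenForm_congr hΩ.measurableSet ε t ?_ ?_
  · filter_upwards [hφ.coeFn_toV_fst, (htest.mono (subset_univ _)).coeFn_toV_fst] with x h1 h2 hx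
    rw [h1, h2, indicator_of_mem hx]
  · filter_upwards [hφ.coeFn_toV_snd, (htest.mono (subset_univ _)).coeFn_toV_snd] with x h1 h2 hx
    rw [h1, h2, gradient_def, gradient_def, (hin hx).fderiv_eq]

/-- A bound of Green's form for a function supported, inside `Ω`, in a set of finite measure. -/
theorem abs_greenForm_le (h : IsSol Ω T U V) (hΩ : MeasurableSet Ω) (ε t : ℝ) {φ : E3 → ℝ}
    (hφ : IsTestFn univ φ) {Λ : Set E3} (hΛ : MeasurableSet Λ) (hΛv : volume Λ ≠ ⊤)
    (h0 : ∀ x ∈ Ω, x ∉ Λ → x ∉ tsupport φ) {S B : ℝ} (hS : 0 ≤ S) (hφS : ∀ x ∈ Λ, |φ x| ≤ S)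
    (hB : ∀ r ∈ Icc (0 : ℝ) 1, ‖toL6 Ω (U (t + ε * r))‖ ^ 5 ≤ B)
    {q : ℝ} (hq : |∫ x in Λ, inner ℝ ((avg ε U t).1.2 x) (gradient φ x)| ≤ q) :
    |greenForm U V ε t hφ.toV| ≤ ‖(ε⁻¹ • (V (t + ε) - V t) : H)‖ * (S * volume.real Λ ^ (1 / 2 : ℝ))
      + q + B * (S * volume.real Λ ^ (1 / 6 : ℝ)) := by
  -- Inside Ω the function φ agrees with its truncation to Λ, whose L² and L⁶ norms carry the small
  -- factors |Λ|^{1/2} and |Λ|^{1/6}.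
  have hm (p : ENNReal) : MemLp (Λ.indicator φ) p volume := (hφ.memLp p).indicator hΛ
  have hb (p : ENNReal) [Fact (1 ≤ p)] : ‖(hm p).toLp _‖ ≤ S * volume.real Λ ^ (1 / p.toReal) :=
    norm_toLp_le (hm p) hΛ hΛv hS (fun x hx => by rw [indicator_of_mem hx]; exact hφS x hx)
      (fun x hx => indicator_of_notMem hx _)
  have hz {x : E3} (hx : x ∈ Ω) : φ x = Λ.indicator φ x := by
    by_cases hxΛ : x ∈ Λ
    · rw [indicator_of_mem hxΛ]
    · rw [indicator_of_notMem hxΛ, image_eq_zero_of_notMem_tsupport (h0 x hx hxΛ)]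
  have e1 : inner ℝ (ε⁻¹ • (V (t + ε) - V t)) hφ.toV.1.1 =
      inner ℝ (ε⁻¹ • (V (t + ε) - V t)) ((hm 2).toLp _) := by
    refine inner_congr_right (h.diffQuot_ae_zero ε t) ?_
    filter_upwards [hφ.coeFn_toV_fst, (hm 2).coeFn_toLp] with x h1 h2 hx
    rw [h1, h2, hz hx]
  have e2 : inner ℝ (avg ε U t).1.2 hφ.toV.1.2 =
      ∫ x in Λ, inner ℝ ((avg ε U t).1.2 x) (gradient φ x) := by
    rw [L2.inner_def, ← integral_indicator hΛ]
    refine integral_congr_ae ?_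
    filter_upwards [hφ.coeFn_toV_snd, (VSub_ae_zero hΩ (avg ε U t).2).2] with x h1 h2
    rw [h1]
    by_cases hxΛ : x ∈ Λ
    · rw [indicator_of_mem hxΛ]
    · rw [indicator_of_notMem hxΛ]
      by_cases hx : x ∈ Ω
      · rw [eq_zero_of_notMem_tsupport_gradient (h0 x hx hxΛ), inner_zero_right]
      · rw [h2 hx, inner_zero_left]
  have e3 (r : ℝ) : quint (toL6 Ω (U (t + ε * r))) (toL6 univ hφ.toV) =
      quint (toL6 Ω (U (t + ε * r))) ((hm 6).toLp _) := by
    refine quint_congr_right (toL6_ae_zero hΩ _) ?_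
    filter_upwards [coeFn_toL6 hφ.toV, hφ.coeFn_toV_fst, (hm 6).coeFn_toLp] with x h1 h2 h3 hx
    rw [h1, h2, h3, hz hx]
  unfold greenForm
  simp only [e1, e2, e3]
  refine (abs_add_le _ _).trans (add_le_add ((abs_add_le _ _).trans (add_le_add ?_ hq)) ?_)
  · refine (abs_real_inner_le_norm _ _).trans ?_
    gcongr
    simpa using hb 2
  · have hb6 := hb 6
    have h6 : (6 : ENNReal).toReal = 6 := by norm_num
    rw [h6] at hb6
    have := intervalIntegral.norm_integral_le_of_norm_le_const (a := 0) (b := 1)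
      (f := fun r => quint (toL6 Ω (U (t + ε * r))) ((hm 6).toLp _))
      (C := B * (S * volume.real Λ ^ (1 / 6 : ℝ))) fun r hr => by
        rw [uIoc_of_le zero_le_one] at hr
        refine (abs_quint_le _ _).trans ?_
        exact mul_le_mul (hB r ⟨hr.1.le, hr.2⟩) hb6 (norm_nonneg _)
          ((by positivity : (0 : ℝ) ≤ _).trans (hB r ⟨hr.1.le, hr.2⟩))
    simpa using this

end IsSol

/-! ### Slices of test functions -/

theorem IsTest.slice {φ : ℝ × E3 → ℝ} (h : IsTest univ φ) (t : ℝ) :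
    IsTestFn univ fun x => φ (t, x) :=
  ⟨h.1.comp (by fun_prop), slice_hasCompactSupport h.2.1 t, subset_univ _⟩

/-- The spatial gradient. -/
def gradX (φ : ℝ × E3 → ℝ) (z : ℝ × E3) : E3 := gradient (fun x => φ (z.1, x)) z.2

theorem gradX_eq {φ : ℝ × E3 → ℝ} (h : Differentiable ℝ φ) (z : ℝ × E3) :
    gradX φ z = (InnerProductSpace.toDual ℝ E3).symm
      ((fderiv ℝ φ z).comp (ContinuousLinearMap.inr ℝ ℝ E3)) := by
  rw [gradX, gradient_def]
  congr 1
  exact ((h z).hasFDerivAt.comp z.2 (hasFDerivAt_prodMk_right z.1 z.2)).fderiv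

theorem IsTest.continuous_gradX {S : Set (ℝ × E3)} {φ : ℝ × E3 → ℝ} (h : IsTest S φ) :
    Continuous (gradX φ) := by
  have h1 : gradX φ = fun z => (InnerProductSpace.toDual ℝ E3).symm
      ((fderiv ℝ φ z).comp (ContinuousLinearMap.inr ℝ ℝ E3)) :=
    funext (gradX_eq (h.1.differentiable (by simp)))
  rw [h1]
  have h2 : Continuous (fderiv ℝ φ) := h.1.continuous_fderiv (by simp)
  fun_prop

theorem IsTest.hasCompactSupport_gradX {S : Set (ℝ × E3)} {φ : ℝ × E3 → ℝ} (h : IsTest S φ) :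
    HasCompactSupport (gradX φ) := by
  refine (h.2.1.fderiv ℝ).mono fun z hz => ?_
  contrapose! hz
  rw [Function.notMem_support] at hz ⊢
  rw [gradX_eq (h.1.differentiable (by simp)), hz, ContinuousLinearMap.zero_comp, map_zero]

/-- The path of slices of a test function. -/
def IsTest.sliceV {φ : ℝ × E3 → ℝ} (h : IsTest univ φ) (t : ℝ) : VSub univ := (h.slice t).toV

theorem IsTest.continuous_sliceV {φ : ℝ × E3 → ℝ} (h : IsTest univ φ) : Continuous h.sliceV := by
  refine Continuous.subtype_mk (Continuous.prodMk ?_ ?_) _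
  · exact continuous_slice (p := 2) h.1.continuous h.2.1
  · exact continuous_slice (p := 2) h.continuous_gradX h.hasCompactSupport_gradX

theorem IsSol.continuous_greenForm {Ω : Set E3} {T : ℝ} {U : ℝ → VSub Ω} {V : ℝ → H}
    (h : IsSol Ω T U V) (ε : ℝ) {Ψ : ℝ → VSub univ} (hΨ : Continuous Ψ) :
    Continuous fun t => greenForm U V ε t (Ψ t) := by
  have h1 := h.contU
  have h2 := h.contV
  have h3 : Continuous fun t => (Ψ t).1.1 := (fstV univ).continuous.comp hΨ
  have h4 : Continuous fun t => (Ψ t).1.2 := (sndV univ).continuous.comp hΨ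
  have h5 : Continuous fun t => (avg ε U t).1.2 :=
    (sndV Ω).continuous.comp (continuous_avg_right h1 ε)
  refine Continuous.add (Continuous.add ?_ (h5.inner h4)) ?_
  · exact Continuous.inner (by fun_prop) h3
  · refine intervalIntegral.continuous_parametric_intervalIntegral_of_continuous' ?_ 0 1
    exact continuous_quint_of ((toL6 Ω).continuous.comp
      (h1.comp (by fun_prop : Continuous fun p : ℝ × ℝ => p.1 + ε * p.2)))
      ((toL6 univ).continuous.comp (hΨ.comp continuous_fst))

/-! ### The estimate in a boundary patch -/

theorem exists_isCutoff (p : E3) {r : ℝ} (hr : 0 < r) : ∃ χ L, IsCutoff χ L ∧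
    (∀ x ∈ Metric.closedBall p r, χ x = 1) ∧ tsupport χ ⊆ Metric.closedBall p (2 * r) := by
  let f : ContDiffBump p := ⟨r, 2 * r, hr, by linarith⟩
  have hd : ContDiff ℝ ∞ f := f.contDiff
  have hcs : HasCompactSupport f := f.hasCompactSupport
  obtain ⟨L, hL⟩ := (hasCompactSupport_gradient hcs).exists_bound_of_continuous
    (continuous_gradient hd)
  have hlip : LipschitzWith (Real.toNNReal L) f := by
    refine lipschitzWith_of_nnnorm_fderiv_le (𝕜 := ℝ) (hd.differentiable (by simp)) fun x => ?_
    rw [← NNReal.coe_le_coe, coe_nnnorm, ← norm_gradient]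
    exact (hL x).trans (Real.le_coe_toNNReal L)
  refine ⟨f, L, ⟨hd, hcs, fun x => f.nonneg, fun x => f.le_one, fun x y => ?_, hL⟩,
    fun x hx => f.one_of_mem_closedBall hx, f.tsupport_eq.subset⟩
  have := hlip.dist_le_mul x y
  rwa [Real.coe_toNNReal _ ((norm_nonneg _).trans (hL 0)), Real.dist_eq, dist_eq_norm] at this

theorem IsTestFn.abs_sub_le {Ω : Set E3} {φ : E3 → ℝ} (h : IsTestFn Ω φ) {S : ℝ}
    (hS : ∀ x, ‖gradient φ x‖ ≤ S) (x y : E3) : |φ x - φ y| ≤ S * ‖x - y‖ := by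
  have hlip : LipschitzWith (Real.toNNReal S) φ := by
    refine lipschitzWith_of_nnnorm_fderiv_le (𝕜 := ℝ) h.differentiable fun x => ?_
    rw [← NNReal.coe_le_coe, coe_nnnorm, ← norm_gradient]
    exact (hS x).trans (Real.le_coe_toNNReal S)
  have := hlip.dist_le_mul x y
  rwa [Real.coe_toNNReal _ ((norm_nonneg _).trans (hS 0)), Real.dist_eq, dist_eq_norm] at this

namespace IsPatch

variable {Ω : Set E3} {p : E3} {i : Fin 3} {e : E3} {ρ : E3 → ℝ} {R c M : ℝ}

/-- Cutoff functions of thin layers along the boundary. -/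
theorem exists_layerFn (h : IsPatch Ω p i e ρ R c M) : ∃ C > 0, ∀ τ > 0, ∃ θ : E3 → ℝ,
    ContDiff ℝ ∞ θ ∧ (∀ x, |θ x| ≤ 1) ∧ (∀ x, ρ x = 0 → θ =ᶠ[𝓝 x] 1) ∧
    (∀ x, ρ x ≤ -(c * τ) → θ =ᶠ[𝓝 x] 0) ∧ ∀ x ∈ Metric.ball p R, ‖gradient θ x‖ ≤ C / τ := by
  -- The profile is evaluated at ρ/(cτ). Any radii 0 < r < r' < 1 would do: the value is 1 near ρ =
  -- 0 and 0 near ρ ≤ −cτ, and the gradient is O(1/τ).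
  let f : ContDiffBump (0 : ℝ) := ⟨1 / 4, 3 / 4, by norm_num, by norm_num⟩
  have hf : ContDiff ℝ ∞ f := f.contDiff
  obtain ⟨K, hK⟩ := (f.hasCompactSupport.fderiv ℝ).exists_bound_of_continuous
    (hf.continuous_fderiv (by simp))
  have hK0 : 0 ≤ K := (norm_nonneg _).trans (hK 0)
  refine ⟨(K + 1) * M / c, div_pos (mul_pos (by linarith) h.M_pos) h.c_pos, fun τ hτ => ?_⟩
  have hcτ : 0 < c * τ := mul_pos h.c_pos hτ
  have hρc := h.smooth.continuous
  have hg : ContDiff ℝ ∞ fun x => (c * τ)⁻¹ * ρ x := contDiff_const.mul h.smooth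
  refine ⟨fun x => f ((c * τ)⁻¹ * ρ x), hf.comp hg, fun x => ?_, fun x hx => ?_, fun x hx => ?_,
    fun x hx => ?_⟩
  · rw [abs_of_nonneg f.nonneg]; exact f.le_one
  · have hlim : Tendsto (fun y => (c * τ)⁻¹ * ρ y) (𝓝 x) (𝓝 0) := by
      have := (hg.continuous).tendsto x
      rwa [hx, mul_zero] at this
    exact hlim.eventually f.eventuallyEq_one
  · have hx1 : (c * τ)⁻¹ * ρ x < -(3 / 4) := by
      have : (c * τ)⁻¹ * ρ x ≤ (c * τ)⁻¹ * -(c * τ) := by gcongr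
      rw [mul_neg, inv_mul_cancel₀ hcτ.ne'] at this
      linarith
    filter_upwards [hg.continuous.continuousAt.eventually (gt_mem_nhds hx1)] with y hy
    refine f.zero_of_le_dist ?_
    rw [Real.dist_eq, sub_zero]
    have : f.rOut = 3 / 4 := rfl
    rw [this]
    exact le_abs.2 (Or.inr (by linarith))
  · rw [norm_gradient]
    have hd1 : HasFDerivAt f (fderiv ℝ f ((c * τ)⁻¹ * ρ x)) ((c * τ)⁻¹ * ρ x) :=
      (hf.differentiable (by simp) _).hasFDerivAt
    have hd2 : HasFDerivAt (fun y => (c * τ)⁻¹ * ρ y) ((c * τ)⁻¹ • fderiv ℝ ρ x) x :=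
      (h.smooth.differentiable (by simp) x).hasFDerivAt.const_mul _
    have hd3 : fderiv ℝ (fun y => f ((c * τ)⁻¹ * ρ y)) x =
        (fderiv ℝ f ((c * τ)⁻¹ * ρ x)).comp ((c * τ)⁻¹ • fderiv ℝ ρ x) :=
      (HasFDerivAt.comp (g := f) x hd1 hd2).fderiv
    rw [hd3]
    refine (ContinuousLinearMap.opNorm_comp_le _ _).trans ?_
    rw [norm_smul, ← norm_gradient ρ, Real.norm_of_nonneg (inv_pos.2 hcτ).le]
    calc _ ≤ (K + 1) * ((c * τ)⁻¹ * M) := by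
          gcongr
          · exact (hK _).trans (by linarith)
          · exact h.grad_le x hx
      _ = (K + 1) * M / c / τ := by
          have := h.c_pos.ne'
          field_simp

/-- The points of the domain near the boundary, in the patch. -/
def layer (_ : IsPatch Ω p i e ρ R c M) (τ : ℝ) : Set E3 :=
  Ω ∩ (Metric.closedBall p (R / 4) ∩ {x | -(c * τ) < ρ x})

theorem measurableSet_layer (h : IsPatch Ω p i e ρ R c M) (hΩ : IsOpen Ω) (τ : ℝ) :
    MeasurableSet (h.layer τ) :=
  hΩ.measurableSet.inter (Metric.isClosed_closedBall.measurableSet.inter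
    (isOpen_lt continuous_const h.smooth.continuous).measurableSet)

theorem closedBall_subset (h : IsPatch Ω p i e ρ R c M) :
    Metric.closedBall p (R / 4) ⊆ Metric.ball p R :=
  Metric.closedBall_subset_ball (by linarith [h.R_pos])

/-- Moving outward by τ raises ρ by at least cτ, more than the depth of the layer. Hence the
translate by τ • e of a function supported in Ω vanishes on the layer. -/
theorem layer_pos (h : IsPatch Ω p i e ρ R c M) {τ : ℝ} (hτ : 0 ≤ τ) (hτR : τ < R / 4) {x : E3}
    (hx : x ∈ h.layer τ) : 0 < ρ (x - τ • e) := by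
  have h1 := h.sub_smul_mem_ball hx.2.1 (abs_of_nonneg hτ).le (by linarith : R / 4 + τ < R)
  have h2 := h.mono x (h.closedBall_subset hx.2.1) τ hτ h1
  have h3 : -(c * τ) < ρ x := hx.2.2
  linarith

theorem layer_sub_notMem (h : IsPatch Ω p i e ρ R c M) {τ : ℝ} (hτ : 0 ≤ τ) (hτR : τ < R / 4) {x : E3}
    (hx : x ∈ h.layer τ) : x - τ • e ∉ Ω := fun hh => by
  have h1 := h.sub_smul_mem_ball hx.2.1 (abs_of_nonneg hτ).le (by linarith : R / 4 + τ < R)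
  have h2 := (h.mem_iff _ h1).1 hh
  linarith [h.layer_pos hτ hτR hx]

/-- Intermediate value theorem for ρ along the outward segment, from a point of Ω to a point where ρ
> 0. -/
theorem layer_foot (h : IsPatch Ω p i e ρ R c M) {τ : ℝ} (hτ : 0 ≤ τ) (hτR : τ < R / 4) {x : E3}
    (hx : x ∈ h.layer τ) : ∃ s ∈ Icc 0 τ, x - s • e ∈ h.bdry (R / 2) := by
  have hc : ContinuousOn (fun s : ℝ => ρ (x - s • e)) (Icc 0 τ) :=
    (h.smooth.continuous.comp (by fun_prop)).continuousOn
  have h0 : ρ (x - (0 : ℝ) • e) ≤ 0 := by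
    rw [zero_smul, sub_zero]
    exact ((h.mem_iff x (h.closedBall_subset hx.2.1)).1 hx.1).le
  obtain ⟨s, hs, hs0⟩ := intermediate_value_Icc hτ hc ⟨h0, (h.layer_pos hτ hτR hx).le⟩
  refine ⟨s, hs, hs0, ?_⟩
  have hxp := hx.2.1
  rw [Metric.mem_closedBall, dist_eq_norm] at hxp ⊢
  calc ‖x - s • e - p‖ = ‖(x - p) - s • e‖ := by congr 1; abel
    _ ≤ ‖x - p‖ + ‖s • e‖ := norm_sub_le _ _
    _ ≤ R / 4 + R / 4 := by
      rw [norm_smul, h.norm_e, mul_one, Real.norm_of_nonneg hs.1]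
      linarith [hs.2]
    _ = R / 2 := by ring

theorem integral_layer_le (h : IsPatch Ω p i e ρ R c M) (hΩ : IsSmoothBoundedDomain Ω) {τ : ℝ}
    (hτ : 0 ≤ τ) (hτR : τ < R / 4) {q F : E3 → ℝ} (hq : Continuous q) (hF : Continuous F)
    (hq0 : ∀ x, 0 ≤ q x) (hF0 : ∀ x, 0 ≤ F x) {B : ℝ} (hFB : ∀ x, F x ≤ B)
    (hqF : ∀ x, ∀ s ∈ Icc 0 τ, q x ≤ F (x - s • e)) :
    ∫ x in h.layer τ, q x ≤ 2 * τ * ∫ x, F x ∂(surfaceMeasure Ω) := by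
  have := isFiniteMeasure_surfaceMeasure hΩ
  have hFi : Integrable F (surfaceMeasure Ω) :=
    Integrable.of_bound hF.aestronglyMeasurable B
      (Eventually.of_forall fun x => by rw [Real.norm_of_nonneg (hF0 x)]; exact hFB x)
  have h1 := h.lintegral_layer_le (r := R / 2) (τ := τ) (by linarith [h.R_pos])
    (h.measurableSet_layer hΩ.isOpen τ) (q := fun x => ENNReal.ofReal (q x))
    (F := fun x => ENNReal.ofReal (F x)) (hq.measurable.ennreal_ofReal)
    (ENNReal.continuous_ofReal.comp hF) fun x hx => by
      obtain ⟨s, hs, hb⟩ := h.layer_foot hτ hτR hx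
      exact ⟨s, hs, hb, ENNReal.ofReal_le_ofReal (hqF x s hs)⟩
  rw [← ofReal_integral_eq_lintegral_ofReal hFi (Eventually.of_forall hF0),
    ← ENNReal.ofReal_mul (by positivity)] at h1
  rw [integral_eq_lintegral_of_nonneg_ae (Eventually.of_forall hq0) hq.aestronglyMeasurable]
  exact ENNReal.toReal_le_of_le_ofReal
    (mul_nonneg (by positivity) (integral_nonneg hF0)) h1

theorem volume_layer_lt_top (h : IsPatch Ω p i e ρ R c M) (τ : ℝ) : volume (h.layer τ) < ⊤ :=
  (measure_mono fun _ hx => hx.2.1).trans_lt (isCompact_closedBall p (R / 4)).measure_lt_top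

theorem volume_layer_le (h : IsPatch Ω p i e ρ R c M) (hΩ : IsSmoothBoundedDomain Ω) {τ : ℝ}
    (hτ : 0 ≤ τ) (hτR : τ < R / 4) :
    volume.real (h.layer τ) ≤ 2 * τ * (surfaceMeasure Ω).real univ := by
  have := h.integral_layer_le hΩ hτ hτR (q := fun _ => 1) (F := fun _ => 1) continuous_const
    continuous_const (fun _ => zero_le_one) (fun _ => zero_le_one) (fun _ => le_rfl)
    (fun _ _ _ => le_rfl)
  simpa using this

/-- In the layer, the gradient is controlled by its increments. -/
theorem integral_layer_sq_le (h : IsPatch Ω p i e ρ R c M) (hΩ : IsOpen Ω) {χ : E3 → ℝ} {L : ℝ}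
    (hχ : IsCutoff χ L) (hχ1 : ∀ x ∈ Metric.closedBall p (R / 4), χ x = 1) {τ : ℝ} (hτ : 0 ≤ τ)
    (hτR : τ < R / 4) (w : VSub Ω) :
    ∫ x in h.layer τ, ‖w.1.2 x‖ ^ 2 ≤ hχ.incr (τ • e) w := by
  unfold IsCutoff.incr
  set d := w.1.2 - transOp (τ • e) w.1.2 with hd
  rw [L2.inner_def, ← integral_indicator (h.measurableSet_layer hΩ τ)]
  refine integral_mono_ae ?_ (L2.integrable_inner _ _) ?_
  · exact ((Lp.memLp w.1.2).integrable_norm_pow (by norm_num)).indicator (h.measurableSet_layer hΩ τ)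
  · filter_upwards [coeFn_mulOp hχ.memLp d, Lp.coeFn_sub w.1.2 (transOp (τ • e) w.1.2),
      coeFn_transOp (τ • e) w.1.2, ae_comp_sub (τ • e) (VSub_ae_zero hΩ.measurableSet w.2).2]
      with x h1 h2 h3 h4
    rw [h1, inner_smul_right, real_inner_self_eq_norm_sq]
    by_cases hx : x ∈ h.layer τ
    · rw [indicator_of_mem hx, hχ1 x hx.2.1, one_mul, hd, h2, Pi.sub_apply, h3,
        h4 (h.layer_sub_notMem hτ hτR hx), sub_zero]
    · rw [indicator_of_notMem hx]
      exact mul_nonneg (hχ.nonneg x) (by positivity)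

/-- The part of Green's form containing the gradient, in the layer. -/
theorem abs_integral_layer_le (h : IsPatch Ω p i e ρ R c M) (hΩ : IsSmoothBoundedDomain Ω)
    {χ : E3 → ℝ} {L : ℝ} (hχ : IsCutoff χ L) (hχ1 : ∀ x ∈ Metric.closedBall p (R / 4), χ x = 1)
    {τ : ℝ} (hτ : 0 < τ) (hτR : τ < R / 4) (w : VSub Ω) {φ : E3 → ℝ} (hφ : IsTestFn univ φ)
    {θ : E3 → ℝ} (hθ : ContDiff ℝ ∞ θ) (hθ1 : ∀ x, |θ x| ≤ 1) {C S μ : ℝ} (hμ : 0 < μ)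
    (hC : 0 ≤ C) (hθC : ∀ x ∈ Metric.ball p R, ‖gradient θ x‖ ≤ C / τ) (hφS : ∀ x, |φ x| ≤ S)
    (hgS : ∀ x, ‖gradient φ x‖ ≤ S) :
    |∫ x in h.layer τ, inner ℝ (w.1.2 x) (gradient (fun y => θ y * φ y) x)| ≤
      μ * (τ⁻¹ * hχ.incr (τ • e) w) / 2 + 2 / μ * (((S + C * S) * τ) ^ 2 *
        (surfaceMeasure Ω).real univ + C ^ 2 * ∫ x, φ x ^ 2 ∂(surfaceMeasure Ω)) := by
  have := isFiniteMeasure_surfaceMeasure hΩ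
  have hS : 0 ≤ S := (norm_nonneg _).trans (hgS 0)
  have hφc := hφ.1.continuous
  set q : E3 → ℝ := fun x => (S * τ + C * |φ x|) ^ 2 with hq
  have hqc : Continuous q := by fun_prop
  have hw : IntegrableOn (fun x => ‖w.1.2 x‖ ^ 2) (h.layer τ) :=
    ((Lp.memLp w.1.2).integrable_norm_pow (by norm_num)).integrableOn
  have hqi : IntegrableOn q (h.layer τ) :=
    (hqc.continuousOn.integrableOn_compact (isCompact_closedBall p (R / 4))).mono_set
      fun _ hx => hx.2.1
  have h1 : |∫ x in h.layer τ, inner ℝ (w.1.2 x) (gradient (fun y => θ y * φ y) x)| ≤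
      ∫ x in h.layer τ, (τ⁻¹ * (μ / 2) * ‖w.1.2 x‖ ^ 2 + τ⁻¹ * (1 / (2 * μ)) * q x) := by
    rw [← Real.norm_eq_abs]
    refine norm_integral_le_of_norm_le ((hw.const_mul _).add (hqi.const_mul _)) ?_
    refine ae_restrict_of_forall_mem (h.measurableSet_layer hΩ.isOpen τ) fun x hx => ?_
    rw [Real.norm_eq_abs]
    refine (abs_real_inner_le_norm (w.1.2 x) _).trans ?_
    rw [gradient_mul_fn (hθ.differentiable (by simp)) hφ.differentiable]
    have h2 : ‖θ x • gradient φ x + φ x • gradient θ x‖ ≤ S + |φ x| * (C / τ) := by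
      refine (norm_add_le _ _).trans (add_le_add ?_ ?_)
      · rw [norm_smul, Real.norm_eq_abs]
        calc |θ x| * ‖gradient φ x‖ ≤ 1 * S := by
              gcongr
              · exact hθ1 x
              · exact hgS x
          _ = S := one_mul S
      · rw [norm_smul, Real.norm_eq_abs]
        gcongr
        exact hθC x (h.closedBall_subset hx.2.1)
    have h3 : S + |φ x| * (C / τ) = τ⁻¹ * (S * τ + C * |φ x|) := by
      field_simp
    -- Young's inequality with weight μ; the weight is optimized only at the very end.
    have h4 : ‖w.1.2 x‖ * (S * τ + C * |φ x|) ≤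
        μ / 2 * ‖w.1.2 x‖ ^ 2 + 1 / (2 * μ) * q x := by
      have := sq_nonneg (μ * ‖w.1.2 x‖ - (S * τ + C * |φ x|))
      have e1 : μ / 2 * ‖w.1.2 x‖ ^ 2 + 1 / (2 * μ) * q x - ‖w.1.2 x‖ * (S * τ + C * |φ x|) =
          1 / (2 * μ) * (μ * ‖w.1.2 x‖ - (S * τ + C * |φ x|)) ^ 2 := by
        rw [hq]; field_simp; ring
      have e2 : 0 ≤ 1 / (2 * μ) * (μ * ‖w.1.2 x‖ - (S * τ + C * |φ x|)) ^ 2 := by positivity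
      linarith
    calc ‖w.1.2 x‖ * ‖θ x • gradient φ x + φ x • gradient θ x‖
        ≤ ‖w.1.2 x‖ * (τ⁻¹ * (S * τ + C * |φ x|)) := by rw [← h3]; gcongr
      _ = τ⁻¹ * (‖w.1.2 x‖ * (S * τ + C * |φ x|)) := by ring
      _ ≤ τ⁻¹ * (μ / 2 * ‖w.1.2 x‖ ^ 2 + 1 / (2 * μ) * q x) := by gcongr
      _ = _ := by ring
  have hφb (x : E3) : φ x ^ 2 ≤ S ^ 2 := by
    rw [← sq_abs]; gcongr; exact hφS x
  have hφi : Integrable (fun x => φ x ^ 2) (surfaceMeasure Ω) :=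
    Integrable.of_bound (hφc.pow 2).aestronglyMeasurable (S ^ 2)
      (Eventually.of_forall fun x => by rw [Real.norm_of_nonneg (sq_nonneg _)]; exact hφb x)
  -- Passing from x to its foot on the boundary changes |φ| by at most Sτ, which accounts for the
  -- extra CSτ. The factors 2 come from (α + β)² ≤ 2α² + 2β².
  have h5 := h.integral_layer_le hΩ hτ.le hτR (q := q)
    (F := fun x => 2 * ((S + C * S) * τ) ^ 2 + 2 * C ^ 2 * φ x ^ 2) hqc (by fun_prop)
    (fun x => by positivity) (fun x => by positivity)
    (B := 2 * ((S + C * S) * τ) ^ 2 + 2 * C ^ 2 * S ^ 2) (fun x => add_le_add_right (mul_le_mul_of_nonneg_left (hφb x) (by positivity)) _)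
    (fun x s hs => by
      have h6 := hφ.abs_sub_le hgS x (x - s • e)
      rw [sub_sub_cancel, norm_smul, h.norm_e, mul_one, Real.norm_of_nonneg hs.1] at h6
      have h7 : |φ x| ≤ |φ (x - s • e)| + S * τ := by
        have := abs_sub_abs_le_abs_sub (φ x) (φ (x - s • e))
        have : S * s ≤ S * τ := by gcongr; exact hs.2
        linarith
      have h8 : S * τ + C * |φ x| ≤ (S + C * S) * τ + C * |φ (x - s • e)| := by
        nlinarith [mul_le_mul_of_nonneg_left h7 hC]
      calc q x ≤ ((S + C * S) * τ + C * |φ (x - s • e)|) ^ 2 := by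
            rw [hq]; simp only; gcongr
        _ ≤ _ := by
            rw [← sq_abs (φ (x - s • e))]
            nlinarith [sq_nonneg ((S + C * S) * τ - C * |φ (x - s • e)|)])
  rw [integral_add (integrable_const _) (hφi.const_mul _),
    integral_const_mul (2 * C ^ 2) fun x => φ x ^ 2, integral_const, smul_eq_mul] at h5
  rw [integral_add (hw.const_mul _) (hqi.const_mul _), integral_const_mul, integral_const_mul] at h1
  have h9 := h.integral_layer_sq_le hΩ.isOpen hχ hχ1 hτ.le hτR w
  refine h1.trans ?_
  calc _ ≤ τ⁻¹ * (μ / 2) * hχ.incr (τ • e) w + τ⁻¹ * (1 / (2 * μ)) * (2 * τ *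
        ((surfaceMeasure Ω).real univ * (2 * ((S + C * S) * τ) ^ 2) +
          2 * C ^ 2 * ∫ x, φ x ^ 2 ∂(surfaceMeasure Ω))) := by gcongr
    _ = _ := by field_simp

end IsPatch

theorem IsTestFn.mul_left {Ω : Set E3} {φ θ : E3 → ℝ} (h : IsTestFn Ω φ) (hθ : ContDiff ℝ ∞ θ) :
    IsTestFn Ω fun x => θ x * φ x :=
  ⟨hθ.mul h.1, h.2.1.mul_left (f := θ), (tsupport_mul_subset_right (f := θ) (g := φ)).trans h.2.2⟩

theorem IsTestFn.toV_add {Ω : Set E3} {φ φ' ψ : E3 → ℝ} (h : IsTestFn Ω φ) (h' : IsTestFn Ω φ')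
    (hψ : IsTestFn Ω ψ) (he : ψ = φ + φ') : hψ.toV = h.toV + h'.toV := by
  subst he
  refine Subtype.ext (Prod.ext (MemLp.toLp_add (h.memLp 2) (h'.memLp 2)) ?_)
  have h1 : gradient (φ + φ') = gradient φ + gradient φ' :=
    gradient_add_fn h.differentiable h'.differentiable
  exact (MemLp.toLp_congr (hψ.memLp_gradient 2)
    ((h.memLp_gradient 2).add (h'.memLp_gradient 2)) (by rw [h1])).trans
    (MemLp.toLp_add (h.memLp_gradient 2) (h'.memLp_gradient 2))

namespace IsSol

variable {Ω : Set E3} {T : ℝ} {U : ℝ → VSub Ω} {V : ℝ → H}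
  {p : E3} {i : Fin 3} {e : E3} {ρ : E3 → ℝ} {R c M : ℝ}

/-- Split φ = (1 − θ)φ + θφ. The first summand vanishes near the boundary and contributes nothing;
the second is supported, inside Ω, in the layer, where the gradient is controlled by its increments.
-/
theorem abs_greenForm_patch_le (h : IsSol Ω T U V) (hP : IsPatch Ω p i e ρ R c M)
    (hΩ : IsSmoothBoundedDomain Ω) {χ : E3 → ℝ} {L : ℝ} (hχ : IsCutoff χ L)
    (hχ1 : ∀ x ∈ Metric.closedBall p (R / 4), χ x = 1) {τ : ℝ} (hτ : 0 < τ) (hτR : τ < R / 4)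
    {θ : E3 → ℝ} (hθ : ContDiff ℝ ∞ θ) (hθ1 : ∀ x, |θ x| ≤ 1) (hθf : ∀ x, ρ x = 0 → θ =ᶠ[𝓝 x] 1)
    (hθi : ∀ x, ρ x ≤ -(c * τ) → θ =ᶠ[𝓝 x] 0) {C S μ Y B : ℝ} (hμ : 0 < μ) (hC : 0 ≤ C)
    (hθC : ∀ x ∈ Metric.ball p R, ‖gradient θ x‖ ≤ C / τ)
    {φ : E3 → ℝ} (hφ : IsTestFn univ φ) (hφp : tsupport φ ⊆ Metric.closedBall p (R / 4))
    (hφS : ∀ x, |φ x| ≤ S) (hgS : ∀ x, ‖gradient φ x‖ ≤ S)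
    {ε t : ℝ} (hε : 0 < ε) (ht : 0 ≤ t) (htT : t + ε ≤ T)
    (hY : ‖(ε⁻¹ • (V (t + ε) - V t) : H)‖ ≤ Y)
    (hB : ∀ r ∈ Icc (0 : ℝ) 1, ‖toL6 Ω (U (t + ε * r))‖ ^ 5 ≤ B) :
    |greenForm U V ε t hφ.toV| ≤
      Y * (S * (2 * τ * (surfaceMeasure Ω).real univ) ^ (1 / 2 : ℝ)) +
      (μ * (τ⁻¹ * hχ.incr (τ • e) (avg ε U t)) / 2 + 2 / μ * (((S + C * S) * τ) ^ 2 *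
        (surfaceMeasure Ω).real univ + C ^ 2 * ∫ x, φ x ^ 2 ∂(surfaceMeasure Ω))) +
      B * (S * (2 * τ * (surfaceMeasure Ω).real univ) ^ (1 / 6 : ℝ)) := by
  have hS : 0 ≤ S := (norm_nonneg _).trans (hgS 0)
  have hB0 : 0 ≤ B := (by positivity : (0 : ℝ) ≤ _).trans (hB 0 (by simp))
  have hY0 : 0 ≤ Y := (norm_nonneg _).trans hY
  have h1 : IsTestFn univ fun x => (1 - θ x) * φ x := hφ.mul_left (contDiff_const.sub hθ)
  have h2 : IsTestFn univ fun x => θ x * φ x := hφ.mul_left hθ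
  have e1 : hφ.toV = h1.toV + h2.toV := h1.toV_add h2 hφ (by ext x; simp only [Pi.add_apply]; ring)
  have h3 : greenForm U V ε t h1.toV = 0 := by
    refine h.greenForm_eq_zero_of_frontier hΩ.isOpen hε ht htT h1 fun x hx => ?_
    by_cases hxp : x ∈ Metric.closedBall p (R / 4)
    · filter_upwards [hθf x (hP.zero_of_frontier hΩ.isOpen (hP.closedBall_subset hxp) hx)] with y hy
      simp [hy]
    · filter_upwards [notMem_tsupport_iff_eventuallyEq.1 fun hh => hxp (hφp hh)] with y hy
      simp [hy]
  rw [e1, h.greenForm_add, h3, zero_add]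
  have hvol := hP.volume_layer_le hΩ hτ.le hτR
  refine (h.abs_greenForm_le hΩ.isOpen.measurableSet ε t h2
    (hP.measurableSet_layer hΩ.isOpen τ) (hP.volume_layer_lt_top τ).ne ?_ hS ?_ hB
    (hP.abs_integral_layer_le hΩ hχ hχ1 hτ hτR (avg ε U t) hφ hθ hθ1 hμ hC hθC hφS hgS)).trans ?_
  · intro x hx hxl
    rw [notMem_tsupport_iff_eventuallyEq]
    by_cases hxp : x ∈ Metric.closedBall p (R / 4)
    · have : ρ x ≤ -(c * τ) := not_lt.1 fun hh => hxl ⟨hx, hxp, hh⟩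
      filter_upwards [hθi x this] with y hy
      simp [hy]
    · filter_upwards [notMem_tsupport_iff_eventuallyEq.1 fun hh => hxp (hφp hh)] with y hy
      simp [hy]
  · intro x _
    rw [abs_mul]
    calc |θ x| * |φ x| ≤ 1 * S := by
          gcongr
          · exact hθ1 x
          · exact hφS x
      _ = S := one_mul S
  · gcongr

end IsSol

theorem continuous_integral_sq {ν : Measure E3} [IsFiniteMeasure ν] {φ : ℝ × E3 → ℝ}
    (hφ : IsTest univ φ) : Continuous fun t => ∫ x, φ (t, x) ^ 2 ∂ν := by
  obtain ⟨S, hS⟩ := hφ.2.1.exists_bound_of_continuous hφ.1.continuous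
  have hc := hφ.1.continuous
  refine continuous_of_dominated (bound := fun _ => S ^ 2) (fun t => ?_) (fun t => ?_)
    (integrable_const _) ?_
  · exact Continuous.aestronglyMeasurable (by fun_prop)
  · refine Eventually.of_forall fun x => ?_
    rw [norm_pow]
    gcongr
    exact hS _
  · exact Eventually.of_forall fun x => by fun_prop

/-- A bound of Green's form by the values on the boundary, for test functions with the
property `P`. -/
def GreenBound (Ω : Set E3) (t₀ C : ℝ) (P : (ℝ × E3 → ℝ) → Prop) : Prop :=
  ∀ (T : ℝ) (U : ℝ → VSub Ω) (V : ℝ → H) (h : IsSol Ω T U V), T ≤ t₀ →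
    ∀ a b ε m : ℝ, 0 < a → a ≤ b → 0 < ε → b + ε < T →
    (∀ s t, |s - t| ≤ ε → dist (U s) (U t) ≤ m) →
    ∀ (φ : ℝ × E3 → ℝ) (hφ : IsTest univ φ), P φ → ∀ μ > 0,
      |∫ t in a..b, greenForm U V ε t (hφ.sliceV t)| ≤
        C * (μ * (en (U 0) (V 0) + m * h.nlBound) +
          1 / μ * ∫ t in a..b, ∫ x, φ (t, x) ^ 2 ∂(surfaceMeasure Ω))

/-- The layer estimate is integrated in time, the Rellich estimate is inserted, and τ → 0 with ε
fixed. Only the energy, the modulus error and the boundary integral survive. -/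
theorem exists_patch_bound {Ω : Set E3} (hΩ : IsSmoothBoundedDomain Ω) {p : E3} (hp : p ∈ frontier Ω) (t₀ : ℝ) :
    ∃ r > 0, ∃ C > 0, GreenBound Ω t₀ C
      fun φ => ∀ t, tsupport (fun x => φ (t, x)) ⊆ Metric.closedBall p r := by
  obtain ⟨i, e, ρ, R, c, M, hP⟩ := exists_isPatch hΩ hp
  obtain ⟨K, hK, hlayer⟩ := hP.exists_layerFn
  have hR := hP.R_pos
  obtain ⟨χ, L, hχ, hχ1, hχs⟩ := exists_isCutoff p (by positivity : 0 < R / 4)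
  have hL := hχ.L_nonneg
  have hfin := isFiniteMeasure_surfaceMeasure hΩ
  -- The limiting coefficients of energy, modulus error and boundary integral are at most 4 +
  -- 5L|t₀|, 1 and 2K²; their sum dominates each.
  refine ⟨R / 4, by positivity, (4 + 5 * L * |t₀|) + 1 + 2 * K ^ 2, by positivity, ?_⟩
  intro T U V h hT a b ε m ha hab hε hbT hmod φ hφ hφp μ hμ
  set σ₁ := (surfaceMeasure Ω).real univ with hσ₁
  set E := en (U 0) (V 0) with hE
  have hE0 : 0 ≤ E := en_nonneg _ _
  set J : ℝ := ∫ t in a..b, ∫ x, φ (t, x) ^ 2 ∂(surfaceMeasure Ω) with hJ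
  have hJc : Continuous fun t => ∫ x, φ (t, x) ^ 2 ∂(surfaceMeasure Ω) := continuous_integral_sq hφ
  have hJ0 : 0 ≤ J :=
    intervalIntegral.integral_nonneg hab fun t _ => integral_nonneg fun x => sq_nonneg _
  have hm0 : 0 ≤ m := dist_nonneg.trans (hmod 0 0 (by simpa using hε.le))
  have hn0 := h.nlBound_nonneg
  have hU := h.contU
  have hV := h.contV
  obtain ⟨S1, hS1⟩ := hφ.2.1.exists_bound_of_continuous hφ.1.continuous
  obtain ⟨S2, hS2⟩ := hφ.hasCompactSupport_gradX.exists_bound_of_continuous hφ.continuous_gradX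
  set S := max S1 S2 with hS
  -- The bounds Y, B and Z may depend on ε and on the solution. Finiteness suffices, since each is
  -- multiplied by a positive power of τ.
  have hYc : Continuous fun t => (ε⁻¹ • (V (t + ε) - V t) : H) := by fun_prop
  obtain ⟨Y, hY⟩ := isCompact_Icc.exists_bound_of_continuousOn (s := Icc a b) hYc.continuousOn
  have hBc : Continuous fun s => ‖toL6 Ω (U s)‖ ^ 5 := by fun_prop
  obtain ⟨B, hB⟩ := isCompact_Icc.exists_bound_of_continuousOn (s := Icc a (b + ε)) hBc.continuousOn
  have hZc : Continuous fun t => (diffQuot U ε t).1.2 := (sndV Ω).continuous.comp (h.continuous_diffQuot ε)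
  obtain ⟨Z, hZ⟩ := isCompact_Icc.exists_bound_of_continuousOn (s := Icc a b) hZc.continuousOn
  set I := |∫ t in a..b, greenForm U V ε t (hφ.sliceV t)| with hI
  set f : ℝ → ℝ := fun τ =>
    (Y * (S * (2 * τ * σ₁) ^ (1 / 2 : ℝ)) + 2 / μ * (((S + K * S) * τ) ^ 2 * σ₁) +
      B * (S * (2 * τ * σ₁) ^ (1 / 6 : ℝ))) * (b - a) +
    μ / 2 * ((8 + 10 * L * T) * E + T * τ * Z ^ 2 + 2 * m * h.nlBound) +
    2 / μ * K ^ 2 * J with hf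
  have hfc : Continuous f := by
    have h1 : Continuous fun τ : ℝ => (2 * τ * σ₁) ^ (1 / 2 : ℝ) :=
      Continuous.rpow_const (by fun_prop) fun _ => Or.inr (by norm_num)
    have h2 : Continuous fun τ : ℝ => (2 * τ * σ₁) ^ (1 / 6 : ℝ) :=
      Continuous.rpow_const (by fun_prop) fun _ => Or.inr (by norm_num)
    fun_prop
  have hle : ∀ τ, 0 < τ → τ < R / 4 → I ≤ f τ := by
    intro τ hτ hτR
    obtain ⟨θ, hθ, hθ1, hθf, hθi, hθC⟩ := hlayer τ hτ
    have hnτ : ‖τ • e‖ = τ := by rw [norm_smul, hP.norm_e, mul_one, Real.norm_of_nonneg hτ.le]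
    have hincr := h.integral_incr_le hχ (c := τ • e) (inv_pos.2 hτ).le
      (by rw [hnτ, inv_mul_cancel₀ hτ.ne'])
      (fun x hx hxs => hP.mem_of_sub_mem hτ.le (by linarith : 2 * (R / 4) + τ < R) (hχs hx) hxs)
      ha hab hε hbT hmod hZ
    rw [hnτ] at hincr
    set w : ℝ → ℝ := fun t => hχ.incr (τ • e) (avg ε U t) with hw
    have hwc : Continuous w := (hχ.continuous_incr _).comp (continuous_avg_right hU ε)
    set A := Y * (S * (2 * τ * σ₁) ^ (1 / 2 : ℝ)) + 2 / μ * (((S + K * S) * τ) ^ 2 * σ₁) +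
      B * (S * (2 * τ * σ₁) ^ (1 / 6 : ℝ)) with hA
    have hpt : I ≤ ∫ t in a..b, (A + (μ / 2 * τ⁻¹) * w t +
        2 / μ * K ^ 2 * ∫ x, φ (t, x) ^ 2 ∂(surfaceMeasure Ω)) := by
      have hgc : Continuous fun t => A + (μ / 2 * τ⁻¹) * w t +
        2 / μ * K ^ 2 * ∫ x, φ (t, x) ^ 2 ∂(surfaceMeasure Ω) := by fun_prop
      rw [hI, ← Real.norm_eq_abs]
      refine intervalIntegral.norm_integral_le_of_norm_le hab (Eventually.of_forall fun t ht => ?_)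
        (hgc.intervalIntegrable _ _)
      have htm : t ∈ Icc a b := ⟨ht.1.le, ht.2⟩
      have := h.abs_greenForm_patch_le hP hΩ hχ hχ1 hτ hτR hθ hθ1 hθf hθi hμ hK.le hθC (hφ.slice t)
        (hφp t) (S := S) (fun x => (hS1 (t, x)).trans (le_max_left _ _))
        (fun x => (hS2 (t, x)).trans (le_max_right _ _)) hε (by linarith [ht.1])
        (by linarith [ht.2]) (hY t htm) (fun r hr => (le_abs_self _).trans (hB _
          ⟨by nlinarith [ht.1, hr.1], by nlinarith [ht.2, hr.2]⟩))
      refine this.trans (le_of_eq ?_)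
      rw [hA, hw]
      ring
    rw [intervalIntegral.integral_add (f := fun t => A + μ / 2 * τ⁻¹ * w t)
      (g := fun t => 2 / μ * K ^ 2 * ∫ x, φ (t, x) ^ 2 ∂(surfaceMeasure Ω))
      (Continuous.intervalIntegrable (by fun_prop) _ _)
      (Continuous.intervalIntegrable (by fun_prop) _ _),
      intervalIntegral.integral_add (f := fun _ => A) (g := fun t => μ / 2 * τ⁻¹ * w t)
      (Continuous.intervalIntegrable (by fun_prop) _ _)
      (Continuous.intervalIntegrable (by fun_prop) _ _),
      intervalIntegral.integral_const_mul, intervalIntegral.integral_const_mul,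
      intervalIntegral.integral_const, smul_eq_mul, ← hJ] at hpt
    refine hpt.trans ?_
    have h5 : μ / 2 * (τ⁻¹ * ∫ t in a..b, w t) ≤
        μ / 2 * ((8 + 10 * L * T) * E + T * τ * Z ^ 2 + 2 * m * h.nlBound) := by gcongr
    rw [hf]
    simp only
    nlinarith
  have hlim : I ≤ f 0 := by
    refine ge_of_tendsto (hfc.continuousWithinAt (s := Ioi 0) (x := 0)) ?_
    filter_upwards [self_mem_nhdsWithin, mem_nhdsWithin_of_mem_nhds
      (gt_mem_nhds (by positivity : 0 < R / 4))] with τ h1 h2 using hle τ h1 h2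
  have hf0 : f 0 = μ / 2 * ((8 + 10 * L * T) * E + 2 * m * h.nlBound) + 2 / μ * K ^ 2 * J := by
    rw [hf]
    simp
  rw [hf0] at hlim
  refine hlim.trans ?_
  have hT1 : T ≤ |t₀| := hT.trans (le_abs_self _)
  have h6 : L * T ≤ L * |t₀| := by gcongr
  have h7 : (4 + 5 * (L * T)) * (μ * E) ≤ (4 + 5 * (L * |t₀|)) * (μ * E) := by gcongr
  have h8 : 0 ≤ μ * E := by positivity
  have h9 : 0 ≤ μ * (m * h.nlBound) := by positivity
  have h10 : 0 ≤ 1 / μ * J := by positivity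
  have h11 : 0 ≤ L * |t₀| := by positivity
  have h12 : 0 ≤ K ^ 2 := by positivity
  have e1 : μ / 2 * ((8 + 10 * L * T) * E + 2 * m * h.nlBound) + 2 / μ * K ^ 2 * J =
      (4 + 5 * (L * T)) * (μ * E) + μ * (m * h.nlBound) + 2 * K ^ 2 * (1 / μ * J) := by ring
  rw [e1]
  have e2 : ((4 + 5 * L * |t₀|) + 1 + 2 * K ^ 2) * (μ * (E + m * h.nlBound) + 1 / μ * J) =
      (4 + 5 * (L * |t₀|)) * (μ * E) + (1 + 2 * K ^ 2) * (μ * E) +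
      (1 + (4 + 5 * (L * |t₀|) + 2 * K ^ 2)) * (μ * (m * h.nlBound)) +
      (2 * K ^ 2 + (5 + 5 * (L * |t₀|))) * (1 / μ * J) := by ring
  rw [e2]
  have h13 : 0 ≤ (1 + 2 * K ^ 2) * (μ * E) := by positivity
  have h14 : 0 ≤ (4 + 5 * (L * |t₀|) + 2 * K ^ 2) * (μ * (m * h.nlBound)) := by positivity
  have h15 : 0 ≤ (5 + 5 * (L * |t₀|)) * (1 / μ * J) := by positivity
  linarith

/-! ### The global estimate -/

theorem IsTest.mul_left {φ : ℝ × E3 → ℝ} (h : IsTest univ φ) {θ : E3 → ℝ} (hθ : ContDiff ℝ ∞ θ) :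
    IsTest univ fun z => θ z.2 * φ z :=
  ⟨(hθ.comp contDiff_snd).mul h.1, h.2.1.mul_left (f := fun z : ℝ × E3 => θ z.2), subset_univ _⟩

variable {Ω : Set E3}

theorem integral_sq_mul_le {ν : Measure E3} [IsFiniteMeasure ν] {φ : ℝ × E3 → ℝ}
    (hφ : IsTest univ φ) {θ : E3 → ℝ} (hθ : ContDiff ℝ ∞ θ) (hθ1 : ∀ x, |θ x| ≤ 1) {a b : ℝ}
    (hab : a ≤ b) : ∫ t in a..b, ∫ x, (θ x * φ (t, x)) ^ 2 ∂ν ≤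
      ∫ t in a..b, ∫ x, φ (t, x) ^ 2 ∂ν := by
  obtain ⟨S, hS⟩ := hφ.2.1.exists_bound_of_continuous hφ.1.continuous
  have hc := hφ.1.continuous
  have hle (t : ℝ) (x : E3) : (θ x * φ (t, x)) ^ 2 ≤ φ (t, x) ^ 2 := by
    rw [mul_pow]
    have : θ x ^ 2 ≤ 1 := by rw [← sq_abs]; exact pow_le_one₀ (abs_nonneg _) (hθ1 x)
    exact mul_le_of_le_one_left (sq_nonneg _) this
  have hb (t : ℝ) (x : E3) : φ (t, x) ^ 2 ≤ S ^ 2 := by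
    rw [← sq_abs]; gcongr; exact hS _
  have hi (t : ℝ) : Integrable (fun x => φ (t, x) ^ 2) ν :=
    Integrable.of_bound (Continuous.aestronglyMeasurable (by fun_prop)) (S ^ 2)
      (Eventually.of_forall fun x => by rw [Real.norm_of_nonneg (sq_nonneg _)]; exact hb t x)
  refine intervalIntegral.integral_mono hab
    ((continuous_integral_sq (hφ.mul_left hθ)).intervalIntegrable _ _)
    ((continuous_integral_sq hφ).intervalIntegrable _ _) fun t => ?_
  exact integral_mono_of_nonneg (Eventually.of_forall fun x => sq_nonneg _) (hi t)
    (Eventually.of_forall (hle t))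

/-- A partition of unity built one ball at a time: φ = fφ + (1 − f)φ, with f supported in the new
patch and equal to 1 on the half ball. The second part needs only the remaining balls, and the
constants add up. -/
theorem exists_greenBound_of_finset (hΩ : IsSmoothBoundedDomain Ω) (t₀ : ℝ) {r C : E3 → ℝ}
    (hr : ∀ p ∈ frontier Ω, 0 < r p) (hC : ∀ p ∈ frontier Ω, 0 < C p)
    (hB : ∀ p ∈ frontier Ω, GreenBound Ω t₀ (C p)
      fun φ => ∀ t, tsupport (fun x => φ (t, x)) ⊆ Metric.closedBall p (r p))
    (s : Finset E3) (hs : ∀ p ∈ s, p ∈ frontier Ω) :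
    ∃ K > 0, GreenBound Ω t₀ K fun φ => ∀ x ∈ frontier Ω,
      (∀ p ∈ s, x ∉ Metric.ball p (r p / 2)) → ∀ t, (fun x => φ (t, x)) =ᶠ[𝓝 x] 0 := by
  classical
  have hfin := isFiniteMeasure_surfaceMeasure hΩ
  induction s using Finset.induction_on with
  | empty =>
    refine ⟨1, one_pos, fun T U V h hT a b ε m ha hab hε hb hmod φ hφ hP μ hμ => ?_⟩
    have h0 : ∫ t in a..b, greenForm U V ε t (hφ.sliceV t) = 0 := by
      refine (intervalIntegral.integral_congr (g := fun _ => 0) fun t ht => ?_).trans (by simp)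
      rw [uIcc_of_le hab] at ht
      exact h.greenForm_eq_zero_of_frontier hΩ.isOpen hε (by linarith [ht.1]) (by linarith [ht.2])
        (hφ.slice t) fun x hx => hP x hx (by simp) t
    have hm0 : 0 ≤ m := dist_nonneg.trans (hmod 0 0 (by simpa using hε.le))
    have hJ0 : 0 ≤ ∫ t in a..b, ∫ x, φ (t, x) ^ 2 ∂(surfaceMeasure Ω) :=
      intervalIntegral.integral_nonneg hab fun t _ => integral_nonneg fun x => sq_nonneg _
    have := h.nlBound_nonneg
    have := en_nonneg (U 0) (V 0)
    rw [h0, abs_zero]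
    positivity
  | insert p s _ ih =>
    obtain ⟨K, hK, ih⟩ := ih fun q hq => hs q (Finset.mem_insert_of_mem hq)
    have hp : p ∈ frontier Ω := hs p (Finset.mem_insert_self p s)
    have hrp := hr p hp
    let f : ContDiffBump p := ⟨r p / 2, r p, by linarith, by linarith⟩
    have hf : ContDiff ℝ ∞ f := f.contDiff
    have hf' : ContDiff ℝ ∞ fun x => 1 - f x := contDiff_const.sub hf
    have hf1 (x : E3) : |f x| ≤ 1 := by rw [abs_of_nonneg f.nonneg]; exact f.le_one
    have hf1' (x : E3) : |1 - f x| ≤ 1 := by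
      rw [abs_of_nonneg (sub_nonneg.2 f.le_one)]; linarith [f.nonneg (x := x)]
    refine ⟨C p + K, add_pos (hC p hp) hK,
      fun T U V h hT a b ε m ha hab hε hb hmod φ hφ hP μ hμ => ?_⟩
    have b1 := hB p hp T U V h hT a b ε m ha hab hε hb hmod _ (hφ.mul_left hf)
      (fun t => (tsupport_mul_subset_left (f := f)).trans f.tsupport_eq.subset) μ hμ
    have b2 := ih T U V h hT a b ε m ha hab hε hb hmod _ (hφ.mul_left hf') (fun x hx hxs t => by
      by_cases hxp : x ∈ Metric.ball p (r p / 2)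
      · filter_upwards [f.eventuallyEq_one_of_mem_ball hxp] with y hy
        simp [hy]
      · filter_upwards [hP x hx (fun q hq => by
          rcases Finset.mem_insert.1 hq with rfl | hq
          · exact hxp
          · exact hxs q hq) t] with y hy
        simp [hy]) μ hμ
    have e1 (t : ℝ) : greenForm U V ε t (hφ.sliceV t) =
        greenForm U V ε t ((hφ.mul_left hf).sliceV t) +
          greenForm U V ε t ((hφ.mul_left hf').sliceV t) := by
      rw [← h.greenForm_add]
      congr 1
      exact IsTestFn.toV_add ((hφ.mul_left hf).slice t) ((hφ.mul_left hf').slice t) (hφ.slice t)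
        (by ext x; simp only [Pi.add_apply]; ring)
    simp only [e1]
    rw [intervalIntegral.integral_add
      ((h.continuous_greenForm ε (hφ.mul_left hf).continuous_sliceV).intervalIntegrable _ _)
      ((h.continuous_greenForm ε (hφ.mul_left hf').continuous_sliceV).intervalIntegrable _ _)]
    refine (abs_add_le _ _).trans ((add_le_add b1 b2).trans ?_)
    have hCp := hC p hp
    rw [add_mul]
    gcongr
    · exact integral_sq_mul_le hφ hf hf1 hab
    · exact integral_sq_mul_le hφ hf' hf1' hab

theorem exists_greenBound (hΩ : IsSmoothBoundedDomain Ω) (t₀ : ℝ) :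
    ∃ K > 0, GreenBound Ω t₀ K fun _ => True := by
  have hcomp : IsCompact (frontier Ω) :=
    Metric.isCompact_of_isClosed_isBounded isClosed_frontier
      (hΩ.isBounded.closure.subset frontier_subset_closure)
  choose! r hr C hC hB using fun p (hp : p ∈ frontier Ω) => exists_patch_bound hΩ hp t₀
  obtain ⟨s, hs, hcov⟩ := hcomp.elim_nhds_subcover (fun p => Metric.ball p (r p / 2))
    fun p hp => Metric.ball_mem_nhds p (half_pos (hr p hp))
  obtain ⟨K, hK, hbd⟩ := exists_greenBound_of_finset hΩ t₀ hr hC hB s hs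
  refine ⟨K, hK, fun T U V h hT a b ε m ha hab hε hb hmod φ hφ _ μ hμ =>
    hbd T U V h hT a b ε m ha hab hε hb hmod φ hφ (fun x hx hxs => ?_) μ hμ⟩
  obtain ⟨p, hp, hxp⟩ := mem_iUnion₂.1 (hcov hx)
  exact absurd hxp (hxs p hp)

/-! ### Removing the time average -/

/-- The time derivative. -/
def derivT (φ : ℝ × E3 → ℝ) (z : ℝ × E3) : ℝ := deriv (fun s => φ (s, z.2)) z.1

theorem hasDerivAt_slice_fst {φ : ℝ × E3 → ℝ} (h : Differentiable ℝ φ) (s : ℝ) (x : E3) :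
    HasDerivAt (fun r => φ (r, x)) (fderiv ℝ φ (s, x) (1, 0)) s :=
  (h (s, x)).hasFDerivAt.comp_hasDerivAt s ((hasDerivAt_id s).prodMk (hasDerivAt_const s x))

theorem derivT_eq {φ : ℝ × E3 → ℝ} (h : Differentiable ℝ φ) (z : ℝ × E3) :
    derivT φ z = fderiv ℝ φ z (1, 0) := (hasDerivAt_slice_fst h z.1 z.2).deriv

theorem IsTest.continuous_derivT {S : Set (ℝ × E3)} {φ : ℝ × E3 → ℝ} (h : IsTest S φ) :
    Continuous (derivT φ) := by
  rw [show derivT φ = fun z => fderiv ℝ φ z (1, 0) from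
    funext (derivT_eq (h.1.differentiable (by simp)))]
  have h2 : Continuous (fderiv ℝ φ) := h.1.continuous_fderiv (by simp)
  fun_prop

theorem IsTest.hasCompactSupport_derivT {S : Set (ℝ × E3)} {φ : ℝ × E3 → ℝ} (h : IsTest S φ) :
    HasCompactSupport (derivT φ) := by
  refine (h.2.1.fderiv ℝ).mono fun z hz => ?_
  contrapose! hz
  rw [Function.notMem_support] at hz ⊢
  rw [derivT_eq (h.1.differentiable (by simp)), hz, zero_apply]

theorem IsTest.mono {S S' : Set (ℝ × E3)} {φ : ℝ × E3 → ℝ} (h : IsTest S φ) (hs : S ⊆ S') :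
    IsTest S' φ := ⟨h.1, h.2.1, h.2.2.trans hs⟩

/-- The path of time derivatives of a test function. -/
def IsTest.sliceT {φ : ℝ × E3 → ℝ} (h : IsTest univ φ) (t : ℝ) : H :=
  QuinticWave.slice 2 h.continuous_derivT h.hasCompactSupport_derivT t

theorem IsTest.continuous_sliceT {φ : ℝ × E3 → ℝ} (h : IsTest univ φ) : Continuous h.sliceT :=
  continuous_slice (p := 2) h.continuous_derivT h.hasCompactSupport_derivT

theorem IsTest.hasDerivAt_sliceV {φ : ℝ × E3 → ℝ} (h : IsTest univ φ) (t : ℝ) :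
    HasDerivAt (fun s => (h.sliceV s).1.1) (h.sliceT t) t := by
  refine hasDerivAt_slice (p := 2) h.1.continuous h.2.1 h.continuous_derivT
    h.hasCompactSupport_derivT (fun s x => ?_) t
  have := hasDerivAt_slice_fst (h.1.differentiable (by simp)) s x
  rwa [← derivT_eq (h.1.differentiable (by simp))] at this

/-- The weak form of the equation at time `t`, averaged over times from `t` to `t + ε`. -/
def weakGreen {Ω : Set E3} (U : ℝ → VSub Ω) (V : ℝ → H) {φ : ℝ × E3 → ℝ} (hφ : IsTest univ φ)
    (ε t : ℝ) : ℝ :=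
  inner ℝ (avg ε U t).1.2 (hφ.sliceV t).1.2 - inner ℝ (avg ε V t) (hφ.sliceT t) +
    ∫ r in (0 : ℝ)..1, quint (toL6 Ω (U (t + ε * r))) (toL6 univ (hφ.sliceV t))

namespace IsSol

variable {Ω : Set E3} {T : ℝ} {U : ℝ → VSub Ω} {V : ℝ → H}

theorem continuous_weakGreen (h : IsSol Ω T U V) {φ : ℝ × E3 → ℝ} (hφ : IsTest univ φ) :
    Continuous fun p : ℝ × ℝ => weakGreen U V hφ p.1 p.2 := by
  have h1 := h.contU
  have h3 : Continuous fun p : ℝ × ℝ => (hφ.sliceV p.2).1.2 :=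
    (sndV univ).continuous.comp (hφ.continuous_sliceV.comp continuous_snd)
  have h4 : Continuous fun p : ℝ × ℝ => hφ.sliceT p.2 := hφ.continuous_sliceT.comp continuous_snd
  have h5 : Continuous fun p : ℝ × ℝ => (avg p.1 U p.2).1.2 :=
    (sndV Ω).continuous.comp (continuous_avg h1)
  have h6 : Continuous fun p : ℝ × ℝ => avg p.1 V p.2 := continuous_avg h.contV
  refine Continuous.add ((h5.inner h3).sub (h6.inner h4)) ?_
  refine intervalIntegral.continuous_parametric_intervalIntegral_of_continuous' ?_ 0 1
  exact continuous_quint_of ((toL6 Ω).continuous.comp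
    (h1.comp (by fun_prop : Continuous fun q : (ℝ × ℝ) × ℝ => q.1.2 + q.1.1 * q.2)))
    ((toL6 univ).continuous.comp
      (hφ.continuous_sliceV.comp (by fun_prop : Continuous fun q : (ℝ × ℝ) × ℝ => q.1.2)))

theorem hasDerivAt_inner_avg (h : IsSol Ω T U V) {φ : ℝ × E3 → ℝ} (hφ : IsTest univ φ) {ε : ℝ}
    (hε : ε ≠ 0) (t : ℝ) : HasDerivAt (fun s => inner ℝ (avg ε V s) (hφ.sliceV s).1.1)
      (inner ℝ (avg ε V t) (hφ.sliceT t) +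
        inner ℝ (ε⁻¹ • (V (t + ε) - V t)) (hφ.sliceV t).1.1) t := by
  have h1 := hasDerivAt_avg h.contV hε t
  have h2 := hφ.hasDerivAt_sliceV t
  exact h1.inner ℝ h2

theorem continuous_deriv_inner_avg (h : IsSol Ω T U V) {φ : ℝ × E3 → ℝ} (hφ : IsTest univ φ)
    (ε : ℝ) : Continuous fun t => inner ℝ (avg ε V t) (hφ.sliceT t) +
        inner ℝ (ε⁻¹ • (V (t + ε) - V t)) (hφ.sliceV t).1.1 := by
  have hV := h.contV
  have h1 : Continuous fun t => (hφ.sliceV t).1.1 := (fstV univ).continuous.comp hφ.continuous_sliceV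
  have h2 : Continuous fun t => (ε⁻¹ • (V (t + ε) - V t) : H) := by fun_prop
  exact ((continuous_avg_right hV ε).inner hφ.continuous_sliceT).add (h2.inner h1)

/-- Integration by parts in time. It moves the difference quotient of V onto φ, after which the
expression has a limit as ε → 0. -/
theorem integral_greenForm_eq (h : IsSol Ω T U V) {φ : ℝ × E3 → ℝ} (hφ : IsTest univ φ) {ε : ℝ}
    (hε : ε ≠ 0) {a b : ℝ} (ha : ∀ x, φ (a, x) = 0) (hb : ∀ x, φ (b, x) = 0) :
    ∫ t in a..b, greenForm U V ε t (hφ.sliceV t) = ∫ t in a..b, weakGreen U V hφ ε t := by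
  have hz {t : ℝ} (ht : ∀ x, φ (t, x) = 0) : (hφ.sliceV t).1.1 = 0 := by
    refine Lp.ext (((hφ.slice t).coeFn_toV_fst).trans ?_)
    filter_upwards [Lp.coeFn_zero ℝ 2 (volume : Measure E3)] with x hx
    rw [hx, ht x, Pi.zero_apply]
  have hc1 := h.continuous_deriv_inner_avg hφ ε
  have h1 := intervalIntegral.integral_eq_sub_of_hasDerivAt (a := a) (b := b)
    (fun t _ => h.hasDerivAt_inner_avg hφ hε t)
    (hc1.intervalIntegrable _ _)
  rw [hz ha, hz hb, inner_zero_right, inner_zero_right, sub_zero] at h1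
  have hw : Continuous fun t => weakGreen U V hφ ε t :=
    Continuous.comp (g := fun p : ℝ × ℝ => weakGreen U V hφ p.1 p.2) (f := fun t => (ε, t))
      (h.continuous_weakGreen hφ) (by fun_prop)
  have h2 (t : ℝ) : greenForm U V ε t (hφ.sliceV t) = weakGreen U V hφ ε t +
      (inner ℝ (avg ε V t) (hφ.sliceT t) +
        inner ℝ (ε⁻¹ • (V (t + ε) - V t)) (hφ.sliceV t).1.1) := by
    unfold greenForm weakGreen
    generalize (∫ r in (0 : ℝ)..1, quint (toL6 Ω (U (t + ε * r))) (toL6 univ (hφ.sliceV t))) = x1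
    generalize (inner ℝ (avg ε V t) (hφ.sliceT t) : ℝ) = x2
    generalize (inner ℝ (ε⁻¹ • (V (t + ε) - V t)) (hφ.sliceV t).1.1 : ℝ) = x3
    ring
  simp only [h2]
  have h3 := intervalIntegral.integral_add (μ := volume) (hw.intervalIntegrable a b)
    (hc1.intervalIntegrable a b)
  rw [h1, add_zero] at h3
  exact h3

/-- On the right of `GreenBound` the averaging length appears only through m. So ε → 0 with m fixed,
and then m → 0. -/
theorem abs_integral_weakGreen_le (h : IsSol Ω T U V) {t₀ K : ℝ}
    (hbd : GreenBound Ω t₀ K fun _ => True) (hT : T ≤ t₀) {a b : ℝ} (ha : 0 < a) (hab : a ≤ b)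
    (hbT : b < T) {φ : ℝ × E3 → ℝ} (hφ : IsTest univ φ) (ha0 : ∀ x, φ (a, x) = 0)
    (hb0 : ∀ x, φ (b, x) = 0) {μ : ℝ} (hμ : 0 < μ) :
    |∫ t in a..b, weakGreen U V hφ 0 t| ≤ K * (μ * en (U 0) (V 0) +
      1 / μ * ∫ t in a..b, ∫ x, φ (t, x) ^ 2 ∂(surfaceMeasure Ω)) := by
  set J := ∫ t in a..b, ∫ x, φ (t, x) ^ 2 ∂(surfaceMeasure Ω)
  have hFc : Continuous fun ε => |∫ t in a..b, weakGreen U V hφ ε t| :=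
    (intervalIntegral.continuous_parametric_intervalIntegral_of_continuous'
      (h.continuous_weakGreen hφ) a b).abs
  have hm (m : ℝ) (hm : 0 < m) : |∫ t in a..b, weakGreen U V hφ 0 t| ≤
      K * (μ * (en (U 0) (V 0) + m * h.nlBound) + 1 / μ * J) := by
    obtain ⟨δ, hδ, hmod⟩ := exists_modulus h.ucU hm
    refine le_of_tendsto (hFc.continuousWithinAt (s := Ioi 0) (x := 0)) ?_
    filter_upwards [self_mem_nhdsWithin, mem_nhdsWithin_of_mem_nhds (gt_mem_nhds hδ),
      mem_nhdsWithin_of_mem_nhds (gt_mem_nhds (sub_pos.2 hbT))] with ε h1 h2 h3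
    rw [← h.integral_greenForm_eq hφ (ne_of_gt h1) ha0 hb0]
    exact hbd T U V h hT a b ε m ha hab h1 (by linarith)
      (fun s t hst => hmod s t (hst.trans (le_of_lt h2))) φ hφ trivial μ hμ
  have hgc : Continuous fun m => K * (μ * (en (U 0) (V 0) + m * h.nlBound) + 1 / μ * J) := by
    fun_prop
  have := ge_of_tendsto (hgc.continuousWithinAt (s := Ioi 0) (x := 0)) (by
    filter_upwards [self_mem_nhdsWithin] with m h1 using hm m h1)
  simpa using this

end IsSol

/-! ### Weak solutions -/

section Pairing

variable {Ω : Set E3}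

theorem integral_fiber_eq (hΩ : MeasurableSet Ω) (w : H10 Ω) (w' : L2 Ω) {φ : ℝ × E3 → ℝ}
    (hφ : IsTest univ φ) (t : ℝ) :
    ∫ x in Ω, (inner ℝ (H10.grad w x) (gradient (fun y => φ (t, y)) x)
      - w' x * deriv (fun s => φ (s, x)) t + H10.fn w x ^ 5 * φ (t, x)) =
    inner ℝ (h10ToV hΩ w).1.2 (hφ.sliceV t).1.2 - inner ℝ (extZero hΩ w') (hφ.sliceT t) +
      quint (toL6 Ω (h10ToV hΩ w)) (toL6 univ (hφ.sliceV t)) := by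
  have i1 := L2.integrable_inner (𝕜 := ℝ) (h10ToV hΩ w).1.2 (hφ.sliceV t).1.2
  have i2 := L2.integrable_inner (𝕜 := ℝ) (extZero hΩ w') (hφ.sliceT t)
  have i3 := integrable_quint (toL6 Ω (h10ToV hΩ w)) (toL6 univ (hφ.sliceV t))
  have e0 := integral_add (i1.sub i2) i3
  simp only [Pi.sub_apply] at e0
  rw [L2.inner_def, L2.inner_def, quint_eq, ← integral_sub i1 i2, ← e0, ← integral_indicator hΩ]
  refine integral_congr_ae ?_
  filter_upwards [coeFn_extZero hΩ (H10.grad w), coeFn_extZero hΩ (H10.fn w), coeFn_extZero hΩ w',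
    (hφ.slice t).coeFn_toV_fst, (hφ.slice t).coeFn_toV_snd, coeFn_toL6 (h10ToV hΩ w),
    coeFn_toL6 (hφ.sliceV t), coeFn_slice (p := 2) hφ.continuous_derivT hφ.hasCompactSupport_derivT t]
    with x h1 h2 h3 h4 h5 h6 h7 h8
  have e1 : (h10ToV hΩ w).1.2 x = Ω.indicator (H10.grad w) x := h1
  have e2 : (h10ToV hΩ w).1.1 x = Ω.indicator (H10.fn w) x := h2
  have e4 : (hφ.sliceV t).1.1 x = φ (t, x) := h4
  have e5 : (hφ.sliceV t).1.2 x = gradient (fun y => φ (t, y)) x := h5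
  have e8 : hφ.sliceT t x = deriv (fun s => φ (s, x)) t := h8
  rw [e1, h3, h6, h7, e2, e4, e5, e8]
  by_cases hx : x ∈ Ω
  · simp only [indicator_of_mem hx]
    simp [mul_comm]
  · simp [indicator_of_notMem hx]

theorem en_eq_energy (hΩ : MeasurableSet Ω) (w : H10 Ω) (w' : L2 Ω) :
    en (h10ToV hΩ w) (extZero hΩ w') = energy Ω w w' := by
  unfold en pot energy
  have i1 := (L2.integrable_inner (𝕜 := ℝ) (h10ToV hΩ w).1.2 (h10ToV hΩ w).1.2).div_const 2
  have i2 := (L2.integrable_inner (𝕜 := ℝ) (extZero hΩ w') (extZero hΩ w')).div_const 2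
  have i3 := (integrable_pow_six (toL6 Ω (h10ToV hΩ w))).div_const 6
  have e0 := integral_add (i1.add i2) i3
  simp only [Pi.add_apply] at e0
  rw [← real_inner_self_eq_norm_sq, ← real_inner_self_eq_norm_sq, L2.inner_def, L2.inner_def,
    quint_self, ← integral_div, ← integral_div, ← integral_div, ← integral_add i1 i2, ← e0,
    ← integral_indicator hΩ]
  refine integral_congr_ae ?_
  filter_upwards [coeFn_extZero hΩ (H10.grad w), coeFn_extZero hΩ (H10.fn w), coeFn_extZero hΩ w',
    coeFn_toL6 (h10ToV hΩ w)] with x h1 h2 h3 h6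
  have e1 : (h10ToV hΩ w).1.2 x = Ω.indicator (H10.grad w) x := h1
  have e2 : (h10ToV hΩ w).1.1 x = Ω.indicator (H10.fn w) x := h2
  rw [e1, h3, h6, e2]
  by_cases hx : x ∈ Ω
  · simp only [indicator_of_mem hx, real_inner_self_eq_norm_sq, sq_abs, Real.norm_eq_abs]
    rw [Even.pow_abs (by decide)]
    ring
  · simp [indicator_of_notMem hx]

theorem exists_Ioo_of_isCompact {K : Set ℝ} (hK : IsCompact K) {T : ℝ} (hT : 0 < T)
    (hKT : K ⊆ Ioo 0 T) : ∃ a b, 0 < a ∧ a ≤ b ∧ b < T ∧ K ⊆ Ioo a b := by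
  rcases K.eq_empty_or_nonempty with rfl | hne
  · exact ⟨T / 2, T / 2, by linarith, le_rfl, by linarith, empty_subset _⟩
  · have h1 := hKT (hK.sInf_mem hne)
    have h2 := hKT (hK.sSup_mem hne)
    have h3 (x : ℝ) (hx : x ∈ K) : sInf K ≤ x := csInf_le hK.bddBelow hx
    have h4 (x : ℝ) (hx : x ∈ K) : x ≤ sSup K := le_csSup hK.bddAbove hx
    have h5 := h3 _ (hK.sSup_mem hne)
    refine ⟨sInf K / 2, (sSup K + T) / 2, by linarith [h1.1], by linarith [h1.1, h2.2],
      by linarith [h2.2], fun x hx => ⟨by linarith [h3 x hx, h1.1], by linarith [h4 x hx, h2.2]⟩⟩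

/-- The time interval in which a test function lives. -/
theorem IsTest.exists_Ioo {T : ℝ} (hT : 0 < T) {φ : ℝ × E3 → ℝ} (hφ : IsTest (Ioo 0 T ×ˢ univ) φ) :
    ∃ a b, 0 < a ∧ a ≤ b ∧ b < T ∧ tsupport φ ⊆ Ioo a b ×ˢ univ := by
  obtain ⟨a, b, ha, hab, hb, hK⟩ := exists_Ioo_of_isCompact (hφ.2.1.isCompact.image continuous_fst) hT
    (by rintro _ ⟨z, hz, rfl⟩; exact (hφ.2.2 hz).1)
  exact ⟨a, b, ha, hab, hb, fun z hz => ⟨hK ⟨z, hz, rfl⟩, mem_univ _⟩⟩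

theorem weakForm_eq (hΩ : MeasurableSet Ω) {t₀ T : ℝ} (hT : T ≤ t₀) {u : ℝ → H10 Ω} {v : ℝ → L2 Ω}
    {U : ℝ → VSub Ω} {V : ℝ → H} (hU : ∀ t ∈ Icc 0 T, U t = h10ToV hΩ (u t))
    (hV : ∀ t ∈ Icc 0 T, V t = extZero hΩ (v t)) {φ : ℝ × E3 → ℝ} (hφ : IsTest univ φ) {a b : ℝ}
    (ha : 0 < a) (hab : a ≤ b) (hb : b < T) (hs : tsupport φ ⊆ Ioo a b ×ˢ univ) :
    weakForm Ω t₀ u v φ = ∫ t in a..b, weakGreen U V hφ 0 t := by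
  rw [weakForm, intervalIntegral.integral_of_le hab, ← integral_Icc_eq_integral_Ioc]
  rw [setIntegral_eq_of_subset_of_forall_sdiff_eq_zero (s := Icc a b) measurableSet_Ioo
    (fun t ht => ⟨by linarith [ht.1], by linarith [ht.2]⟩)]
  · refine setIntegral_congr_fun measurableSet_Icc fun t ht => ?_
    have ht' : t ∈ Icc 0 T := ⟨by linarith [ht.1], by linarith [ht.2]⟩
    rw [integral_fiber_eq hΩ (u t) (v t) hφ t]
    unfold weakGreen
    rw [avg_zero, avg_zero, hU t ht', hV t ht']
    simp only [zero_mul, add_zero, intervalIntegral.integral_const, sub_zero, one_smul, hU t ht']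
  · rintro t ⟨-, ht⟩
    have hnot (x : E3) : (t, x) ∉ tsupport φ := fun hh => ht (Ioo_subset_Icc_self (hs hh).1)
    have h0 (x : E3) : fderiv ℝ φ (t, x) = 0 := by
      by_contra hne
      exact hnot x (support_fderiv_subset ℝ hne)
    have hd : Differentiable ℝ φ := hφ.1.differentiable (by simp)
    have h2 (x : E3) : deriv (fun s => φ (s, x)) t = 0 := by
      have := derivT_eq hd (t, x)
      rwa [h0, zero_apply] at this
    have h3 (x : E3) : φ (t, x) = 0 := image_eq_zero_of_notMem_tsupport (hnot x)
    simp [h2, h3]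

end Pairing

/-! #### Functions with vanishing weak derivative -/

/-- Zero mean is what makes the primitive vanish again beyond the support of ζ. -/
theorem exists_primitive {ζ : ℝ → ℝ} (hζ : ContDiff ℝ ∞ ζ) {T : ℝ} (hT : 0 < T)
    (hc : HasCompactSupport ζ) (hs : tsupport ζ ⊆ Ioo 0 T) (h0 : ∫ t, ζ t = 0) :
    ∃ θ : ℝ → ℝ, ContDiff ℝ ∞ θ ∧ HasCompactSupport θ ∧ tsupport θ ⊆ Ioo 0 T ∧
      ∀ t, HasDerivAt θ (ζ t) t := by
  obtain ⟨a, b, ha, hab, hb, hK⟩ := exists_Ioo_of_isCompact hc hT hs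
  have hz (t : ℝ) (ht : t ∉ Ioo a b) : ζ t = 0 :=
    image_eq_zero_of_notMem_tsupport fun hh => ht (hK hh)
  have hd (t : ℝ) : HasDerivAt (fun t => ∫ s in a..t, ζ s) (ζ t) t :=
    intervalIntegral.integral_hasDerivAt_right (hζ.continuous.intervalIntegrable _ _)
      (hζ.continuous.stronglyMeasurableAtFilter _ _) hζ.continuous.continuousAt
  have hab0 : ∫ s in a..b, ζ s = 0 := by
    rw [intervalIntegral.integral_of_le hab, ← h0]
    exact setIntegral_eq_integral_of_forall_compl_eq_zero fun t ht =>
      hz t fun hh => ht (Ioo_subset_Ioc_self hh)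
  have hsupp : Function.support (fun t => ∫ s in a..t, ζ s) ⊆ Icc a b := by
    intro t ht
    by_contra hh
    refine ht ?_
    rcases lt_or_ge t a with h1 | h1
    · refine (intervalIntegral.integral_congr (g := fun _ => 0) fun s hs => ?_).trans (by simp)
      rw [uIcc_of_ge h1.le] at hs
      exact hz s fun h2 => by linarith [h2.1, hs.2]
    · simp only
      have h2 : b < t := not_le.1 fun h3 => hh ⟨h1, h3⟩
      rw [← intervalIntegral.integral_add_adjacent_intervals (b := b)
        (hζ.continuous.intervalIntegrable _ _) (hζ.continuous.intervalIntegrable _ _), hab0, zero_add]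
      refine (intervalIntegral.integral_congr (g := fun _ => 0) fun s hs => ?_).trans (by simp)
      rw [uIcc_of_le h2.le] at hs
      exact hz s fun h4 => by linarith [h4.2, hs.1]
  have hts : tsupport (fun t => ∫ s in a..t, ζ s) ⊆ Icc a b := closure_minimal hsupp isClosed_Icc
  refine ⟨fun t => ∫ s in a..t, ζ s, ?_, HasCompactSupport.of_support_subset_isCompact isCompact_Icc
    hsupp, fun t ht => ⟨by linarith [(hts ht).1], by linarith [(hts ht).2]⟩, hd⟩
  rw [contDiff_infty_iff_deriv]
  refine ⟨fun t => (hd t).differentiableAt, ?_⟩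
  rwa [show deriv (fun t => ∫ s in a..t, ζ s) = ζ from funext fun t => (hd t).deriv]

/-- The du Bois-Reymond argument: subtracting its mean times a fixed normalized bump from η leaves a
function of mean zero, hence a derivative. Continuity upgrades the almost everywhere identity and
reaches the end points. -/
theorem eq_const_of_weak_deriv {g : ℝ → ℝ} (hg : Continuous g) {T : ℝ} (hT : 0 < T)
    (h : ∀ θ ζ : ℝ → ℝ, ContDiff ℝ ∞ θ → HasCompactSupport θ → tsupport θ ⊆ Ioo 0 T →
      (∀ t, HasDerivAt θ (ζ t) t) → ∫ t, ζ t * g t = 0) :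
    ∃ k, ∀ t ∈ Icc 0 T, g t = k := by
  let f : ContDiffBump (T / 2) := ⟨T / 8, T / 4, by linarith, by linarith⟩
  set η₀ : ℝ → ℝ := f.normed volume with hη₀
  have hη₀d : ContDiff ℝ ∞ η₀ := f.contDiff_normed
  have hη₀c : HasCompactSupport η₀ := f.hasCompactSupport_normed
  have hη₀s : tsupport η₀ ⊆ Ioo 0 T := by
    rw [hη₀, f.tsupport_normed_eq, Real.closedBall_eq_Icc]
    intro t ht
    have h1 : f.rOut = T / 4 := rfl
    rw [h1] at ht
    exact ⟨by linarith [ht.1], by linarith [ht.2]⟩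
  have hη₀i : ∫ t, η₀ t = 1 := f.integral_normed
  have hint {η : ℝ → ℝ} (h1 : Continuous η) (h2 : HasCompactSupport η) {k : ℝ → ℝ}
      (hk : Continuous k) : Integrable fun t => η t * k t :=
    (h1.mul hk).integrable_of_hasCompactSupport h2.mul_right
  have hint' {η : ℝ → ℝ} (h1 : Continuous η) (h2 : HasCompactSupport η) : Integrable η :=
    h1.integrable_of_hasCompactSupport h2
  set k := ∫ t, η₀ t * g t with hk
  refine ⟨k, ?_⟩
  have hae : ∀ᵐ t, t ∈ Ioo 0 T → g t - k = 0 := by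
    refine isOpen_Ioo.ae_eq_zero_of_integral_contDiff_smul_eq_zero
      ((hg.sub continuous_const).locallyIntegrable.locallyIntegrableOn _) fun η hη hηc hηs => ?_
    have hζd : ContDiff ℝ ∞ fun t => η t - (∫ s, η s) * η₀ t := hη.sub (contDiff_const.mul hη₀d)
    have hη0' : HasCompactSupport fun t => (∫ s, η s) * η₀ t := hη₀c.mul_left
    have hζc : HasCompactSupport fun t => η t - (∫ s, η s) * η₀ t := hηc.sub hη0'
    have hζs : tsupport (fun t => η t - (∫ s, η s) * η₀ t) ⊆ Ioo 0 T :=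
      (tsupport_sub η fun t => (∫ s, η s) * η₀ t).trans
        (union_subset hηs ((tsupport_mul_subset_right (f := fun _ => ∫ s, η s) (g := η₀)).trans hη₀s))
    have hζ0 : ∫ t, (η t - (∫ s, η s) * η₀ t) = 0 := by
      rw [integral_sub (hint' hη.continuous hηc) ((hint' hη₀d.continuous hη₀c).const_mul _),
        integral_const_mul, hη₀i, mul_one, sub_self]
    obtain ⟨θ, h1, h2, h3, h4⟩ := exists_primitive hζd hT hζc hζs hζ0
    have h5 := h θ _ h1 h2 h3 h4
    simp only [sub_mul, mul_assoc] at h5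
    rw [integral_sub (hint hη.continuous hηc hg) ((hint hη₀d.continuous hη₀c hg).const_mul _),
      integral_const_mul, ← hk] at h5
    simp only [smul_eq_mul, mul_sub]
    rw [integral_sub (hint hη.continuous hηc hg) ((hint' hη.continuous hηc).mul_const _),
      integral_mul_const]
    exact h5
  have hIoo : ∀ t ∈ Ioo 0 T, g t = k := by
    have := Measure.eqOn_open_of_ae_eq (μ := (volume : Measure ℝ)) (f := g) (g := fun _ => k)
      (U := Ioo 0 T) ((ae_restrict_iff' measurableSet_Ioo).2
        (hae.mono fun t ht hm => sub_eq_zero.1 (ht hm))) isOpen_Ioo hg.continuousOn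
        continuousOn_const
    exact this
  intro t ht
  have hcl : t ∈ closure (Ioo 0 T) := by rwa [closure_Ioo hT.ne]
  exact closure_minimal (t := {t | g t = k}) hIoo (isClosed_eq hg continuous_const) hcl

/-! #### Products of functions of time and space -/

section Product

variable {Ω : Set E3} {T : ℝ} {θ : ℝ → ℝ} {ψ : E3 → ℝ}

theorem tsupport_prod_subset (θ : ℝ → ℝ) (ψ : E3 → ℝ) :
    tsupport (fun z : ℝ × E3 => θ z.1 * ψ z.2) ⊆ tsupport θ ×ˢ tsupport ψ := by
  refine closure_minimal (fun z hz => ?_) ((isClosed_tsupport θ).prod (isClosed_tsupport ψ))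
  rw [Function.mem_support, mul_ne_zero_iff] at hz
  exact ⟨subset_tsupport _ hz.1, subset_tsupport _ hz.2⟩

theorem IsTestFn.prod (hψ : IsTestFn Ω ψ) (hθ : ContDiff ℝ ∞ θ) (hc : HasCompactSupport θ)
    (hs : tsupport θ ⊆ Ioo 0 T) : IsTest (Ioo 0 T ×ˢ Ω) fun z => θ z.1 * ψ z.2 :=
  ⟨(hθ.comp contDiff_fst).mul (hψ.1.comp contDiff_snd),
    (hc.isCompact.prod hψ.2.1.isCompact).of_isClosed_subset (isClosed_tsupport _)
      (tsupport_prod_subset θ ψ),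
    (tsupport_prod_subset θ ψ).trans (prod_mono hs hψ.2.2)⟩

theorem toL6_mono_toV (hψ : IsTestFn Ω ψ) :
    toL6 univ (hψ.mono (subset_univ _)).toV = toL6 Ω hψ.toV :=
  Lp.ext ((coeFn_toL6 _).trans (coeFn_toL6 hψ.toV).symm)

theorem sliceV_prod (hψ : IsTestFn univ ψ) (hφ : IsTest univ fun z : ℝ × E3 => θ z.1 * ψ z.2)
    (t : ℝ) : hφ.sliceV t = θ t • hψ.toV := by
  refine Subtype.ext (Prod.ext (Lp.ext ?_) (Lp.ext ?_))
  · refine (hφ.slice t).coeFn_toV_fst.trans ?_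
    refine EventuallyEq.trans ?_ (Lp.coeFn_smul (θ t) hψ.toV.1.1).symm
    filter_upwards [hψ.coeFn_toV_fst] with x hx
    rw [Pi.smul_apply, hx, smul_eq_mul]
  · refine (hφ.slice t).coeFn_toV_snd.trans ?_
    refine EventuallyEq.trans ?_ (Lp.coeFn_smul (θ t) hψ.toV.1.2).symm
    filter_upwards [hψ.coeFn_toV_snd] with x hx
    rw [Pi.smul_apply, hx]
    exact congrFun (gradient_smul_fn hψ.differentiable (θ t)) x

theorem sliceT_prod {ζ : ℝ → ℝ} (hψ : IsTestFn univ ψ)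
    (hφ : IsTest univ fun z : ℝ × E3 => θ z.1 * ψ z.2) (hζ : ∀ t, HasDerivAt θ (ζ t) t) (t : ℝ) :
    hφ.sliceT t = ζ t • hψ.toV.1.1 := by
  refine Lp.ext ((coeFn_slice (p := 2) hφ.continuous_derivT hφ.hasCompactSupport_derivT t).trans ?_)
  refine EventuallyEq.trans ?_ (Lp.coeFn_smul (ζ t) hψ.toV.1.1).symm
  filter_upwards [hψ.coeFn_toV_fst] with x hx
  rw [Pi.smul_apply, hx, smul_eq_mul]
  exact ((hζ t).mul_const (ψ x)).deriv

end Product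

/-! #### Construction of the path in `H¹₀ × L²` -/

section Construction

variable {Ω : Set E3} {t₀ T : ℝ} {u : ℝ → H10 Ω} {v : ℝ → L2 Ω}

/-- The solution, with time clamped to `[0, T]`. -/
def clampU (hΩ : MeasurableSet Ω) (u : ℝ → H10 Ω) (hT : 0 ≤ T) (t : ℝ) : VSub Ω :=
  h10ToV hΩ (u (projIcc 0 T hT t))

/-- The velocity, with time clamped to `[0, T]`. -/
def clampV (hΩ : MeasurableSet Ω) (v : ℝ → L2 Ω) (hT : 0 ≤ T) (t : ℝ) : H :=
  extZero hΩ (v (projIcc 0 T hT t))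

theorem clampU_of_mem (hΩ : MeasurableSet Ω) (u : ℝ → H10 Ω) (hT : 0 ≤ T) {t : ℝ}
    (ht : t ∈ Icc 0 T) : clampU hΩ u hT t = h10ToV hΩ (u t) := by
  rw [clampU, projIcc_of_mem hT ht]

theorem clampV_of_mem (hΩ : MeasurableSet Ω) (v : ℝ → L2 Ω) (hT : 0 ≤ T) {t : ℝ}
    (ht : t ∈ Icc 0 T) : clampV hΩ v hT t = extZero hΩ (v t) := by
  rw [clampV, projIcc_of_mem hT ht]

theorem uniformContinuous_clamp {X : Type*} [PseudoMetricSpace X] {f : ℝ → X} (hT : 0 ≤ T)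
    (hf : ContinuousOn f (Icc 0 T)) : UniformContinuous fun t => f (projIcc 0 T hT t) := by
  have h1 : Continuous fun s : Icc 0 T => f s := continuousOn_iff_continuous_domRestrict.1 hf
  exact (CompactSpace.uniformContinuous_of_continuous h1).comp
    (LipschitzWith.projIcc hT).uniformContinuous

/-- The equation tested with a function of the space variables. -/
theorem eqn_testFn (hΩ : MeasurableSet Ω) (h : IsWeakSolution Ω t₀ u v) (hT : 0 < T) (hTt : T < t₀)
    (hcU : Continuous (clampU hΩ u hT.le)) (hcV : Continuous (clampV hΩ v hT.le))
    {ψ : E3 → ℝ} (hψ : IsTestFn Ω ψ) {s t : ℝ} (hs : 0 ≤ s) (hst : s ≤ t) (ht : t ≤ T) :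
    inner ℝ (clampV hΩ v hT.le t - clampV hΩ v hT.le s) hψ.toV.1.1 =
      - ∫ r in s..t, (inner ℝ (clampU hΩ u hT.le r).1.2 hψ.toV.1.2 +
        quint (toL6 Ω (clampU hΩ u hT.le r)) (toL6 Ω hψ.toV)) := by
  set U := clampU hΩ u hT.le with hUdef
  set V := clampV hΩ v hT.le with hVdef
  set f1 : ℝ → ℝ := fun r => inner ℝ (V r) hψ.toV.1.1 with hf1
  set f2 : ℝ → ℝ := fun r => inner ℝ (U r).1.2 hψ.toV.1.2 +
    quint (toL6 Ω (U r)) (toL6 Ω hψ.toV) with hf2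
  have hf1c : Continuous f1 := hcV.inner continuous_const
  have hf2c : Continuous f2 :=
    (((sndV Ω).continuous.comp hcU).inner continuous_const).add
      (continuous_quint_comp hcU continuous_const)
  set F2 : ℝ → ℝ := fun r => ∫ r' in (0 : ℝ)..r, f2 r' with hF2
  have hF2d (r : ℝ) : HasDerivAt F2 (f2 r) r :=
    intervalIntegral.integral_hasDerivAt_right (hf2c.intervalIntegrable _ _)
      (hf2c.stronglyMeasurableAtFilter _ _) hf2c.continuousAt
  have hF2c : Continuous F2 := continuous_iff_continuousAt.2 fun r => (hF2d r).continuousAt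
  -- The weak equation tested with θ(t)ψ(x) says that f1 has weak derivative −f2. Since F2 is a
  -- primitive of f2, the sum f1 + F2 is constant.
  obtain ⟨k, hk⟩ := eq_const_of_weak_deriv (g := fun r => f1 r + F2 r) (hf1c.add hF2c) hT (by
    intro θ ζ hθ hθc hθs hd
    have hζ : ζ = deriv θ := funext fun r => (hd r).deriv.symm
    have hζc : Continuous ζ := by rw [hζ]; exact hθ.continuous_deriv (by simp)
    have hζs : Function.support ζ ⊆ tsupport θ := by rw [hζ]; exact support_deriv_subset
    obtain ⟨a, b, ha, hab, hb, hKab⟩ := exists_Ioo_of_isCompact hθc hT hθs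
    have hz (r : ℝ) (hr : r ∉ Ioo a b) : θ r = 0 :=
      image_eq_zero_of_notMem_tsupport fun hh => hr (hKab hh)
    have hz' (r : ℝ) (hr : r ∉ Ioo a b) : ζ r = 0 := by
      by_contra hne
      exact hr (hKab (hζs hne))
    have hφ := hψ.prod hθ hθc hθs
    have hφu : IsTest univ fun z : ℝ × E3 => θ z.1 * ψ z.2 := hφ.mono (subset_univ _)
    have hw0 := h.equation _ (hφ.mono (prod_mono (Ioo_subset_Ioo_right hTt.le) subset_rfl))
    rw [weakForm_eq (U := U) (V := V) hΩ hTt.le (fun r hr => clampU_of_mem hΩ u hT.le hr)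
      (fun r hr => clampV_of_mem hΩ v hT.le hr) hφu ha hab hb
      ((tsupport_prod_subset θ ψ).trans (prod_mono hKab (subset_univ _)))] at hw0
    have hw (r : ℝ) : weakGreen U V hφu 0 r = θ r * f2 r - ζ r * f1 r := by
      unfold weakGreen
      rw [sliceV_prod (hψ.mono (subset_univ _)), sliceT_prod (hψ.mono (subset_univ _)) hφu hd,
        avg_zero, avg_zero]
      simp only [zero_mul, add_zero, intervalIntegral.integral_const, sub_zero, one_smul, map_smul,
        quint_smul, real_inner_smul_right]
      rw [toL6_mono_toV hψ]
      have e1 : inner ℝ (U r).1.2 (θ r • (hψ.mono (subset_univ _)).toV).1.2 =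
        θ r * inner ℝ (U r).1.2 hψ.toV.1.2 := real_inner_smul_right _ _ _
      have e2 : inner ℝ (V r) (hψ.mono (subset_univ _)).toV.1.1 = f1 r := rfl
      rw [e1, e2, hf2]
      ring
    simp only [hw] at hw0
    have hparts := intervalIntegral.integral_eq_sub_of_hasDerivAt (a := a) (b := b)
      (fun r _ => (hd r).mul (hF2d r))
      (((hζc.mul hF2c).add (hθ.continuous.mul hf2c)).intervalIntegrable _ _)
    have hza : θ a = 0 := hz a fun hh => lt_irrefl _ hh.1
    have hzb : θ b = 0 := hz b fun hh => lt_irrefl _ hh.2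
    simp only [Pi.mul_apply, hza, hzb, zero_mul, sub_zero] at hparts
    have i1 : IntervalIntegrable (fun r => θ r * f2 r - ζ r * f1 r) volume a b :=
      ((hθ.continuous.mul hf2c).sub (hζc.mul hf1c)).intervalIntegrable _ _
    have i2 : IntervalIntegrable (fun r => ζ r * F2 r + θ r * f2 r) volume a b :=
      ((hζc.mul hF2c).add (hθ.continuous.mul hf2c)).intervalIntegrable _ _
    have h1 : ∫ r in a..b, ζ r * (f1 r + F2 r) = 0 := by
      have := intervalIntegral.integral_sub i2 i1
      rw [hw0, hparts, sub_zero] at this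
      rw [← this]
      refine intervalIntegral.integral_congr fun r _ => ?_
      ring
    rw [intervalIntegral.integral_of_le hab] at h1
    rw [← h1]
    refine (setIntegral_eq_integral_of_forall_compl_eq_zero fun r hr => ?_).symm
    rw [hz' r fun hh => hr (Ioo_subset_Ioc_self hh), zero_mul])
  have h1 := hk t ⟨hs.trans hst, ht⟩
  have h2 := hk s ⟨hs, hst.trans ht⟩
  have h3 : F2 t - F2 s = ∫ r in s..t, f2 r :=
    intervalIntegral.integral_interval_sub_left (hf2c.intervalIntegrable _ _)
      (hf2c.intervalIntegrable _ _)
  rw [inner_sub_left]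
  change f1 t - f1 s = -∫ r in s..t, f2 r
  linarith

/-- Since T < t₀, the paths are continuous on the compact interval [0,T], hence uniformly continuous
after clamping. The tested equation extends from test functions to all of H¹₀ by density, both sides
being continuous in the test element. -/
theorem isSol_clamp (hΩ : MeasurableSet Ω) (h : IsWeakSolution Ω t₀ u v) (hT : 0 < T)
    (hTt : T < t₀) : IsSol Ω T (clampU hΩ u hT.le) (clampV hΩ v hT.le) := by
  have hsub : Icc 0 T ⊆ Ico 0 t₀ := fun t ht => ⟨ht.1, ht.2.trans_lt hTt⟩
  have hucU : UniformContinuous (clampU hΩ u hT.le) :=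
    uniformContinuous_clamp (f := fun t => h10ToV hΩ (u t)) hT.le
      ((h10ToV hΩ).continuous.comp_continuousOn (h.isInX.continuousOn.mono hsub))
  have hucV : UniformContinuous (clampV hΩ v hT.le) :=
    uniformContinuous_clamp (f := fun t => extZero hΩ (v t)) hT.le
      ((extZero hΩ).continuous.comp_continuousOn (h.isInX.continuousOn_deriv.mono hsub))
  refine ⟨hucU, hucV, ?_, ?_, ?_, fun t => ?_⟩
  · intro s t hs hst ht
    rw [clampU_of_mem hΩ u hT.le ⟨hs.trans hst, ht⟩, clampU_of_mem hΩ u hT.le ⟨hs, hst.trans ht⟩]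
    refine (intervalIntegral.integral_eq_sub_of_hasDerivAt_of_le
      (f := fun r => extZero hΩ (H10.fn (u r))) hst ?_ (fun r hr => ?_)
      (hucV.continuous.intervalIntegrable _ _)).symm
    · have hc : ContinuousOn (fun r => (h10ToV hΩ (u r)).1.1) (Icc s t) :=
        ((fstV Ω).continuous.comp (h10ToV hΩ).continuous).comp_continuousOn
          (h.isInX.continuousOn.mono ((Icc_subset_Icc hs ht).trans hsub))
      exact hc
    · have hr0 : r ∈ Ioo 0 T := ⟨by linarith [hr.1], by linarith [hr.2]⟩
      have hr1 : r ∈ Icc 0 T := Ioo_subset_Icc_self hr0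
      have h1 := (h.isInX.hasDeriv r (hsub hr1)).hasDerivAt
        (Ico_mem_nhds hr0.1 (hr0.2.trans hTt))
      rw [clampV_of_mem hΩ v hT.le hr1]
      exact (extZero (F := ℝ) hΩ).toContinuousLinearMap.hasFDerivAt.comp_hasDerivAt r h1
  · intro ψ s t hs hst ht
    have hclosed : IsClosed {ψ : VSub Ω |
        inner ℝ (clampV hΩ v hT.le t - clampV hΩ v hT.le s) ψ.1.1 =
        - ∫ r in s..t, (inner ℝ (clampU hΩ u hT.le r).1.2 ψ.1.2 +
          quint (toL6 Ω (clampU hΩ u hT.le r)) (toL6 Ω ψ))} := by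
      refine isClosed_eq (Continuous.inner continuous_const (fstV Ω).continuous) (Continuous.neg ?_)
      refine intervalIntegral.continuous_parametric_intervalIntegral_of_continuous' ?_ s t
      have hc : Continuous fun q : VSub Ω × ℝ => clampU hΩ u hT.le q.2 :=
        hucU.continuous.comp continuous_snd
      exact (((sndV Ω).continuous.comp hc).inner ((sndV Ω).continuous.comp continuous_fst)).add
        (continuous_quint_comp hc continuous_fst)
    have hψ : ψ.1 ∈ closure (testPairs Ω : Set (H × G)) := ψ.2
    obtain ⟨x, hx, hlim⟩ := mem_closure_iff_seq_limit.1 hψ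
    have hlim' : Tendsto (fun n => (⟨x n, Submodule.le_topologicalClosure _ (hx n)⟩ : VSub Ω)) atTop
        (𝓝 ψ) := tendsto_subtype_rng.2 hlim
    refine hclosed.mem_of_tendsto hlim' (Eventually.of_forall fun n => ?_)
    obtain ⟨φ, hφ, h1, h2⟩ := hx n
    have he : (⟨x n, Submodule.le_topologicalClosure _ (hx n)⟩ : VSub Ω) = hφ.toV :=
      Subtype.ext (Prod.ext (Lp.ext (h1.trans hφ.coeFn_toV_fst.symm))
        (Lp.ext (h2.trans hφ.coeFn_toV_snd.symm)))
    rw [mem_ofPred_eq, he]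
    exact eqn_testFn hΩ h hT hTt hucU.continuous hucV.continuous hφ hs hst ht
  · have hT' : (T + t₀) / 2 ∈ Ioo 0 t₀ := ⟨by linarith, by linarith⟩
    refine lt_of_le_of_lt ?_ (h.isInX.locally_L5_L10 _ hT')
    refine (setLIntegral_mono' measurableSet_Ioc fun t ht => le_of_eq ?_).trans
      (lintegral_mono_set (μ := volume) fun t (ht : t ∈ Ioc 0 T) =>
        (⟨ht.1, by linarith [ht.2]⟩ : t ∈ Ioo 0 ((T + t₀) / 2)))
    rw [clampU_of_mem hΩ u hT.le (Ioc_subset_Icc_self ht)]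
    congr 1
    rw [← eLpNorm_indicator_eq_eLpNorm_restrict hΩ]
    exact eLpNorm_congr_ae (coeFn_extZero hΩ (H10.fn (u t)))
  · filter_upwards [coeFn_extZero hΩ (v (projIcc 0 T hT.le t))] with x hx hxΩ
    have : clampV hΩ v hT.le t x = _ := hx
    rw [this, indicator_of_notMem hxΩ]

end Construction

/-! ### The normal derivative -/

theorem IsTest.add {S : Set (ℝ × E3)} {φ φ' : ℝ × E3 → ℝ} (h : IsTest S φ) (h' : IsTest S φ') :
    IsTest S (φ + φ') :=
  ⟨h.1.add h'.1, h.2.1.add h'.2.1, (tsupport_add _ _).trans (union_subset h.2.2 h'.2.2)⟩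

theorem IsTest.smul {S : Set (ℝ × E3)} {φ : ℝ × E3 → ℝ} (h : IsTest S φ) (c : ℝ) :
    IsTest S (c • φ) :=
  ⟨contDiff_const.smul h.1, h.2.1.smul_left (f := fun _ => c),
    (tsupport_smul_subset_right (fun _ => c) φ).trans h.2.2⟩

/-- The space of test functions. -/
def testSpace (S : Set (ℝ × E3)) : Submodule ℝ (ℝ × E3 → ℝ) where
  carrier := {φ | IsTest S φ}
  add_mem' := IsTest.add
  zero_mem' := ⟨contDiff_const, HasCompactSupport.zero, by simp [tsupport]⟩
  smul_mem' c _ h := h.smul c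

theorem weakGreen_zero {Ω : Set E3} (U : ℝ → VSub Ω) (V : ℝ → H) {φ : ℝ × E3 → ℝ}
    (hφ : IsTest univ φ) (t : ℝ) : weakGreen U V hφ 0 t =
      inner ℝ (U t).1.2 (hφ.sliceV t).1.2 - inner ℝ (V t) (hφ.sliceT t) +
        quint (toL6 Ω (U t)) (toL6 univ (hφ.sliceV t)) := by
  unfold weakGreen
  rw [avg_zero, avg_zero]
  simp

theorem weakGreen_add {Ω : Set E3} (U : ℝ → VSub Ω) (V : ℝ → H) {φ φ' : ℝ × E3 → ℝ}
    (h : IsTest univ φ) (h' : IsTest univ φ') (t : ℝ) :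
    weakGreen U V (h.add h') 0 t = weakGreen U V h 0 t + weakGreen U V h' 0 t := by
  have e1 : (h.add h').sliceV t = h.sliceV t + h'.sliceV t :=
    IsTestFn.toV_add (h.slice t) (h'.slice t) ((h.add h').slice t) rfl
  have e2 : (h.add h').sliceT t = h.sliceT t + h'.sliceT t := by
    have h3 := (h.add h').hasDerivAt_sliceV t
    have h4 := (h.hasDerivAt_sliceV t).add (h'.hasDerivAt_sliceV t)
    refine h3.unique (h4.congr_of_eventuallyEq (Eventually.of_forall fun s => ?_))
    exact congrArg (fun x : VSub univ => x.1.1)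
      (IsTestFn.toV_add (h.slice s) (h'.slice s) ((h.add h').slice s) rfl)
  have e3 : (h.sliceV t + h'.sliceV t).1.2 = (h.sliceV t).1.2 + (h'.sliceV t).1.2 := rfl
  rw [weakGreen_zero, weakGreen_zero, weakGreen_zero, e1, e2, map_add, quint_add, e3,
    inner_add_right, inner_add_right]
  ring

theorem weakGreen_smul {Ω : Set E3} (U : ℝ → VSub Ω) (V : ℝ → H) {φ : ℝ × E3 → ℝ}
    (h : IsTest univ φ) (c t : ℝ) :
    weakGreen U V (h.smul c) 0 t = c * weakGreen U V h 0 t := by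
  have e1 (s : ℝ) : (h.smul c).sliceV s = c • h.sliceV s := by
    have h1 := (h.slice s).coeFn_toV_fst
    have h2 := (h.slice s).coeFn_toV_snd
    refine Subtype.ext (Prod.ext (Lp.ext ?_) (Lp.ext ?_))
    · refine ((h.smul c).slice s).coeFn_toV_fst.trans ?_
      refine EventuallyEq.trans ?_ (Lp.coeFn_smul c (h.sliceV s).1.1).symm
      filter_upwards [h1] with x hx
      exact congrArg (c • ·) hx.symm
    · refine ((h.smul c).slice s).coeFn_toV_snd.trans ?_
      refine EventuallyEq.trans ?_ (Lp.coeFn_smul c (h.sliceV s).1.2).symm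
      filter_upwards [h2] with x hx
      exact (congrFun (gradient_smul_fn (h.slice s).differentiable c) x).trans
        (congrArg (c • ·) hx.symm)
  have e2 : (h.smul c).sliceT t = c • h.sliceT t := by
    refine ((h.smul c).hasDerivAt_sliceV t).unique
      (((h.hasDerivAt_sliceV t).const_smul c).congr_of_eventuallyEq (Eventually.of_forall fun s => ?_))
    exact congrArg (fun x : VSub univ => x.1.1) (e1 s)
  have e3 : (c • h.sliceV t).1.2 = c • (h.sliceV t).1.2 := rfl
  rw [weakGreen_zero, weakGreen_zero, e1, e2, map_smul, quint_smul, e3, inner_smul_right,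
    inner_smul_right]
  ring

section Trace

variable {Ω : Set E3} {t₀ : ℝ} {u : ℝ → H10 Ω} {v : ℝ → L2 Ω}

theorem IsSol.continuous_weakGreen_zero {T : ℝ} {U : ℝ → VSub Ω} {V : ℝ → H} (h : IsSol Ω T U V)
    {φ : ℝ × E3 → ℝ} (hφ : IsTest univ φ) : Continuous fun t => weakGreen U V hφ 0 t :=
  Continuous.comp (g := fun p : ℝ × ℝ => weakGreen U V hφ p.1 p.2) (f := fun t => ((0 : ℝ), t))
    (h.continuous_weakGreen hφ) (by fun_prop)

/-- Splitting the time integral needs integrability, which comes from continuity in time on a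
compact interval containing both supports; this is where the solution class is used. -/
theorem weakForm_add (hΩ : MeasurableSet Ω) (ht₀ : 0 < t₀) (h : IsWeakSolution Ω t₀ u v)
    {φ φ' : ℝ × E3 → ℝ} (hφ : IsTest (Ioo 0 t₀ ×ˢ univ) φ) (hφ' : IsTest (Ioo 0 t₀ ×ˢ univ) φ') :
    weakForm Ω t₀ u v (φ + φ') = weakForm Ω t₀ u v φ + weakForm Ω t₀ u v φ' := by
  obtain ⟨a₁, b₁, ha₁, hab₁, hb₁, hs₁⟩ := hφ.exists_Ioo ht₀
  obtain ⟨a₂, b₂, ha₂, hab₂, hb₂, hs₂⟩ := hφ'.exists_Ioo ht₀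
  set a := min a₁ a₂
  set b := max b₁ b₂
  have ha : 0 < a := lt_min ha₁ ha₂
  have hab : a ≤ b := (min_le_left _ _).trans (hab₁.trans (le_max_left _ _))
  have hb : b < t₀ := max_lt hb₁ hb₂
  have hs : tsupport φ ⊆ Ioo a b ×ˢ univ :=
    hs₁.trans (prod_mono (Ioo_subset_Ioo (min_le_left _ _) (le_max_left _ _)) subset_rfl)
  have hs' : tsupport φ' ⊆ Ioo a b ×ˢ univ :=
    hs₂.trans (prod_mono (Ioo_subset_Ioo (min_le_right _ _) (le_max_right _ _)) subset_rfl)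
  have hs'' : tsupport (φ + φ') ⊆ Ioo a b ×ˢ univ :=
    (tsupport_add _ _).trans (union_subset hs hs')
  have hT : 0 < (b + t₀) / 2 := by linarith
  have hTt : (b + t₀) / 2 < t₀ := by linarith
  have hbT : b < (b + t₀) / 2 := by linarith
  have hsol := isSol_clamp hΩ h hT hTt
  have key {ψ : ℝ × E3 → ℝ} (hψ : IsTest univ ψ) (hψs : tsupport ψ ⊆ Ioo a b ×ˢ univ) :=
    weakForm_eq hΩ hTt.le (U := clampU hΩ u hT.le) (V := clampV hΩ v hT.le)
      (fun r hr => clampU_of_mem hΩ u hT.le hr)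
      (fun r hr => clampV_of_mem hΩ v hT.le hr) hψ ha hab hbT hψs
  have hu := hφ.mono (subset_univ _)
  have hu' := hφ'.mono (subset_univ _)
  rw [key hu hs, key hu' hs', key (hu.add hu') hs'']
  simp only [weakGreen_add _ _ hu hu']
  exact intervalIntegral.integral_add ((hsol.continuous_weakGreen_zero hu).intervalIntegrable _ _)
    ((hsol.continuous_weakGreen_zero hu').intervalIntegrable _ _)

theorem weakForm_smul (hΩ : MeasurableSet Ω) (ht₀ : 0 < t₀)
    {φ : ℝ × E3 → ℝ} (hφ : IsTest (Ioo 0 t₀ ×ˢ univ) φ) (c : ℝ) :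
    weakForm Ω t₀ u v (c • φ) = c * weakForm Ω t₀ u v φ := by
  obtain ⟨a, b, ha, hab, hb, hs⟩ := hφ.exists_Ioo ht₀
  have key {ψ : ℝ × E3 → ℝ} (hψ : IsTest univ ψ) (hψs : tsupport ψ ⊆ Ioo a b ×ˢ univ) :=
    weakForm_eq hΩ le_rfl (U := clampU hΩ u ht₀.le) (V := clampV hΩ v ht₀.le)
      (fun r hr => clampU_of_mem hΩ u ht₀.le hr)
      (fun r hr => clampV_of_mem hΩ v ht₀.le hr) hψ ha hab hb hψs
  have hu := hφ.mono (subset_univ _)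
  rw [key hu hs, key (hu.smul c) ((tsupport_smul_subset_right (fun _ => c) φ).trans hs)]
  simp only [weakGreen_smul _ _ hu]
  exact intervalIntegral.integral_const_mul _ _

theorem isFiniteMeasure_lateralMeasure (hΩ : IsSmoothBoundedDomain Ω) (t₀ : ℝ) :
    IsFiniteMeasure (lateralMeasure Ω t₀) := by
  have := isFiniteMeasure_surfaceMeasure hΩ
  have : IsFiniteMeasure ((volume : Measure ℝ).restrict (Ioo 0 t₀)) :=
    ⟨by rw [Measure.restrict_apply_univ, Real.volume_Ioo]; exact ENNReal.ofReal_lt_top⟩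
  unfold lateralMeasure
  infer_instance

theorem IsTest.memLp_lateral (hΩ : IsSmoothBoundedDomain Ω) {S : Set (ℝ × E3)} {φ : ℝ × E3 → ℝ}
    (hφ : IsTest S φ) : MemLp φ 2 (lateralMeasure Ω t₀) := by
  have := isFiniteMeasure_lateralMeasure hΩ t₀
  obtain ⟨K, hK⟩ := hφ.2.1.exists_bound_of_continuous hφ.1.continuous
  exact MemLp.of_bound hφ.1.continuous.aestronglyMeasurable K (Eventually.of_forall hK)

theorem IsTest.sq_norm_toLp (hΩ : IsSmoothBoundedDomain Ω) {φ : ℝ × E3 → ℝ}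
    (hφ : IsTest (Ioo 0 t₀ ×ˢ univ) φ) {a b : ℝ} (ha : 0 < a) (hab : a ≤ b) (hb : b < t₀)
    (hs : tsupport φ ⊆ Ioo a b ×ˢ univ) :
    ‖(hφ.memLp_lateral (t₀ := t₀) hΩ).toLp φ‖ ^ 2 =
      ∫ t in a..b, ∫ x, φ (t, x) ^ 2 ∂(surfaceMeasure Ω) := by
  have := isFiniteMeasure_surfaceMeasure hΩ
  have hm := hφ.memLp_lateral (t₀ := t₀) hΩ
  rw [← real_inner_self_eq_norm_sq, L2.inner_def]
  have h1 : ∫ z, inner ℝ ((hm.toLp φ) z) ((hm.toLp φ) z) ∂(lateralMeasure Ω t₀) =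
      ∫ z, φ z ^ 2 ∂(lateralMeasure Ω t₀) := by
    refine integral_congr_ae ?_
    filter_upwards [hm.coeFn_toLp] with z hz
    rw [hz, real_inner_self_eq_norm_sq, Real.norm_eq_abs, sq_abs]
  have hi : Integrable (fun z => φ z ^ 2) (lateralMeasure Ω t₀) := hm.integrable_sq
  rw [h1]
  unfold lateralMeasure at hi ⊢
  rw [integral_prod _ hi, intervalIntegral.integral_of_le hab, ← integral_Icc_eq_integral_Ioc]
  refine setIntegral_eq_of_subset_of_forall_sdiff_eq_zero measurableSet_Ioo
    (fun t ht => ⟨by linarith [ht.1], by linarith [ht.2]⟩) ?_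
  rintro t ⟨-, ht⟩
  have h3 (x : E3) : φ (t, x) = 0 :=
    image_eq_zero_of_notMem_tsupport fun hh => ht (Ioo_subset_Icc_self (hs hh).1)
  simp [h3]

/-- Optimization in μ by the discriminant of the quadratic KEμ² − Wμ + KN², which is non-negative
for every real μ. The degenerate cases E = 0 and N = 0 need no separate treatment. -/
theorem abs_le_of_forall_mul_add_div {W K E N : ℝ} (hW : 0 ≤ W) (hE : 0 ≤ E) (hN : 0 ≤ N) (hK : 0 ≤ K)
    (h : ∀ μ > 0, W ≤ K * (μ * E + 1 / μ * N ^ 2)) : W ≤ 2 * K * E ^ (1 / 2 : ℝ) * N := by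
  have h1 (μ : ℝ) : 0 ≤ K * E * (μ * μ) + -W * μ + K * N ^ 2 := by
    rcases le_or_gt μ 0 with hμ | hμ
    · have : 0 ≤ -W * μ := by nlinarith
      have := mul_self_nonneg μ
      positivity
    · have h2 := mul_le_mul_of_nonneg_left (h μ hμ) hμ.le
      have e1 : μ * (K * (μ * E + 1 / μ * N ^ 2)) = K * E * (μ * μ) + K * N ^ 2 := by
        field_simp
      linarith
  have h3 := discrim_le_zero h1
  rw [discrim] at h3
  rw [← Real.sqrt_eq_rpow]
  refine le_of_sq_le_sq ?_ (by positivity)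
  rw [mul_pow, mul_pow, mul_pow, Real.sq_sqrt hE]
  nlinarith

theorem abs_weakForm_le (hΩ : IsSmoothBoundedDomain Ω) (ht₀ : 0 < t₀) {K : ℝ} (hK : 0 < K)
    (hbd : GreenBound Ω t₀ K fun _ => True) (h : IsWeakSolution Ω t₀ u v) {φ : ℝ × E3 → ℝ}
    (hφ : IsTest (Ioo 0 t₀ ×ˢ univ) φ) :
    |weakForm Ω t₀ u v φ| ≤ 2 * K * energy Ω (u 0) (v 0) ^ (1 / 2 : ℝ) *
      ‖(hφ.memLp_lateral (t₀ := t₀) hΩ).toLp φ‖ := by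
  have hm := hΩ.isOpen.measurableSet
  obtain ⟨a, b, ha, hab, hb, hs⟩ := hφ.exists_Ioo ht₀
  have hT : 0 < (b + t₀) / 2 := by linarith
  have hTt : (b + t₀) / 2 < t₀ := by linarith
  have hbT : b < (b + t₀) / 2 := by linarith
  have hsol := isSol_clamp hm h hT hTt
  have hu : IsTest univ φ := hφ.mono (subset_univ _)
  have hE : en (clampU hm u hT.le 0) (clampV hm v hT.le 0) = energy Ω (u 0) (v 0) := by
    rw [clampU_of_mem hm u hT.le ⟨le_rfl, hT.le⟩, clampV_of_mem hm v hT.le ⟨le_rfl, hT.le⟩,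
      en_eq_energy]
  have hz {t : ℝ} (ht : t ∉ Ioo a b) (x : E3) : φ (t, x) = 0 :=
    image_eq_zero_of_notMem_tsupport fun hh => ht (hs hh).1
  refine abs_le_of_forall_mul_add_div (abs_nonneg _) (hE ▸ en_nonneg _ _) (norm_nonneg _) hK.le
    fun μ hμ => ?_
  rw [hφ.sq_norm_toLp hΩ ha hab hb hs, ← hE,
    weakForm_eq hm hTt.le (fun r hr => clampU_of_mem hm u hT.le hr)
      (fun r hr => clampV_of_mem hm v hT.le hr) hu ha hab hbT hs]
  exact hsol.abs_integral_weakGreen_le hbd hTt.le ha hab hbT hu (hz fun hh => lt_irrefl _ hh.1)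
    (hz fun hh => lt_irrefl _ hh.2) hμ

/-- A linear functional which is bounded in terms of the values of a linear map in a Hilbert space
is represented by a vector. -/
theorem exists_inner_eq_of_bound {D X : Type*} [AddCommGroup D] [Module ℝ D] [NormedAddCommGroup X]
    [InnerProductSpace ℝ X] [CompleteSpace X] (A : D →ₗ[ℝ] X) (f : D →ₗ[ℝ] ℝ) {c : ℝ} (hc : 0 ≤ c)
    (h : ∀ d, |f d| ≤ c * ‖A d‖) : ∃ g : X, ‖g‖ ≤ c ∧ ∀ d, inner ℝ g (A d) = f d := by
  -- The bound forces f to vanish on the kernel of A, so f factors through A.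
  have hker : f ∈ (LinearMap.ker A).dualAnnihilator := by
    rw [Submodule.mem_dualAnnihilator]
    intro d hd
    have := h d
    rw [LinearMap.mem_ker.1 hd, norm_zero, mul_zero] at this
    exact abs_eq_zero.1 (le_antisymm this (abs_nonneg _))
  rw [← LinearMap.range_dualMap_eq_dualAnnihilator_ker] at hker
  obtain ⟨k, hk⟩ := hker
  have hk' (d : D) : k (A d) = f d := LinearMap.congr_fun hk d
  let k₁ : StrongDual ℝ (LinearMap.range A) :=
    (k.comp (LinearMap.range A).subtype).mkContinuous c fun x => by
      obtain ⟨d, hd⟩ := x.2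
      have : (k.comp (LinearMap.range A).subtype) x = f d := by
        rw [LinearMap.comp_apply, Submodule.subtype_apply, ← hd, hk']
      rw [this, Real.norm_eq_abs, Submodule.coe_norm, ← hd]
      exact h d
  -- Norm-preserving extension from the range, followed by Riesz representation; the range of A need
  -- not be dense.
  obtain ⟨k₂, hk₂, hn⟩ := exists_extension_norm_eq (LinearMap.range A) k₁
  refine ⟨(InnerProductSpace.toDual ℝ X).symm k₂, ?_, fun d => ?_⟩
  · rw [LinearIsometryEquiv.norm_map, hn]
    exact LinearMap.mkContinuous_norm_le _ hc _
  · rw [InnerProductSpace.toDual_symm_apply, hk₂ ⟨A d, d, rfl⟩]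
    exact hk' d

theorem exists_normalDeriv (hΩ : IsSmoothBoundedDomain Ω) (ht₀ : 0 < t₀) {K : ℝ} (hK : 0 < K)
    (hbd : GreenBound Ω t₀ K fun _ => True) (h : IsWeakSolution Ω t₀ u v) :
    ∃ g : ℝ × E3 → ℝ, MemLp g 2 (lateralMeasure Ω t₀) ∧ IsNormalDerivTrace Ω t₀ u v g ∧
      eLpNorm g 2 (lateralMeasure Ω t₀) ≤
        ENNReal.ofReal (2 * K * energy Ω (u 0) (v 0) ^ (1 / 2 : ℝ)) := by
  have hm := hΩ.isOpen.measurableSet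
  have hE : 0 ≤ energy Ω (u 0) (v 0) := by
    rw [← en_eq_energy hm]; exact en_nonneg _ _
  let A : testSpace (Ioo 0 t₀ ×ˢ univ) →ₗ[ℝ] Lp ℝ 2 (lateralMeasure Ω t₀) :=
    { toFun := fun φ => (IsTest.memLp_lateral hΩ φ.2).toLp φ.1
      map_add' := fun φ φ' =>
        MemLp.toLp_add (IsTest.memLp_lateral hΩ φ.2) (IsTest.memLp_lateral hΩ φ'.2)
      map_smul' := fun c φ => MemLp.toLp_const_smul c (IsTest.memLp_lateral hΩ φ.2) }
  let f : testSpace (Ioo 0 t₀ ×ˢ univ) →ₗ[ℝ] ℝ :=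
    { toFun := fun φ => weakForm Ω t₀ u v φ.1
      map_add' := fun φ φ' => weakForm_add hm ht₀ h φ.2 φ'.2
      map_smul' := fun c φ => weakForm_smul hm ht₀ φ.2 c }
  obtain ⟨g, hg, hgf⟩ := exists_inner_eq_of_bound A f
    (c := 2 * K * energy Ω (u 0) (v 0) ^ (1 / 2 : ℝ)) (by positivity)
    fun φ => abs_weakForm_le hΩ ht₀ hK hbd h φ.2
  refine ⟨g, Lp.memLp g, fun φ hφ => ?_, ?_⟩
  · have hφm := hφ.memLp_lateral (t₀ := t₀) hΩ
    refine ⟨(Lp.memLp g).integrable_mul hφm, ?_⟩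
    have h1 : weakForm Ω t₀ u v φ = inner ℝ g (A ⟨φ, hφ⟩) := (hgf ⟨φ, hφ⟩).symm
    rw [h1, L2.inner_def]
    refine integral_congr_ae ?_
    filter_upwards [hφm.coeFn_toLp] with z hz
    have h2 : A ⟨φ, hφ⟩ z = φ z := hz
    rw [h2]
    simp [mul_comm]
  · rw [← ENNReal.ofReal_toReal (Lp.eLpNorm_ne_top g), ← Lp.norm_def]
    exact ENNReal.ofReal_le_ofReal hg

end Trace

end

end QuinticWave

theorem mainTheorem6 (Ω : Set QuinticWave.E3) (hΩ : QuinticWave.IsSmoothBoundedDomain Ω)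
    (t₀ : ℝ) (ht₀ : 0 < t₀) :
    ∃ C : ℝ, 0 < C ∧ ∀ (u : ℝ → QuinticWave.H10 Ω) (v : ℝ → QuinticWave.L2 Ω),
      QuinticWave.IsWeakSolution Ω t₀ u v →
        ∃ g : ℝ × QuinticWave.E3 → ℝ,
          MemLp g 2 (QuinticWave.lateralMeasure Ω t₀) ∧
          QuinticWave.IsNormalDerivTrace Ω t₀ u v g ∧
          eLpNorm g 2 (QuinticWave.lateralMeasure Ω t₀) ≤
            ENNReal.ofReal (C * QuinticWave.energy Ω (u 0) (v 0) ^ (1 / 2 : ℝ)) := by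
  obtain ⟨K, hK, hbd⟩ := QuinticWave.exists_greenBound hΩ t₀
  exact ⟨2 * K, by positivity, fun u v h => QuinticWave.exists_normalDeriv hΩ ht₀ hK hbd h⟩
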